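/- In the problem BCPM (Bounded Correct-Parity Perfect Matching) the input is a finite simple graph $G$, each of whose edges is coloured red or blue, and an integer $k$. For a perfect matching $M$ of $G$ let $r(M)$ denote the number of red edges in $M$. The task is to output a perfect matching $M$ of $G$ with $r(M) \le k$ and $r(M) \equiv k \pmod 2$, or to report correctly that no such perfect matching exists. **Theorem.** There is a deterministic polynomial-time algorithm for BCPM on bipartite graphs. That is, there are a deterministic algorithm (a program of a random access machine whose arithmetic operations are addition and subtraction of integers, each at unit cost) and a polynomial $p$ such that, for every bipartite graph $G$ on the vertex set $\{0,\dots,n-1\}$ (given by its adjacency matrix; no bipartition is given), every set of red edges of $G$ (given by its adjacency matrix), and every integer $k$, the algorithm halts after at most $p(n+\ell(k))$ steps, where $\ell(k)$ is the number of binary digits of $|k|$ (with $\ell(0)=0$), and solves BCPM on this instance. -/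

import Mathlib

namespace BCPM

/-! ### The problem -/

/-- `r(M)`: the number of red edges in the subgraph `M`. -/
noncomputable def redCount {V : Type*} {G : SimpleGraph V} (red : Set (Sym2 V))
    (M : G.Subgraph) : ℕ :=
  (M.edgeSet ∩ red).ncard

/-- `M` is a solution of the Bounded Correct-Parity Perfect Matching instance `(G, red, k)`:
a perfect matching with at most `k` red edges whose number of red edges is congruent to `k`
modulo 2. -/
def IsSolution {V : Type*} {G : SimpleGraph V} (red : Set (Sym2 V)) (k : ℤ)
    (M : G.Subgraph) : Prop :=
  M.IsPerfectMatching ∧ (redCount red M : ℤ) ≤ k ∧ (redCount red M : ℤ) ≡ k [ZMOD 2]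

/-! ### The machine model

A deterministic random access machine. It has registers and arrays, both holding integers.
A program mentions only finitely many registers and arrays. The arithmetic instructions are
addition and subtraction only, each at unit cost. As there is no multiplication, division or
shift, the bit length of the largest number in the memory grows by at most one per step (up to
the constants written in the program), so that running times are polynomially related to those of
a Turing machine. -/

/-- The memory: `reg i` is the content of register `i`, and `arr x z` is the content of the
cell with address `z` in the array `x`. -/
@[ext]
structure Memory where
  reg : ℕ → ℤ
  arr : ℕ → ℤ → ℤ

/-- The basic instructions. -/
inductive Instr where
  /-- register `d` := the constant `c` -/
  | const (d : ℕ) (c : ℤ)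
  /-- register `d` := register `a` + register `b` -/
  | add (d a b : ℕ)
  /-- register `d` := register `a` - register `b` -/
  | sub (d a b : ℕ)
  /-- register `d` := the cell of the array `x` whose address is in register `a` -/
  | load (d x a : ℕ)
  /-- the cell of the array `x` whose address is in register `a` := register `b` -/
  | store (x a b : ℕ)

/-- The effect of a basic instruction. -/
def Instr.exec (s : Memory) : Instr → Memory
  | .const d c => { s with reg := Function.update s.reg d c }
  | .add d a b => { s with reg := Function.update s.reg d (s.reg a + s.reg b) }
  | .sub d a b => { s with reg := Function.update s.reg d (s.reg a - s.reg b) }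
  | .load d x a => { s with reg := Function.update s.reg d (s.arr x (s.reg a)) }
  | .store x a b =>
      { s with arr :=
        Function.update s.arr x (Function.update (s.arr x) (s.reg a) (s.reg b)) }

/-- Programs. -/
inductive Program where
  /-- do nothing -/
  | skip
  /-- a basic instruction -/
  | instr (i : Instr)
  /-- first `p`, then `q` -/
  | seq (p q : Program)
  /-- if register `a` is positive then `p` else `q` -/
  | cond (a : ℕ) (p q : Program)
  /-- while register `a` is positive do `p` -/
  | loop (a : ℕ) (p : Program)

/-- `Run P s t s'`: started in the memory `s`, the program `P` halts after exactly `t` steps,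
and the memory is then `s'`. Each basic instruction and each evaluation of a test is one step. -/
inductive Run : Program → Memory → ℕ → Memory → Prop where
  | skip (s : Memory) : Run .skip s 1 s
  | instr (i : Instr) (s : Memory) : Run (.instr i) s 1 (i.exec s)
  | seq {p q : Program} {s s' s'' : Memory} {t t' : ℕ}
      (hp : Run p s t s') (hq : Run q s' t' s'') : Run (.seq p q) s (t + t') s''
  | cond_pos {a : ℕ} {p q : Program} {s s' : Memory} {t : ℕ}
      (h : 0 < s.reg a) (hp : Run p s t s') : Run (.cond a p q) s (t + 1) s'
  | cond_nonpos {a : ℕ} {p q : Program} {s s' : Memory} {t : ℕ}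
      (h : s.reg a ≤ 0) (hq : Run q s t s') : Run (.cond a p q) s (t + 1) s'
  | loop_pos {a : ℕ} {p : Program} {s s' s'' : Memory} {t t' : ℕ}
      (h : 0 < s.reg a) (hp : Run p s t s') (hl : Run (.loop a p) s' t' s'') :
      Run (.loop a p) s (t + t' + 1) s''
  | loop_nonpos {a : ℕ} {p : Program} {s : Memory}
      (h : s.reg a ≤ 0) : Run (.loop a p) s 1 s

/-- The machine is deterministic. -/
theorem Run.deterministic {p : Program} {s s₁ s₂ : Memory} {t₁ t₂ : ℕ}
    (h₁ : Run p s t₁ s₁) (h₂ : Run p s t₂ s₂) : t₁ = t₂ ∧ s₁ = s₂ := by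
  induction h₁ generalizing t₂ s₂ with
  | skip s => cases h₂; exact ⟨rfl, rfl⟩
  | instr i s => cases h₂; exact ⟨rfl, rfl⟩
  | seq _ _ ihp ihq =>
    cases h₂ with
    | seq hp hq =>
      obtain ⟨rfl, rfl⟩ := ihp hp
      obtain ⟨rfl, rfl⟩ := ihq hq
      exact ⟨rfl, rfl⟩
  | cond_pos h _ ih =>
    cases h₂ with
    | cond_pos _ hp =>
      obtain ⟨rfl, rfl⟩ := ih hp
      exact ⟨rfl, rfl⟩
    | cond_nonpos h' _ => omega
  | cond_nonpos h _ ih =>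
    cases h₂ with
    | cond_pos h' _ => omega
    | cond_nonpos _ hq =>
      obtain ⟨rfl, rfl⟩ := ih hq
      exact ⟨rfl, rfl⟩
  | loop_pos h _ _ ihp ihl =>
    cases h₂ with
    | loop_pos _ hp hl =>
      obtain ⟨rfl, rfl⟩ := ihp hp
      obtain ⟨rfl, rfl⟩ := ihl hl
      exact ⟨rfl, rfl⟩
    | loop_nonpos h' => omega
  | loop_nonpos h =>
    cases h₂ with
    | loop_pos h' _ _ => omega
    | loop_nonpos _ => exact ⟨rfl, rfl⟩

/-! ### Input and output -/

open Classical in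
/-- The initial memory for the instance `(G, red, k)`: register 0 holds the number `n` of
vertices, register 1 holds `k`, array 0 holds the adjacency matrix of `G` and array 1 the
adjacency matrix of the red edges (both row by row, the entry `(i, j)` at the address
`i * n + j`). Everything else is 0. -/
noncomputable def inputMemory {n : ℕ} (G : SimpleGraph (Fin n)) (red : Set (Sym2 (Fin n)))
    (k : ℤ) : Memory where
  reg a := if a = 0 then (n : ℤ) else if a = 1 then k else 0
  arr x z :=
    if x = 0 then
      if ∃ i j : Fin n, z = (i : ℤ) * n + j ∧ G.Adj i j then 1 else 0
    else if x = 1 then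
      if ∃ i j : Fin n, z = (i : ℤ) * n + j ∧ s(i, j) ∈ red then 1 else 0
    else 0

/-- The size of an instance: the number of vertices plus the number of binary digits of `k`.
(The length of the whole input is polynomial in it.) -/
def inputSize (n : ℕ) (k : ℤ) : ℕ := n + Nat.size k.natAbs

/-- The matching `M` is written in the memory: array 2 holds, at the address `v`, the partner of
the vertex `v`. -/
def Encodes {n : ℕ} {G : SimpleGraph (Fin n)} (s : Memory) (M : G.Subgraph) : Prop :=
  ∀ v w : Fin n, M.Adj v w ↔ s.arr 2 (v : ℤ) = (w : ℤ)

/-- The final memory `s` is a correct answer to the instance `(G, red, k)`: either register 0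
holds 1 and a solution is written in the memory, or register 0 holds 0 and there is no
solution. -/
def IsCorrectOutput {n : ℕ} (G : SimpleGraph (Fin n)) (red : Set (Sym2 (Fin n))) (k : ℤ)
    (s : Memory) : Prop :=
  (s.reg 0 = 1 ∧ ∃ M : G.Subgraph, IsSolution red k M ∧ Encodes s M) ∨
    (s.reg 0 = 0 ∧ ¬ ∃ M : G.Subgraph, IsSolution red k M)

end BCPM

namespace BCPM

/-! ### Running programs within a time bound -/

/-! Take the prism over `G`: two copies of `G` joined by rungs `(v, n + v)`. Red edges of the first
copy cost 1, all other copied edges cost 0, a rung costs N = 2n + 2, and a pair that is not an edge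
gets the prohibitive cost K = N². The prism is bipartite and always has a perfect matching, namely
the rungs. A perfect matching M of `G`, used in both copies, is a rungless matching of cost r(M),
and conversely a rungless matching of cost c restricts to a perfect matching of `G` with c red
edges. Rungless matchings cost at most n, while a single rung already costs more. So BCPM becomes a
question about the cost of matchings of the prism and its parity.

Given a matching μ, let an arc u → v of the exchange digraph mean that u takes over the partner of
v; its weight is c(u, μ v) - c(v, μ v). The difference between μ and another matching splits into
closed walks whose weights add up to the difference of the costs (`Matching.exists_walk`).
Conversely, exchanging along a cycle made of edges changes the cost by exactly its weight
(`Matching.exch`). Bipartiteness enters here: such a cycle stays in one colour class and so never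
meets the partners of its own vertices.

Call a weight acceptable if it is even and negative, or odd and at most θ, where θ ≥ -1. The crux is
`Acc.split`: if a sum is acceptable, so is one of its summands. Hence a matching of acceptable
relative cost yields a single acceptable closed walk, and a shortest acceptable closed walk repeats
no vertex, so it is a cycle (`injOn_of_shortest`). Shortest closed walks of prescribed length and
parity, unlike such cycles, are found by dynamic programming (`dist`). The parity thus costs only a
factor of two. As K is huge, light walks use edges only.

For θ = -1 acceptable means negative, so repeated improvement reaches a matching of minimum cost. If
the slack k - cost is then positive and odd, one more improvement with θ = min(slack, n) either
finds an odd change of cost within the slack (negative changes no longer exist), or certifies that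
no solution exists. The cost stays at most 2n < N, so no rung appears.

For the machine, the algorithm is written in a small language whose loops are capped by a global
bound B, computed beforehand. Compiled code then runs in time polynomial in B whatever the data are
(`Tm.ends_compile`, `Stm.ends_compile`), and correctness is a statement about the values of terms
and statements. -/

/-- Started in `s`, the program `P` halts after at most `T` steps with a memory that satisfies
`Q`. -/
def Ends (P : Program) (s : Memory) (T : ℕ) (Q : Memory → Prop) : Prop :=
  ∃ t ≤ T, ∃ s', Run P s t s' ∧ Q s'

namespace Ends

variable {p q : Program} {s : Memory} {T T' : ℕ} {Q Q' : Memory → Prop}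

theorem mono (h : Ends p s T Q) (hT : T ≤ T') (hQ : ∀ s', Q s' → Q' s') : Ends p s T' Q' := by
  obtain ⟨t, ht, s', hr, hs'⟩ := h
  exact ⟨t, ht.trans hT, s', hr, hQ s' hs'⟩

theorem skip (h : Q s) : Ends .skip s 1 Q := ⟨1, le_rfl, s, .skip s, h⟩

theorem instr {i : Instr} (h : Q (i.exec s)) : Ends (.instr i) s 1 Q :=
  ⟨1, le_rfl, _, .instr i s, h⟩

theorem seq (h : Ends p s T fun s' => Ends q s' T' Q) : Ends (.seq p q) s (T + T') Q := by
  obtain ⟨t, ht, s', hp, t', ht', s'', hq, hQ⟩ := h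
  exact ⟨t + t', by omega, s'', .seq hp hq, hQ⟩

theorem cond {a : ℕ} (hp : 0 < s.reg a → Ends p s T Q) (hq : s.reg a ≤ 0 → Ends q s T Q) :
    Ends (.cond a p q) s (T + 1) Q := by
  rcases lt_or_ge 0 (s.reg a) with h | h
  · obtain ⟨t, ht, s', hr, hQ⟩ := hp h
    exact ⟨t + 1, by omega, s', .cond_pos h hr, hQ⟩
  · obtain ⟨t, ht, s', hr, hQ⟩ := hq h
    exact ⟨t + 1, by omega, s', .cond_nonpos h hr, hQ⟩

/-- A loop whose counter register `a` decreases by one in each round. -/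
theorem loop {a N : ℕ} (I : ℕ → Memory → Prop)
    (hI : ∀ j < N, ∀ s, I j s → s.reg a = (N : ℤ) - j →
      Ends p s T fun s' => I (j + 1) s' ∧ s'.reg a = (N : ℤ) - (j + 1 : ℕ))
    (h0 : I 0 s) (hs : s.reg a = N) :
    Ends (.loop a p) s (N * (T + 1) + 1) (I N) := by
  suffices H : ∀ d ≤ N, ∀ s, I (N - d) s → s.reg a = d →
      Ends (.loop a p) s (d * (T + 1) + 1) (I N) from
    H N le_rfl s (by simpa using h0) hs
  intro d
  induction d with
  | zero =>
    intro _ s h0 hs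
    exact ⟨1, by omega, s, .loop_nonpos (by simp [hs]), by simpa using h0⟩
  | succ d ih =>
    intro hd s h0 hs
    obtain ⟨t₁, ht₁, s₁, hr₁, hI₁, ha₁⟩ := hI (N - (d + 1)) (by omega) s h0 (by rw [hs]; omega)
    rw [show N - (d + 1) + 1 = N - d by omega] at hI₁ ha₁
    obtain ⟨t₂, ht₂, s₂, hr₂, hI₂⟩ := ih (by omega) s₁ hI₁ (by rw [ha₁]; omega)
    refine ⟨t₁ + t₂ + 1, ?_, s₂, .loop_pos (by rw [hs]; positivity) hr₁ hr₂, hI₂⟩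
    have : (d + 1) * (T + 1) = d * (T + 1) + (T + 1) := by ring
    omega

end Ends

/-! ### A language of terms and statements -/

/-- The `n`-fold iterate of `f`, which is told the number of the round. -/
def iter {α : Type*} (f : ℕ → α → α) (x : α) : ℕ → α
  | 0 => x
  | n + 1 => f n (iter f x n)

/-- The number of rounds of a loop: `z`, but at least 0 and at most `B`. -/
def cap (B : ℕ) (z : ℤ) : ℕ := min z.toNat B

/-- Terms. The number of rounds of `mul` and `fold` is capped by a global bound. -/
inductive Tm where
  | lit (c : ℤ)
  | var (i : ℕ)
  | add (a b : Tm)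
  | sub (a b : Tm)
  | mul (a b : Tm)
  | ld (x : ℕ) (a : Tm)
  /-- if `c` is positive then `a` else `b` -/
  | ite (c a b : Tm)
  /-- start with `init` and, for `i = 0, …, n - 1`, replace the value `a` by `body` -/
  | fold (i a : ℕ) (n init body : Tm)

/-- The value of a term. -/
def Tm.eval (B : ℕ) (A : ℕ → ℤ → ℤ) : Tm → (ℕ → ℤ) → ℤ
  | .lit c, _ => c
  | .var i, v => v i
  | .add a b, v => a.eval B A v + b.eval B A v
  | .sub a b, v => a.eval B A v - b.eval B A v
  | .mul a b, v => cap B (a.eval B A v) * b.eval B A v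
  | .ld x a, v => A x (a.eval B A v)
  | .ite c a b, v => if 0 < c.eval B A v then a.eval B A v else b.eval B A v
  | .fold i a n init body, v =>
      iter (fun j r => body.eval B A (Function.update (Function.update v i (j : ℤ)) a r))
        (init.eval B A v) (cap B (n.eval B A v))

/-- Statements. -/
inductive Stm where
  | skip
  | set (i : ℕ) (t : Tm)
  | st (x : ℕ) (a t : Tm)
  | seq (S S' : Stm)
  | ite (c : Tm) (S S' : Stm)
  /-- for `i = 0, …, n - 1` do `S` -/
  | rep (i : ℕ) (n : Tm) (S : Stm)

/-- Set register `i` to `z`. -/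
def Memory.set (s : Memory) (i : ℕ) (z : ℤ) : Memory :=
  { s with reg := Function.update s.reg i z }

/-- The effect of a statement. -/
def Stm.eval (B : ℕ) : Stm → Memory → Memory
  | .skip, s => s
  | .set i t, s => s.set i (t.eval B s.arr s.reg)
  | .st x a t, s =>
      ⟨s.reg, Function.update s.arr x
        (Function.update (s.arr x) (a.eval B s.arr s.reg) (t.eval B s.arr s.reg))⟩
  | .seq S S', s => S'.eval B (S.eval B s)
  | .ite c S S', s => if 0 < c.eval B s.arr s.reg then S.eval B s else S'.eval B s
  | .rep i n S, s => iter (fun j s' => S.eval B (s'.set i j)) s (cap B (n.eval B s.arr s.reg))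

/-! ### Compilation

The variable `i` lives in the register `2 * i`. The registers `2 * h + 1` are used by the compiled
program: register 1 holds the bound `B`, and the registers 3 and 5 hold the constants 1 and 0. -/

/-- Cap the counter in register `2 * h + 1` and repeat `p`. -/
def repeatProg (h : ℕ) (p : Program) : Program :=
  .seq (.instr (.sub (2 * h + 3) (2 * h + 1) 1))
    (.seq (.cond (2 * h + 3) (.instr (.add (2 * h + 1) 1 5)) .skip)
      (.seq (.cond (2 * h + 1) .skip (.instr (.add (2 * h + 1) 5 5)))
        (.seq (.instr (.const (2 * h + 3) 0))
          (.loop (2 * h + 1) (.seq p (.seq (.instr (.add (2 * h + 3) (2 * h + 3) 3))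
            (.instr (.sub (2 * h + 1) (2 * h + 1) 3))))))))

/-- The program that leaves the value of the term in the register `2 * h + 1`. -/
def Tm.compile : Tm → ℕ → Program
  | .lit c, h => .instr (.const (2 * h + 1) c)
  | .var i, h => .instr (.add (2 * h + 1) (2 * i) 5)
  | .add a b, h => .seq (a.compile h) (.seq (b.compile (h + 1))
      (.instr (.add (2 * h + 1) (2 * h + 1) (2 * h + 3))))
  | .sub a b, h => .seq (a.compile h) (.seq (b.compile (h + 1))
      (.instr (.sub (2 * h + 1) (2 * h + 1) (2 * h + 3))))
  | .mul a b, h => .seq (b.compile h) (.seq (a.compile (h + 2)) (.seq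
      (.instr (.const (2 * h + 3) 0)) (.seq
      (repeatProg (h + 2) (.instr (.add (2 * h + 3) (2 * h + 3) (2 * h + 1))))
      (.instr (.add (2 * h + 1) (2 * h + 3) 5)))))
  | .ld x a, h => .seq (a.compile h) (.instr (.load (2 * h + 1) x (2 * h + 1)))
  | .ite c a b, h => .seq (c.compile h) (.cond (2 * h + 1) (a.compile h) (b.compile h))
  | .fold i a n init body, h => .seq (init.compile h) (.seq (n.compile (h + 3)) (.seq
      (.instr (.add (2 * h + 3) (2 * i) 5)) (.seq
      (.instr (.add (2 * h + 5) (2 * a) 5)) (.seq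
      (repeatProg (h + 3) (.seq (.instr (.add (2 * i) (2 * h + 9) 5)) (.seq
        (.instr (.add (2 * a) (2 * h + 1) 5)) (.seq (body.compile (h + 5))
        (.instr (.add (2 * h + 1) (2 * h + 11) 5)))))) (.seq
      (.instr (.add (2 * i) (2 * h + 3) 5))
      (.instr (.add (2 * a) (2 * h + 5) 5)))))))

/-- The program that executes the statement, using no odd registers below `2 * h + 1`. -/
def Stm.compile : Stm → ℕ → Program
  | .skip, _ => .skip
  | .set i t, h => .seq (t.compile h) (.instr (.add (2 * i) (2 * h + 1) 5))
  | .st x a t, h => .seq (a.compile h) (.seq (t.compile (h + 1))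
      (.instr (.store x (2 * h + 1) (2 * h + 3))))
  | .seq S S', h => .seq (S.compile h) (S'.compile h)
  | .ite c S S', h => .seq (c.compile h) (.cond (2 * h + 1) (S.compile h) (S'.compile h))
  | .rep i n S, h => .seq (n.compile h) (repeatProg h
      (.seq (.instr (.add (2 * i) (2 * h + 3) 5)) (S.compile (h + 2))))

open Polynomial in
/-- A bound, in terms of the cap, for the running time of a compiled term. -/
noncomputable def Tm.time : Tm → ℕ[X]
  | .lit _ => 1
  | .var _ => 1
  | .add a b => a.time + b.time + 1
  | .sub a b => a.time + b.time + 1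
  | .mul a b => a.time + b.time + (X * 4 + 9) 
  | .ld _ a => a.time + 1
  | .ite c a b => c.time + a.time + b.time + 1
  | .fold _ _ n init body => n.time + init.time + (X * (body.time + 6) + 11)

open Polynomial in
/-- A bound, in terms of the cap, for the running time of a compiled statement. -/
noncomputable def Stm.time : Stm → ℕ[X]
  | .skip => 1
  | .set _ t => t.time + 1
  | .st _ a t => a.time + t.time + 1
  | .seq S S' => S.time + S'.time
  | .ite c S S' => c.time + S.time + S'.time + 1
  | .rep _ n S => n.time + (X * (S.time + 4) + 7)

/-! ### Correctness and running time of compiled code. -/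

/-- The constants of a compiled program are in place. -/
structure Ready (B : ℕ) (s : Memory) : Prop where
  one : s.reg 1 = B
  three : s.reg 3 = 1
  five : s.reg 5 = 0

/-- The memory seen by a compiled program: the variables and the arrays. -/
def Memory.view (s : Memory) : Memory := ⟨fun i => s.reg (2 * i), s.arr⟩

@[simp] theorem exec_add_reg (s : Memory) (d a b r : ℕ) :
    ((Instr.add d a b).exec s).reg r = if r = d then s.reg a + s.reg b else s.reg r := by
  simp [Instr.exec, Function.update_apply]

@[simp] theorem exec_sub_reg (s : Memory) (d a b r : ℕ) :
    ((Instr.sub d a b).exec s).reg r = if r = d then s.reg a - s.reg b else s.reg r := by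
  simp [Instr.exec, Function.update_apply]

@[simp] theorem exec_const_reg (s : Memory) (d r : ℕ) (c : ℤ) :
    ((Instr.const d c).exec s).reg r = if r = d then c else s.reg r := by
  simp [Instr.exec, Function.update_apply]

@[simp] theorem exec_load_reg (s : Memory) (d x a r : ℕ) :
    ((Instr.load d x a).exec s).reg r = if r = d then s.arr x (s.reg a) else s.reg r := by
  simp [Instr.exec, Function.update_apply]

@[simp] theorem exec_store_reg (s : Memory) (x a b : ℕ) :
    ((Instr.store x a b).exec s).reg = s.reg := rfl

@[simp] theorem exec_add_arr (s : Memory) (d a b : ℕ) :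
    ((Instr.add d a b).exec s).arr = s.arr := rfl

@[simp] theorem exec_sub_arr (s : Memory) (d a b : ℕ) :
    ((Instr.sub d a b).exec s).arr = s.arr := rfl

@[simp] theorem exec_const_arr (s : Memory) (d : ℕ) (c : ℤ) :
    ((Instr.const d c).exec s).arr = s.arr := rfl

@[simp] theorem exec_load_arr (s : Memory) (d x a : ℕ) :
    ((Instr.load d x a).exec s).arr = s.arr := rfl

/-- The loop rule for compiled code. The header and the end of each round write only the counter `2
* h + 1` and the index `2 * h + 3`; `hstable` asks that the invariant ignore these two registers, so
that only the body has to be examined. Capping the counter makes the time bound independent of its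
value. -/
theorem ends_repeatProg {B h T : ℕ} {p : Program} {s : Memory} (hh : 3 ≤ h) (hs : Ready B s)
    (I : ℕ → Memory → Prop) (h0 : I 0 s)
    (hstable : ∀ j s₁ s₂, I j s₁ → s₂.arr = s₁.arr →
      (∀ r, r ≠ 2 * h + 1 → r ≠ 2 * h + 3 → s₂.reg r = s₁.reg r) → I j s₂)
    (hI : ∀ j < cap B (s.reg (2 * h + 1)), ∀ s₁, I j s₁ → Ready B s₁ → s₁.reg (2 * h + 3) = j →
      Ends p s₁ T fun s₂ => Ready B s₂ ∧ s₂.reg (2 * h + 1) = s₁.reg (2 * h + 1) ∧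
        s₂.reg (2 * h + 3) = s₁.reg (2 * h + 3) ∧ I (j + 1) s₂) :
    Ends (repeatProg h p) s (B * (T + 3) + 7) fun s' => Ready B s' ∧
      I (cap B (s.reg (2 * h + 1))) s' := by
  set N := cap B (s.reg (2 * h + 1)) with hN
  have hNB : N ≤ B := min_le_right _ _
  have hready : ∀ s₁ s₂ : Memory, Ready B s₁ →
      (∀ r, r ≠ 2 * h + 1 → r ≠ 2 * h + 3 → s₂.reg r = s₁.reg r) → Ready B s₂ := by
    intro s₁ s₂ ⟨h1, h3, h5⟩ hr
    exact ⟨by rw [hr _ (by omega) (by omega), h1], by rw [hr _ (by omega) (by omega), h3],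
      by rw [hr _ (by omega) (by omega), h5]⟩
  have key : ∀ s' : Memory, s'.arr = s.arr →
      (∀ r, r ≠ 2 * h + 1 → r ≠ 2 * h + 3 → s'.reg r = s.reg r) →
      s'.reg (2 * h + 1) = N → s'.reg (2 * h + 3) = 0 →
      Ends (.loop (2 * h + 1) (.seq p (.seq (.instr (.add (2 * h + 3) (2 * h + 3) 3))
            (.instr (.sub (2 * h + 1) (2 * h + 1) 3))))) s' (N * (T + 3) + 1)
        fun s' => Ready B s' ∧ I N s' := by
    intro s' ha hr hc hi
    refine (Ends.loop (T := T + 2) (fun j s' => Ready B s' ∧ I j s' ∧ s'.reg (2 * h + 3) = j)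
      ?_ ⟨hready s s' hs hr, hstable 0 s s' h0 ha hr, by simpa using hi⟩ hc).mono le_rfl
      (fun s' hs' => ⟨hs'.1, hs'.2.1⟩)
    rintro j hj s₁ ⟨hR, hIj, hi⟩ hc
    refine Ends.seq (T' := 2) ((hI j hj s₁ hIj hR hi).mono le_rfl ?_)
    rintro s₂ ⟨hR₂, hc₂, hi₂, hI₂⟩
    have h3 := hR₂.three
    refine .seq (.instr (.instr ?_))
    refine ⟨⟨hready s₂ _ hR₂ ?_, hstable _ s₂ _ hI₂ (by simp) ?_, ?_⟩, ?_⟩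
    · intro r h1 h2; simp [h1, h2]
    · intro r h1 h2; simp [h1, h2]
    · simp [hi₂, hi, h3]
    · simp [hc₂, hc, h3]; omega
  obtain ⟨h1, h3, h5⟩ := hs
  have hNz : N = min (s.reg (2 * h + 1)).toNat B := rfl
  -- One step for the comparison with the bound, two for each conditional of the cap, one to reset
  -- the index. Each round costs `T` plus two updates and one test, and the final test is one more
  -- step.
  have hle : 1 + (2 + (2 + (1 + (N * (T + 3) + 1)))) ≤ B * (T + 3) + 7 := by
    have := Nat.mul_le_mul_right (T + 3) hNB
    omega
  refine Ends.mono (T := 1 + (2 + (2 + (1 + (N * (T + 3) + 1))))) ?_ hle (fun _ h => h)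
  refine .seq (.instr (.seq (.cond (fun hc => .instr ?_) (fun hc => .skip ?_))))
  all_goals
    refine .seq (.cond (fun hc' => .skip ?_) (fun hc' => .instr ?_))
    all_goals
      refine .seq (.instr (key _ (by simp) (fun r h1 h2 => by simp [h1, h2]) ?_ (by simp)))
      simp [h1, h5, show (5 : ℕ) ≠ 2 * h + 3 by omega, show (5 : ℕ) ≠ 2 * h + 1 by omega] at hc hc' ⊢
      omega

/-- `s'` agrees with `s` except for odd registers from `2 * h + 1` on. -/
structure Keeps (h : ℕ) (s s' : Memory) : Prop where
  arr : s'.arr = s.arr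
  even : ∀ i, s'.reg (2 * i) = s.reg (2 * i)
  odd : ∀ j < h, s'.reg (2 * j + 1) = s.reg (2 * j + 1)

theorem Keeps.trans {h : ℕ} {s s' s'' : Memory} (h₁ : Keeps h s s') (h₂ : Keeps h s' s'') :
    Keeps h s s'' :=
  ⟨h₂.arr.trans h₁.arr, fun i => (h₂.even i).trans (h₁.even i),
    fun j hj => (h₂.odd j hj).trans (h₁.odd j hj)⟩

theorem Keeps.weaken {h h' : ℕ} {s s' : Memory} (hk : Keeps h s s') (hh : h' ≤ h) :
    Keeps h' s s' :=
  ⟨hk.arr, hk.even, fun j hj => hk.odd j (by omega)⟩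

theorem Ready.of_odd {B h : ℕ} {s s' : Memory} (hs : Ready B s) (hh : 3 ≤ h)
    (ho : ∀ j < h, s'.reg (2 * j + 1) = s.reg (2 * j + 1)) : Ready B s' :=
  ⟨by rw [← hs.one]; exact ho 0 (by omega), by rw [← hs.three]; exact ho 1 (by omega),
    by rw [← hs.five]; exact ho 2 (by omega)⟩

theorem Keeps.ready {B h : ℕ} {s s' : Memory} (hk : Keeps h s s') (hh : 3 ≤ h) (hs : Ready B s) :
    Ready B s' := hs.of_odd hh hk.odd

/-- The value of a term in the memory seen by a compiled program. -/
def Tm.val (B : ℕ) (t : Tm) (s : Memory) : ℤ := t.eval B s.arr fun i => s.reg (2 * i)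

theorem Keeps.val {B h : ℕ} {s s' : Memory} (hk : Keeps h s s') (t : Tm) :
    t.val B s' = t.val B s := by
  simp only [Tm.val, hk.arr, hk.even]

/-- Compiled terms use the odd registers from `2 * h + 1` on as a stack, and a fold saves and
restores the two variables it binds. So evaluation has no visible effect (`Keeps`), and subterms can
be evaluated one after the other without disturbing earlier results. -/
theorem Tm.ends_compile (B : ℕ) (t : Tm) : ∀ (h : ℕ) (s : Memory), 3 ≤ h → Ready B s →
    Ends (t.compile h) s (t.time.eval B) fun s' => Keeps h s s' ∧ s'.reg (2 * h + 1) = t.val B s := by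
  induction t with
  | lit c =>
    intro h s hh hs
    simp only [Tm.compile, Tm.time, Polynomial.eval_one]
    refine .instr ⟨⟨by simp, fun i => ?_, fun j hj => ?_⟩, by simp [Tm.val, Tm.eval]⟩
    · simp; omega
    · simp; omega
  | var i =>
    intro h s hh hs
    simp only [Tm.compile, Tm.time, Polynomial.eval_one]
    have := hs.five
    refine .instr ⟨⟨by simp, fun i => ?_, fun j hj => ?_⟩, by simp [Tm.val, Tm.eval, this]⟩
    · simp; omega
    · simp; omega
  | add a b iha ihb =>
    intro h s hh hs
    simp only [Tm.compile, Tm.time, Polynomial.eval_add, Polynomial.eval_one, add_assoc]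
    refine .seq ((iha h s hh hs).mono le_rfl ?_)
    rintro s₁ ⟨hk₁, hv₁⟩
    refine .seq ((ihb (h + 1) s₁ (by omega) (hk₁.ready hh hs)).mono le_rfl ?_)
    rintro s₂ ⟨hk₂, hv₂⟩
    have h1 := hk₂.odd h (by omega)
    rw [hk₁.val] at hv₂
    refine .instr ⟨(hk₁.trans (hk₂.weaken (by omega))).trans
      ⟨by simp, fun i => ?_, fun j hj => ?_⟩, ?_⟩
    · simp; omega
    · simp; omega
    · simp only [exec_add_reg, if_true, h1, hv₁, Tm.val, Tm.eval]
      congr 1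
  | sub a b iha ihb =>
    intro h s hh hs
    simp only [Tm.compile, Tm.time, Polynomial.eval_add, Polynomial.eval_one, add_assoc]
    refine .seq ((iha h s hh hs).mono le_rfl ?_)
    rintro s₁ ⟨hk₁, hv₁⟩
    refine .seq ((ihb (h + 1) s₁ (by omega) (hk₁.ready hh hs)).mono le_rfl ?_)
    rintro s₂ ⟨hk₂, hv₂⟩
    have h1 := hk₂.odd h (by omega)
    rw [hk₁.val] at hv₂
    refine .instr ⟨(hk₁.trans (hk₂.weaken (by omega))).trans
      ⟨by simp, fun i => ?_, fun j hj => ?_⟩, ?_⟩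
    · simp; omega
    · simp; omega
    · simp only [exec_sub_reg, if_true, h1, hv₁, Tm.val, Tm.eval]
      congr 1
  | ld x a iha =>
    intro h s hh hs
    simp only [Tm.compile, Tm.time, Polynomial.eval_add, Polynomial.eval_one]
    refine .seq ((iha h s hh hs).mono le_rfl ?_)
    rintro s₁ ⟨hk₁, hv₁⟩
    refine .instr ⟨hk₁.trans ⟨by simp, fun i => ?_, fun j hj => ?_⟩, ?_⟩
    · simp; omega
    · simp; omega
    · simp only [exec_load_reg, if_true, hv₁, Tm.val, Tm.eval, hk₁.arr]
  | ite c a b ihc iha ihb =>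
    intro h s hh hs
    have ha : a.time.eval B ≤ a.time.eval B + b.time.eval B := by omega
    have hb : b.time.eval B ≤ a.time.eval B + b.time.eval B := by omega
    simp only [Tm.compile, Tm.time, Polynomial.eval_add, Polynomial.eval_one]
    rw [show ∀ x y z : ℕ, x + y + z + 1 = x + (y + z + 1) by intros; ring]
    refine .seq ((ihc h s hh hs).mono le_rfl ?_)
    rintro s₁ ⟨hk₁, hv₁⟩
    refine .cond (fun hc => (iha h s₁ hh (hk₁.ready hh hs)).mono ha ?_)
      (fun hc => (ihb h s₁ hh (hk₁.ready hh hs)).mono hb ?_)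
    · rintro s₂ ⟨hk₂, hv₂⟩
      rw [hv₁] at hc
      exact ⟨hk₁.trans hk₂, by rw [hv₂, hk₁.val]; exact (if_pos hc).symm⟩
    · rintro s₂ ⟨hk₂, hv₂⟩
      rw [hv₁] at hc
      exact ⟨hk₁.trans hk₂, by rw [hv₂, hk₁.val]; exact (if_neg hc.not_gt).symm⟩
  | mul a b iha ihb =>
    intro h s hh hs
    simp only [Tm.compile, Tm.time, Polynomial.eval_add, Polynomial.eval_mul, Polynomial.eval_X,
      Polynomial.eval_ofNat]
    rw [show ∀ x y z : ℕ, x + y + (z * 4 + 9) = y + (x + (1 + ((z * (1 + 3) + 7) + 1))) by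
      intros; ring]
    refine .seq ((ihb h s hh hs).mono le_rfl ?_)
    rintro s₁ ⟨hk₁, hv₁⟩
    refine .seq ((iha (h + 2) s₁ (by omega) (hk₁.ready hh hs)).mono le_rfl ?_)
    rintro s₂ ⟨hk₂, hv₂⟩
    rw [hk₁.val, show 2 * (h + 2) + 1 = 2 * h + 5 by ring] at hv₂
    have h1 := hk₂.odd h (by omega)
    rw [hv₁] at h1
    have hk := hk₁.trans (hk₂.weaken (by omega : h ≤ h + 2))
    refine .seq (.instr (.seq ?_))
    refine (ends_repeatProg (B := B) (by omega) ?_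
      (fun j s' => Keeps h s s' ∧ s'.reg (2 * h + 1) = b.val B s ∧
        s'.reg (2 * h + 3) = j * b.val B s) ?_ ?_ ?_).mono le_rfl ?_
    · refine (hk.ready hh hs).of_odd hh fun j hj => ?_
      simp; omega
    · refine ⟨hk.trans ⟨by simp, fun i => ?_, fun j hj => ?_⟩, ?_, ?_⟩
      · simp; omega
      · simp; omega
      · simp [h1]
      · simp
    · rintro j s₃ s₄ ⟨hk₃, h3, h4⟩ ha hr
      refine ⟨hk₃.trans ⟨ha, fun i => hr _ (by omega) (by omega),
        fun j hj => hr _ (by omega) (by omega)⟩, ?_, ?_⟩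
      · rw [hr _ (by omega) (by omega), h3]
      · rw [hr _ (by omega) (by omega), h4]
    · rintro j - s₃ ⟨hk₃, h3, h4⟩ hR hj
      refine .instr ⟨hR.of_odd (h := 3) le_rfl fun j hj => ?_, ?_, ?_, hk₃.trans
        ⟨by simp, fun i => ?_, fun j hj => ?_⟩, ?_, ?_⟩
      · simp; omega
      · simp; omega
      · simp
      · simp; omega
      · simp; omega
      · simp [h3]
      · simp [h3, h4]; ring
    · rintro s₃ ⟨hR, hk₃, h3, h4⟩
      have h5 := hR.five
      refine .instr ⟨hk₃.trans ⟨by simp, fun i => ?_, fun j hj => ?_⟩, ?_⟩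
      · simp; omega
      · simp; omega
      · simp only [exec_add_reg, if_true, h4, h5]
        simp [hv₂, Tm.val, Tm.eval, show 2 * (h + 2) + 1 = 2 * h + 5 by ring]
  | fold i a n init body ihn ihi ihb =>
    intro h s hh hs
    simp only [Tm.compile, Tm.time, Polynomial.eval_add, Polynomial.eval_mul, Polynomial.eval_X,
      Polynomial.eval_ofNat]
    rw [show ∀ x y z w : ℕ, x + y + (z * (w + 6) + 11) =
      y + (x + (1 + (1 + ((z * ((1 + (1 + (w + 1))) + 3) + 7) + (1 + 1))))) by intros; ring]
    refine .seq ((ihi h s hh hs).mono le_rfl ?_)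
    rintro s₁ ⟨hk₁, hv₁⟩
    refine .seq ((ihn (h + 3) s₁ (by omega) (hk₁.ready hh hs)).mono le_rfl ?_)
    rintro s₂ ⟨hk₂, hv₂⟩
    rw [hk₁.val, show 2 * (h + 3) + 1 = 2 * h + 7 by ring] at hv₂
    have h1 := hk₂.odd h (by omega)
    rw [hv₁] at h1
    have hk := hk₁.trans (hk₂.weaken (by omega : h ≤ h + 3))
    have h5 := (hk.ready hh hs).five
    set f : ℕ → ℤ → ℤ := fun j r => body.eval B s.arr
      (Function.update (Function.update (fun k => s.reg (2 * k)) i (j : ℤ)) a r)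
    refine .seq (.instr (.seq (.instr (.seq ?_))))
    refine (ends_repeatProg (B := B) (by omega) ?_
      (fun j s' => (s'.arr = s.arr ∧ (∀ k, k ≠ i → k ≠ a → s'.reg (2 * k) = s.reg (2 * k)) ∧
        ∀ k < h, s'.reg (2 * k + 1) = s.reg (2 * k + 1)) ∧
        s'.reg (2 * h + 1) = iter f (init.val B s) j ∧
        s'.reg (2 * h + 3) = s.reg (2 * i) ∧ s'.reg (2 * h + 5) = s.reg (2 * a)) ?_ ?_ ?_).mono
        le_rfl ?_
    · refine (hk.ready hh hs).of_odd hh fun j hj => ?_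
      simp; omega
    · refine ⟨⟨by simp [hk.arr], fun k hki hka => ?_, fun k hk' => ?_⟩, ?_, ?_, ?_⟩
      · rw [← hk.even]; simp; omega
      · rw [← hk.odd k hk']; simp; omega
      · simp [h1, iter]
      · simp [h5, hk.even]
      · simp [h5, hk.even]; omega
    · rintro j s₃ s₄ ⟨⟨h3a, h3b, h3c⟩, h3, h4, h5'⟩ ha hr
      refine ⟨⟨ha.trans h3a, fun k hki hka => ?_, fun k hk => ?_⟩, ?_, ?_, ?_⟩
      · rw [hr _ (by omega) (by omega), h3b k hki hka]
      · rw [hr _ (by omega) (by omega), h3c k hk]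
      · rw [hr _ (by omega) (by omega), h3]
      · rw [hr _ (by omega) (by omega), h4]
      · rw [hr _ (by omega) (by omega), h5']
    · rintro j - s₃ ⟨⟨h3a, h3b, h3c⟩, h3, h4, h5'⟩ hR hj
      rw [show 2 * (h + 3) + 3 = 2 * h + 9 by ring] at hj
      have hR5 := hR.five
      refine .seq (.instr (.seq (.instr (.seq ?_))))
      refine (ihb (h + 5) _ (by omega) ?_).mono le_rfl ?_
      · refine hR.of_odd (h := 3) le_rfl fun j hj => ?_
        simp; omega
      rintro s₄ ⟨hk₄, hv₄⟩
      have ho : ∀ k < h + 5, s₄.reg (2 * k + 1) = s₃.reg (2 * k + 1) := by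
        intro k hk
        rw [hk₄.odd k hk]
        simp; omega
      have hR4 : Ready B s₄ := hR.of_odd (h := 3) le_rfl fun j hj => ho j (by omega)
      have hR45 := hR4.five
      refine .instr ⟨hR4.of_odd (h := 3) le_rfl fun j hj => ?_, ?_, ?_,
        ⟨?_, fun k hki hka => ?_, fun k hk => ?_⟩, ?_, ?_, ?_⟩
      · simp; omega
      · have := ho (h + 3) (by omega)
        simpa using this
      · have := ho (h + 4) (by omega)
        simpa [mul_add] using this
      · simp [hk₄.arr, h3a]
      · rw [← h3b k hki hka]
        have := hk₄.even k
        simp [hki, hka] at this ⊢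
        rw [if_neg (by omega), this]
      · rw [← h3c k hk, ← ho k (by omega)]
        simp; omega
      · have : s₄.reg (2 * h + 11) = f j (iter f (init.val B s) j) := by
          rw [show 2 * h + 11 = 2 * (h + 5) + 1 by ring, hv₄, ← h3]
          simp only [Tm.val, f]
          simp only [exec_add_arr, h3a]
          congr 1
          funext k
          by_cases hka : k = a
          · subst hka; simp [hR5]; omega
          · by_cases hki : k = i
            · subst hki; simp [hR5, hj, hka]
            · simp [hka, hki, h3b k hki hka]
        simp [this, hR45, iter]
      · have := ho (h + 1) (by omega)
        simp [mul_add] at this ⊢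
        rw [this, h4]
      · have := ho (h + 2) (by omega)
        simp [mul_add] at this ⊢
        rw [this, h5']
    · rintro s₃ ⟨hR, ⟨h3a, h3b, h3c⟩, h3, h4, h5'⟩
      have hR5 := hR.five
      -- Restoring `i` before `a` is right even if the two are the same variable, since both saved
      -- values then coincide.
      refine .seq (.instr (.instr ⟨⟨by simp [h3a], fun k => ?_, fun k hk => ?_⟩, ?_⟩))
      · by_cases hka : k = a
        · subst hka; simp [hR5, h5']; omega
        · by_cases hki : k = i
          · subst hki; simp [hka, hR5, h4]
          · simp [hka, hki, h3b k hki hka]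
      · rw [← h3c k hk]; simp; omega
      · have e : 2 * (h + 3) + 1 = 2 * h + 7 := by ring
        rw [e] at h3
        simp [hv₂] at h3
        simp only [exec_add_reg]
        rw [if_neg (by omega), if_neg (by omega), h3]
        rfl

/-- `s'` is an implementation of the memory `u`, and agrees with `s` in the odd registers below
`2 * h + 1`. -/
structure Implements (h : ℕ) (s : Memory) (u s' : Memory) : Prop where
  view : s'.view = u
  odd : ∀ j < h, s'.reg (2 * j + 1) = s.reg (2 * j + 1)

theorem Implements.ready {B h : ℕ} {s u s' : Memory} (hk : Implements h s u s') (hh : 3 ≤ h)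
    (hs : Ready B s) : Ready B s' := hs.of_odd hh hk.odd

theorem Keeps.view {h : ℕ} {s s' : Memory} (hk : Keeps h s s') : s'.view = s.view :=
  Memory.ext (funext hk.even) hk.arr

/-- Unlike a term, a statement may change variables and arrays, so what is tracked is the whole view
of the memory. The body of a loop is compiled two levels higher because the counter and the index of
the loop occupy the registers `2 * h + 1` and `2 * h + 3`. -/
theorem Stm.ends_compile (B : ℕ) (S : Stm) : ∀ (h : ℕ) (s : Memory), 3 ≤ h → Ready B s →
    Ends (S.compile h) s (S.time.eval B) (Implements h s (S.eval B s.view)) := by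
  induction S with
  | skip =>
    intro h s hh hs
    simp only [Stm.compile, Stm.time, Polynomial.eval_one]
    exact .skip ⟨rfl, fun j hj => rfl⟩
  | set i t =>
    intro h s hh hs
    simp only [Stm.compile, Stm.time, Polynomial.eval_add, Polynomial.eval_one]
    refine .seq ((t.ends_compile B h s hh hs).mono le_rfl ?_)
    rintro s₁ ⟨hk₁, hv₁⟩
    have h5 := (hk₁.ready hh hs).five
    refine .instr ⟨Memory.ext (funext fun k => ?_) ?_, fun j hj => ?_⟩
    · by_cases hki : k = i
      · subst hki
        simp [Memory.view, Stm.eval, Memory.set, hv₁, h5, Tm.val]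
      · simp [Memory.view, Stm.eval, Memory.set, hki, hk₁.even]
    · simp [Memory.view, Stm.eval, Memory.set, hk₁.arr]
    · rw [← hk₁.odd j hj]; simp; omega
  | st x a t =>
    intro h s hh hs
    simp only [Stm.compile, Stm.time, Polynomial.eval_add, Polynomial.eval_one, add_assoc]
    refine .seq ((a.ends_compile B h s hh hs).mono le_rfl ?_)
    rintro s₁ ⟨hk₁, hv₁⟩
    refine .seq ((t.ends_compile B (h + 1) s₁ (by omega) (hk₁.ready hh hs)).mono le_rfl ?_)
    rintro s₂ ⟨hk₂, hv₂⟩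
    rw [hk₁.val, show 2 * (h + 1) + 1 = 2 * h + 3 by ring] at hv₂
    have h1 := (hk₂.odd h (by omega)).trans hv₁
    have hk := hk₁.trans (hk₂.weaken (by omega : h ≤ h + 1))
    refine .instr ⟨Memory.ext (funext fun k => ?_) ?_, fun j hj => ?_⟩
    · simp [Memory.view, Stm.eval, hk.even]
    · simp [Memory.view, Stm.eval, Instr.exec, hk.arr, h1, hv₂, Tm.val]
    · rw [← hk.odd j hj]; simp
  | seq S S' ih ih' =>
    intro h s hh hs
    simp only [Stm.compile, Stm.time, Polynomial.eval_add]
    refine .seq ((ih h s hh hs).mono le_rfl ?_)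
    intro s₁ hs₁
    refine (ih' h s₁ hh (hs₁.ready hh hs)).mono le_rfl ?_
    intro s₂ hs₂
    refine ⟨by rw [hs₂.view, hs₁.view]; rfl, fun j hj => (hs₂.odd j hj).trans (hs₁.odd j hj)⟩
  | ite c S S' ih ih' =>
    intro h s hh hs
    have ha : S.time.eval B ≤ S.time.eval B + S'.time.eval B := by omega
    have hb : S'.time.eval B ≤ S.time.eval B + S'.time.eval B := by omega
    simp only [Stm.compile, Stm.time, Polynomial.eval_add, Polynomial.eval_one]
    rw [show ∀ x y z : ℕ, x + y + z + 1 = x + (y + z + 1) by intros; ring]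
    refine .seq ((c.ends_compile B h s hh hs).mono le_rfl ?_)
    rintro s₁ ⟨hk₁, hv₁⟩
    refine .cond (fun hc => (ih h s₁ hh (hk₁.ready hh hs)).mono ha ?_)
      (fun hc => (ih' h s₁ hh (hk₁.ready hh hs)).mono hb ?_)
    · intro s₂ hs₂
      rw [hv₁] at hc
      refine ⟨?_, fun j hj => (hs₂.odd j hj).trans (hk₁.odd j hj)⟩
      rw [hs₂.view, hk₁.view]
      exact (if_pos hc).symm
    · intro s₂ hs₂
      rw [hv₁] at hc
      refine ⟨?_, fun j hj => (hs₂.odd j hj).trans (hk₁.odd j hj)⟩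
      rw [hs₂.view, hk₁.view]
      exact (if_neg hc.not_gt).symm
  | rep i n S ih =>
    intro h s hh hs
    simp only [Stm.compile, Stm.time, Polynomial.eval_add, Polynomial.eval_mul, Polynomial.eval_X,
      Polynomial.eval_ofNat]
    rw [show ∀ x y z : ℕ, x + (y * (z + 4) + 7) = x + (y * ((1 + z) + 3) + 7) by intros; ring]
    refine .seq ((n.ends_compile B h s hh hs).mono le_rfl ?_)
    rintro s₁ ⟨hk₁, hv₁⟩
    refine (ends_repeatProg hh (hk₁.ready hh hs) (fun j s' => Implements h s
      (iter (fun j s' => S.eval B (s'.set i j)) s.view j) s') ?_ ?_ ?_).mono le_rfl ?_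
    · exact ⟨hk₁.view, hk₁.odd⟩
    · intro j s₂ s₃ hs₂ ha hr
      refine ⟨?_, fun k hk => ?_⟩
      · rw [← hs₂.view]
        exact Memory.ext (funext fun k => hr _ (by omega) (by omega)) ha
      · rw [hr _ (by omega) (by omega), hs₂.odd k hk]
    · rintro j - s₂ hs₂ hR hj
      have h5 := hR.five
      refine .seq (.instr ?_)
      refine (ih (h + 2) _ (by omega) (hR.of_odd (h := 3) le_rfl ?_)).mono le_rfl ?_
      · intro k hk; simp; omega
      intro s₃ hs₃
      have ho : ∀ k < h + 2, s₃.reg (2 * k + 1) = s₂.reg (2 * k + 1) := by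
        intro k hk; rw [hs₃.odd k hk]; simp; omega
      refine ⟨hR.of_odd (h := 3) le_rfl fun k hk => ho k (by omega), ho h (by omega),
        ho (h + 1) (by omega), ?_, fun k hk => (ho k (by omega)).trans (hs₂.odd k hk)⟩
      rw [hs₃.view]
      simp only [iter, ← hs₂.view]
      congr 1
      refine Memory.ext (funext fun k => ?_) ?_
      · by_cases hki : k = i
        · subst hki; simp [Memory.view, Memory.set, hj, h5]
        · simp [Memory.view, Memory.set, hki]
      · simp [Memory.view, Memory.set]
    · rintro s₂ ⟨hR, hs₂⟩
      rw [hv₁] at hs₂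
      exact hs₂

/-! ### Acceptable weights -/

/-- The weights we look for: negative ones, and odd ones that are at most `θ`. -/
def Acc (θ w : ℤ) : Prop := (w % 2 = 0 ∧ w < 0) ∨ (w % 2 = 1 ∧ w ≤ θ)

/-- If the sum is even and negative, one summand is negative, and it is acceptable even when odd
because -1 ≤ θ. If the sum is odd and at most θ, one summand is even; either that one is negative or
the odd one is at most θ. This lets acceptable closed walks be decomposed at will. -/
theorem Acc.split {θ a b : ℤ} (hθ : -1 ≤ θ) (h : Acc θ (a + b)) : Acc θ a ∨ Acc θ b := by
  unfold Acc at *; omega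

theorem not_acc_zero {θ : ℤ} : ¬ Acc θ 0 := by
  unfold Acc; omega

/-! ### Walks -/

/-- The weight of the first `n` arcs of the walk `z`. -/
def wt {V : Type*} (W : V → V → ℤ) (z : ℕ → V) (n : ℕ) : ℤ :=
  ∑ t ∈ Finset.range n, W (z t) (z (t + 1))

theorem wt_succ {V : Type*} (W : V → V → ℤ) (z : ℕ → V) (n : ℕ) :
    wt W z (n + 1) = wt W z n + W (z n) (z (n + 1)) := Finset.sum_range_succ _ _

theorem wt_succ' {V : Type*} (W : V → V → ℤ) (z : ℕ → V) (n : ℕ) :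
    wt W z (n + 1) = W (z 0) (z 1) + wt W (fun t => z (t + 1)) n := by
  simp [wt, Finset.sum_range_succ', add_comm]

theorem wt_add {V : Type*} (W : V → V → ℤ) (z : ℕ → V) (a b : ℕ) :
    wt W z (a + b) = wt W z a + wt W (fun t => z (a + t)) b := by
  simp [wt, Finset.sum_range_add, add_assoc]

theorem wt_congr {V V' : Type*} {W : V → V → ℤ} {W' : V' → V' → ℤ} {z : ℕ → V} {z' : ℕ → V'} {n : ℕ}
    (h : ∀ t < n, W (z t) (z (t + 1)) = W' (z' t) (z' (t + 1))) : wt W z n = wt W' z' n :=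
  Finset.sum_congr rfl fun t ht => h t (Finset.mem_range.1 ht)

/-- There is a closed walk with `n` arcs and acceptable weight. -/
def HasWalk {V : Type*} (W : V → V → ℤ) (θ : ℤ) (n : ℕ) : Prop :=
  ∃ z : ℕ → V, z n = z 0 ∧ Acc θ (wt W z n)

/-- A shortest closed walk of acceptable weight is a cycle. -/
theorem injOn_of_shortest {V : Type*} {W : V → V → ℤ} {θ : ℤ} (hθ : -1 ≤ θ) {n : ℕ} {z : ℕ → V}
    (hz : z n = z 0) (hA : Acc θ (wt W z n)) (hmin : ∀ n' < n, ¬ HasWalk W θ n') :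
    ∀ i < n, ∀ j < n, z i = z j → i = j := by
  suffices H : ∀ i j, i < j → j < n → z i ≠ z j by
    intro i hi j hj h
    by_contra hne
    rcases lt_or_gt_of_ne hne with hlt | hlt
    · exact H i j hlt hj h
    · exact H j i hlt hi h.symm
  intro i j hij hj h
  obtain ⟨a, rfl⟩ := Nat.exists_eq_add_of_lt hij
  obtain ⟨b, rfl⟩ := Nat.exists_eq_add_of_lt hj
  -- The closed walk is cut at the repeated vertex: `z₁` is the loop between the two visits, `z₂` is
  -- the walk with that loop skipped. Both are shorter, and their weights add up to the original
  -- weight.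
  set z₁ : ℕ → V := fun t => z (i + t) with hz₁
  set z₂ : ℕ → V := fun t => if t ≤ i then z t else z (t + (a + 1)) with hz₂
  have e₁ : wt W z (i + a + 1 + b + 1) = wt W z i + (wt W z₁ (a + 1) +
      wt W (fun t => z (i + (a + 1) + t)) (b + 1)) := by
    rw [show i + a + 1 + b + 1 = i + ((a + 1) + (b + 1)) by ring, wt_add, wt_add W _ (a + 1)]
    simp only [hz₁, add_assoc]
  have e₂ : wt W z₂ (i + (b + 1)) = wt W z i + wt W (fun t => z (i + (a + 1) + t)) (b + 1) := by
    rw [wt_add]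
    congr 1
    · refine wt_congr fun t ht => ?_
      simp [hz₂, ht.le, show t + 1 ≤ i by omega]
    · refine wt_congr fun t ht => ?_
      rcases Nat.eq_zero_or_pos t with rfl | ht
      · simp only [hz₂, add_zero, le_refl, if_true, zero_add, if_neg (show ¬ i + 1 ≤ i by omega)]
        rw [h, ← add_assoc]
        congr 2
        ring
      · simp only [hz₂, if_neg (show ¬ i + t ≤ i by omega),
          if_neg (show ¬ i + (t + 1) ≤ i by omega)]
        congr 2 <;> ring
  have e : wt W z (i + a + 1 + b + 1) = wt W z₁ (a + 1) + wt W z₂ (i + (b + 1)) := by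
    rw [e₁, e₂]; ring
  rw [e] at hA
  rcases hA.split hθ with hA | hA
  · exact hmin (a + 1) (by omega) ⟨z₁, by simp only [hz₁, add_zero]; rw [h, add_assoc], hA⟩
  · refine hmin (i + (b + 1)) (by omega) ⟨z₂, ?_, hA⟩
    simp only [hz₂, if_neg (show ¬ i + (b + 1) ≤ i by omega), zero_le, if_true]
    rw [← hz]
    congr 1
    ring

/-- If the sum of `f` over an invariant set is acceptable, then so is the sum over some orbit. -/
theorem exists_orbit {V : Type*} [Fintype V] [DecidableEq V] (π : Equiv.Perm V) (f : V → ℤ)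
    {θ : ℤ} (hθ : -1 ≤ θ) (S : Finset V) (hS : ∀ v ∈ S, π v ∈ S) (hA : Acc θ (∑ v ∈ S, f v)) :
    ∃ u, ∃ n ≤ Fintype.card V, (π^[n]) u = u ∧ Acc θ (∑ t ∈ Finset.range n, f ((π^[t]) u)) := by
  induction S using Finset.strongInduction with
  | H S ih =>
  rcases S.eq_empty_or_nonempty with rfl | ⟨u, hu⟩
  · simp [not_acc_zero] at hA
  set n := Function.minimalPeriod π u
  have hper : (π^[n]) u = u := Function.iterate_minimalPeriod
  have hn : 0 < n := Function.minimalPeriod_pos_of_mem_periodicPts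
    (π.injective.mem_periodicPts u)
  have hinj : Set.InjOn (fun t => (π^[t]) u) (Finset.range n) := by
    intro i hi j hj h
    exact (Function.iterate_eq_iterate_iff_of_lt_minimalPeriod (by simpa using hi)
      (by simpa using hj)).1 h
  set O := (Finset.range n).image fun t => (π^[t]) u with hO
  have hOS : O ⊆ S := by
    intro v hv
    obtain ⟨t, -, rfl⟩ := Finset.mem_image.1 hv
    have : ∀ t, (π^[t]) u ∈ S := by
      intro t
      induction t with
      | zero => exact hu
      | succ t iht => rw [Function.iterate_succ_apply']; exact hS _ iht
    exact this t
  have huO : u ∈ O := Finset.mem_image.2 ⟨0, by simpa using hn, rfl⟩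
  have hsum : ∑ v ∈ O, f v = ∑ t ∈ Finset.range n, f ((π^[t]) u) := Finset.sum_image hinj
  rw [← Finset.sum_sdiff hOS] at hA
  rcases hA.split hθ with hA | hA
  · refine ih (S \ O) (Finset.sdiff_ssubset hOS ⟨u, huO⟩) (fun v hv => ?_) hA
    rw [Finset.mem_sdiff] at hv ⊢
    refine ⟨hS v hv.1, fun h => hv.2 ?_⟩
    obtain ⟨t, ht, hv'⟩ := Finset.mem_image.1 h
    rcases t with _ | t
    · refine Finset.mem_image.2 ⟨n - 1, by simp; omega, π.injective ?_⟩
      rw [← hv']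
      simp only [← Function.iterate_succ_apply']
      rw [show (n - 1).succ = n by omega, hper]
      rfl
    · refine Finset.mem_image.2 ⟨t, by simp at ht ⊢; omega, π.injective ?_⟩
      rw [← hv']
      simp only [← Function.iterate_succ_apply']
  · refine ⟨u, n, ?_, hper, hsum ▸ hA⟩
    rw [← Finset.card_range n, ← Finset.card_image_of_injOn hinj]
    exact Finset.card_le_univ _

/-! ### Matchings in weighted bipartite graphs -/

/-- A bipartite graph with costs. Pairs of cost `K` or more are not edges. -/
structure CostGraph (V : Type*) where
  c : V → V → ℤ
  K : ℤ
  N : ℤ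
  col : V → Bool
  symm : ∀ u v, c u v = c v u
  nonneg : ∀ u v, 0 ≤ c u v
  le : ∀ u v, c u v < K → c u v ≤ N
  col_ne : ∀ u v, c u v < K → col u ≠ col v

namespace CostGraph

variable {V : Type*} (H : CostGraph V)

/-- `μ` maps every vertex to its partner in a perfect matching. -/
structure Matching (μ : V → V) : Prop where
  invol : ∀ v, μ (μ v) = v
  lt : ∀ v, H.c v (μ v) < H.K

/-- The arc weights of the exchange digraph of the matching `μ`. -/
def weight (μ : V → V) (u v : V) : ℤ := H.c u (μ v) - H.c v (μ v)

variable {H} {μ μ' : V → V}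

theorem Matching.col_ne (h : H.Matching μ) (v : V) : H.col (μ v) = !H.col v := by
  have := H.col_ne _ _ (h.lt v)
  cases h1 : H.col v <;> cases h2 : H.col (μ v) <;> simp_all

theorem neg_le_weight (h : H.Matching μ) (u v : V) : -H.N ≤ H.weight μ u v := by
  have := H.nonneg u (μ v)
  have := H.le _ _ (h.lt v)
  unfold weight; omega

/-- An arc passes through two edges, from `z t` to the partner of `z (t + 1)` and from there to `z
(t + 1)`, so the colour changes twice. -/
theorem Matching.col_walk (h : H.Matching μ) {z : ℕ → V} {n : ℕ}
    (hlt : ∀ t < n, H.c (z t) (μ (z (t + 1))) < H.K) : ∀ t ≤ n, H.col (z t) = H.col (z 0) := by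
  intro t ht
  induction t with
  | zero => rfl
  | succ t ih =>
    rw [← ih (by omega)]
    have h1 := H.col_ne _ _ (hlt t (by omega))
    rw [h.col_ne] at h1
    cases h2 : H.col (z t) <;> cases h3 : H.col (z (t + 1)) <;> simp_all

/-- The arcs of a light walk come from edges. -/
theorem Matching.lt_of_wt (h : H.Matching μ) {z : ℕ → V} {n : ℕ}
    (hw : wt (H.weight μ) z n + n * H.N < H.K) (t : ℕ) (ht : t < n) :
    H.c (z t) (μ (z (t + 1))) < H.K := by
  -- After adding `N` to every arc weight all terms are nonnegative, so each one is below `K`. As a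
  -- matching edge costs at most `N`, the new pair of the arc costs less than `K`.
  have h1 : ∀ t ∈ Finset.range n, 0 ≤ H.weight μ (z t) (z (t + 1)) + H.N := fun t _ => by
    have := neg_le_weight h (z t) (z (t + 1))
    omega
  have h2 := Finset.single_le_sum h1 (Finset.mem_range.2 ht)
  rw [Finset.sum_add_distrib] at h2
  have h3 := H.le _ _ (h.lt (z (t + 1)))
  simp only [Finset.sum_const, Finset.card_range, nsmul_eq_mul] at h2
  unfold wt at hw
  unfold weight at h2 hw
  omega

/-- Exchange along the first `n` arcs of `z`. -/
def exch [DecidableEq V] (μ : V → V) (z : ℕ → V) (n : ℕ) (v : V) : V :=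
  iter (fun t r => if v = z t then μ (z (t + 1)) else if v = μ (z (t + 1)) then z t else r) (μ v) n

/-- The later arcs override the earlier ones in `exch`. The three hypotheses say that the vertices
`z t` and the partners `μ (z (t + 1))` are all distinct, so no override ever happens and all arcs
take effect together. -/
theorem exch_spec [DecidableEq V] (μ : V → V) (z : ℕ → V) (n : ℕ)
    (h₁ : ∀ i < n, ∀ j < n, z i = z j → i = j)
    (h₂ : ∀ i < n, ∀ j < n, μ (z (i + 1)) = μ (z (j + 1)) → i = j)
    (h₃ : ∀ i < n, ∀ j < n, z i ≠ μ (z (j + 1))) :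
    (∀ t < n, exch μ z n (z t) = μ (z (t + 1))) ∧ (∀ t < n, exch μ z n (μ (z (t + 1))) = z t) ∧
      ∀ v, (∀ t < n, v ≠ z t ∧ v ≠ μ (z (t + 1))) → exch μ z n v = μ v := by
  induction n with
  | zero => simp [exch, iter]
  | succ n ih =>
    obtain ⟨i₁, i₂, i₃⟩ := ih (fun i hi j hj => h₁ i (by omega) j (by omega))
      (fun i hi j hj => h₂ i (by omega) j (by omega)) (fun i hi j hj => h₃ i (by omega) j (by omega))
    have e : ∀ v, exch μ z (n + 1) v =
      if v = z n then μ (z (n + 1)) else if v = μ (z (n + 1)) then z n else exch μ z n v :=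
      fun v => rfl
    refine ⟨fun t ht => ?_, fun t ht => ?_, fun v hv => ?_⟩
    · rw [e]
      rcases Nat.lt_succ_iff_lt_or_eq.1 ht with h | rfl
      · rw [if_neg fun he => ?_, if_neg (h₃ t ht n (by omega)), i₁ t h]
        have := h₁ t ht n (by omega) he
        omega
      · rw [if_pos rfl]
    · rw [e, if_neg (h₃ n (by omega) t ht).symm]
      rcases Nat.lt_succ_iff_lt_or_eq.1 ht with h | rfl
      · rw [if_neg fun he => ?_, i₂ t h]
        have := h₂ t ht n (by omega) he
        omega
      · rw [if_pos rfl]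
    · rw [e, if_neg (hv n (by omega)).1, if_neg (hv n (by omega)).2, i₃ v fun t ht => hv t (by omega)]

variable [Fintype V]

/-- The cost of a matching. -/
def cost (H : CostGraph V) (μ : V → V) : ℤ := ∑ v with H.col v = true, H.c v (μ v)

theorem cost_nonneg (H : CostGraph V) (μ : V → V) : 0 ≤ H.cost μ :=
  Finset.sum_nonneg fun _ _ => H.nonneg _ _

/-- The sum of a symmetric function over a set with one end of each edge. -/
theorem Matching.two_mul_sum (h : H.Matching μ) (f : V → ℤ) (hf : ∀ v, f (μ v) = f v)
    (S : V → Prop) [DecidablePred S] (hS : ∀ v, S (μ v) ↔ ¬ S v) :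
    2 * ∑ v with S v, f v = ∑ v, f v := by
  rw [← Finset.sum_filter_add_sum_filter_not Finset.univ S f, two_mul]
  congr 1
  refine Finset.sum_bij' (fun v _ => μ v) (fun v _ => μ v) ?_ ?_ ?_ ?_ ?_
  · intro v hv; simp at hv ⊢; rw [hS]; simpa using hv
  · intro v hv; simp at hv ⊢; rw [hS]; simpa using hv
  · intro v _; exact h.invol v
  · intro v _; exact h.invol v
  · intro v _; exact (hf v).symm

theorem Matching.two_mul_cost (h : H.Matching μ) : 2 * H.cost μ = ∑ v, H.c v (μ v) :=
  h.two_mul_sum _ (fun v => by rw [h.invol, H.symm]) _ (fun v => by rw [h.col_ne]; simp)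

theorem Matching.sum_eq_cost (h : H.Matching μ) (S : V → Prop) [DecidablePred S]
    (hS : ∀ v, S (μ v) ↔ ¬ S v) : ∑ v with S v, H.c v (μ v) = H.cost μ := by
  have h1 := h.two_mul_sum (fun v => H.c v (μ v)) (fun v => by rw [h.invol, H.symm]) S hS
  have h2 := h.two_mul_cost
  omega

theorem Matching.sum_col_eq_cost (h : H.Matching μ) (κ : Bool) :
    ∑ v with H.col v = κ, H.c v (μ v) = H.cost μ :=
  h.sum_eq_cost _ fun v => by rw [h.col_ne]; cases κ <;> simp

/-- If there is a matching of acceptable relative cost then there is a closed walk of acceptable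
weight in the exchange digraph. -/
theorem Matching.exists_walk [DecidableEq V] (h : H.Matching μ) (h' : H.Matching μ') {θ : ℤ}
    (hθ : -1 ≤ θ) (hA : Acc θ (H.cost μ' - H.cost μ)) :
    ∃ n ≤ Fintype.card V, HasWalk (H.weight μ) θ n := by
  -- The union of the two matchings, read as a permutation: follow `μ'`, then `μ`. The arc from `v`
  -- to `π v` trades `v`'s new edge against the old edge at `π v`, so over one colour class the
  -- weights sum to the difference of the costs.
  let π : Equiv.Perm V := ⟨fun v => μ (μ' v), fun v => μ' (μ v), fun v => by simp [h.invol, h'.invol],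
    fun v => by simp [h.invol, h'.invol]⟩
  have hπ : ∀ v, π v = μ (μ' v) := fun _ => rfl
  have hcol : ∀ v, H.col (π v) = H.col v := fun v => by rw [hπ, h.col_ne, h'.col_ne]; simp
  have hsum : H.cost μ' - H.cost μ = ∑ v with H.col v = true, H.weight μ v (π v) := by
    have : H.cost μ = ∑ v with H.col v = true, H.c (π v) (μ (π v)) := by
      refine (Finset.sum_bij (fun v _ => π v) ?_ ?_ ?_ ?_).symm
      · intro v hv; simpa [hcol] using hv
      · intro v _ w _ hvw; exact π.injective hvw
      · intro v hv
        exact ⟨π.symm v, by simpa [← hcol (π.symm v)] using hv, by simp⟩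
      · intro v _; rfl
    rw [this, cost, ← Finset.sum_sub_distrib]
    refine Finset.sum_congr rfl fun v _ => ?_
    rw [weight, hπ, h.invol]
  rw [hsum] at hA
  obtain ⟨u, n, hn, hu, hA⟩ := exists_orbit π _ hθ _ (fun v hv => by simpa [hcol] using hv) hA
  refine ⟨n, hn, fun t => (π^[t]) u, hu, ?_⟩
  simpa only [wt, Function.iterate_succ_apply'] using hA

/-- Exchange along a cycle of the exchange digraph. -/
theorem Matching.exchange [DecidableEq V] (h : H.Matching μ) {z : ℕ → V} {n : ℕ}
    (hz : z n = z 0) (hinj : ∀ i < n, ∀ j < n, z i = z j → i = j)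
    (hlt : ∀ t < n, H.c (z t) (μ (z (t + 1))) < H.K)
    (h₁ : ∀ t < n, μ' (z t) = μ (z (t + 1))) (h₂ : ∀ t < n, μ' (μ (z (t + 1))) = z t)
    (h₃ : ∀ v, (∀ t < n, v ≠ z t ∧ v ≠ μ (z (t + 1))) → μ' v = μ v) :
    H.Matching μ' ∧ H.cost μ' = H.cost μ + wt (H.weight μ) z n := by
  have hcol := h.col_walk hlt
  have hcyc : ∀ t < n, ∃ t' < n, z (t + 1) = z t' := by
    intro t ht
    rcases Nat.lt_or_ge (t + 1) n with h | h
    · exact ⟨t + 1, h, rfl⟩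
    · exact ⟨0, by omega, by rw [show t + 1 = n by omega, hz]⟩
  have hcyc' : ∀ t < n, ∃ t' < n, z t = z (t' + 1) := by
    intro t ht
    rcases t with _ | t
    · exact ⟨n - 1, by omega, by rw [show n - 1 + 1 = n by omega, hz]⟩
    · exact ⟨t, by omega, rfl⟩
  have hM : H.Matching μ' := by
    constructor
    · intro v
      by_cases hv : ∀ t < n, v ≠ z t ∧ v ≠ μ (z (t + 1))
      · rw [h₃ v hv, h₃, h.invol]
        intro t ht
        constructor
        · intro he
          obtain ⟨t', ht', he'⟩ := hcyc' t ht
          exact (hv t' ht').2 (by rw [← he', ← he, h.invol])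
        · intro he
          obtain ⟨t', ht', he'⟩ := hcyc t ht
          exact (hv t' ht').1 (by rw [← he', ← h.invol v, he, h.invol])
      · push Not at hv
        obtain ⟨t, ht, hv⟩ := hv
        by_cases hvt : v = z t
        · rw [hvt, h₁ t ht, h₂ t ht]
        · rw [hv hvt, h₂ t ht, h₁ t ht]
    · intro v
      by_cases hv : ∀ t < n, v ≠ z t ∧ v ≠ μ (z (t + 1))
      · rw [h₃ v hv]; exact h.lt v
      · push Not at hv
        obtain ⟨t, ht, hv⟩ := hv
        by_cases hvt : v = z t
        · rw [hvt, h₁ t ht]; exact hlt t ht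
        · rw [hv hvt, h₂ t ht, H.symm]; exact hlt t ht
  refine ⟨hM, ?_⟩
  -- Both costs are taken over the colour class that contains the cycle. Off the cycle the terms
  -- cancel; on the cycle the old edges at `z t` and at `z (t + 1)` have the same total because the
  -- cycle is closed.
  rw [← hM.sum_col_eq_cost (H.col (z 0)), ← h.sum_col_eq_cost (H.col (z 0)), ← sub_eq_iff_eq_add',
    ← Finset.sum_sub_distrib]
  have hsub : (Finset.range n).image z ⊆ Finset.univ.filter fun v => H.col v = H.col (z 0) := by
    intro v hv
    obtain ⟨t, ht, rfl⟩ := Finset.mem_image.1 hv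
    simpa using hcol t (by simpa using (Finset.mem_range.1 ht).le)
  rw [← Finset.sum_subset hsub, Finset.sum_image]
  · rw [Finset.sum_sub_distrib, wt]
    simp only [weight]
    rw [Finset.sum_sub_distrib]
    congr 1
    · exact Finset.sum_congr rfl fun t ht => by rw [h₁ t (Finset.mem_range.1 ht)]
    · have := Finset.sum_range_succ' (fun t => H.c (z t) (μ (z t))) n
      rw [Finset.sum_range_succ, hz] at this
      simpa using this
  · intro i hi j hj hij
    exact hinj i (by simpa using hi) j (by simpa using hj) hij
  · intro v hv hv'
    rw [h₃ v, sub_self]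
    intro t ht
    constructor
    · rintro rfl
      exact hv' (Finset.mem_image_of_mem _ (by simpa using ht))
    · rintro rfl
      have := hcol (t + 1) (by omega)
      simp [h.col_ne, this] at hv

/-- The result of the exchange along a cycle. -/
theorem Matching.exch [DecidableEq V] (h : H.Matching μ) {z : ℕ → V} {n : ℕ}
    (hz : z n = z 0) (hinj : ∀ i < n, ∀ j < n, z i = z j → i = j)
    (hlt : ∀ t < n, H.c (z t) (μ (z (t + 1))) < H.K) :
    H.Matching (exch μ z n) ∧ H.cost (CostGraph.exch μ z n) = H.cost μ + wt (H.weight μ) z n := by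
  have hcol := h.col_walk hlt
  have h4 : ∀ i < n, ∀ j < n, μ (z (i + 1)) = μ (z (j + 1)) → i = j := by
    intro i hi j hj hij
    have he : z (i + 1) = z (j + 1) := by rw [← h.invol (z (i + 1)), hij, h.invol]
    rcases Nat.lt_or_ge (i + 1) n with hi' | hi' <;> rcases Nat.lt_or_ge (j + 1) n with hj' | hj'
    · have := hinj _ hi' _ hj' he
      omega
    · rw [show j + 1 = n by omega, hz] at he
      have := hinj _ hi' _ (by omega) he
      omega
    · rw [show i + 1 = n by omega, hz] at he
      have := hinj _ (by omega) _ hj' he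
      omega
    · omega
  -- The use of bipartiteness: the cycle lies in one colour class and the partners of its vertices
  -- in the other.
  have h5 : ∀ i < n, ∀ j < n, z i ≠ μ (z (j + 1)) := by
    intro i hi j hj hij
    have h1 := hcol i hi.le
    rw [hij, h.col_ne, hcol (j + 1) hj] at h1
    simp at h1
  obtain ⟨h₁, h₂, h₃⟩ := exch_spec μ z n hinj h4 h5
  exact h.exchange hz hinj hlt h₁ h₂ h₃

end CostGraph

/-! ### Shortest walks -/

theorem iter_min_le (e : ℕ → ℤ) (K : ℤ) (n : ℕ) :
    iter (fun z r => min r (e z)) K n ≤ K ∧ ∀ z < n, iter (fun z r => min r (e z)) K n ≤ e z := by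
  induction n with
  | zero => simp [iter]
  | succ n ih =>
    refine ⟨(min_le_left _ _).trans ih.1, fun z hz => ?_⟩
    rcases Nat.lt_succ_iff_lt_or_eq.1 hz with hz | rfl
    · exact (min_le_left _ _).trans (ih.2 z hz)
    · exact min_le_right _ _

theorem iter_min_eq (e : ℕ → ℤ) (K : ℤ) (n : ℕ) (h : iter (fun z r => min r (e z)) K n < K) :
    ∃ z < n, e z = iter (fun z r => min r (e z)) K n := by
  induction n with
  | zero => simp [iter] at h
  | succ n ih =>
    simp only [iter] at h ⊢
    rcases le_or_gt (iter (fun z r => min r (e z)) K n) (e n) with hle | hlt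
    · rw [min_eq_left hle] at h ⊢
      obtain ⟨z, hz, he⟩ := ih h
      exact ⟨z, by omega, he⟩
    · exact ⟨n, by omega, by rw [min_eq_right hlt.le]⟩

/-- The parity that remains after an arc of weight `w`. -/
def flip (w : ℤ) (p : ℕ) : ℕ := if w % 2 = 1 then 1 - p else p

theorem flip_lt {w : ℤ} {p : ℕ} (hp : p < 2) : flip w p < 2 := by
  unfold flip; split_ifs <;> omega

theorem flip_emod {w : ℤ} {p : ℕ} (hp : p < 2) : ((flip w p : ℤ) + w - p) % 2 = 0 := by
  unfold flip; split_ifs <;> omega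

/-- The smallest weight of a walk from `x` to `y` with `l` arcs and weight congruent to `p`
modulo 2; walks of weight `K` or more do not count. -/
def dist (W : ℕ → ℕ → ℤ) (m : ℕ) (K : ℤ) : ℕ → ℕ → ℕ → ℕ → ℤ
  | 0, p, x, y => if p = 0 ∧ x = y then 0 else K
  | l + 1, p, x, y => iter (fun z r => min r (W x z + dist W m K l (flip (W x z) p) z y)) K m

/-- Every successor takes part in the minimum, so following any walk through the recursion bounds
`dist` from above. The default `K` can only lower the minimum. -/
theorem dist_le {W : ℕ → ℕ → ℤ} {m : ℕ} {K : ℤ} {l : ℕ} : ∀ {p : ℕ} {z : ℕ → ℕ},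
    (∀ t, z t < m) → p < 2 → (wt W z l - p) % 2 = 0 →
    dist W m K l p (z 0) (z l) ≤ wt W z l := by
  induction l with
  | zero =>
    intro p z hz hp hw
    have : p = 0 := by simp [wt] at hw; omega
    simp [dist, wt, this]
  | succ l ih =>
    intro p z hz hp hw
    rw [wt_succ'] at hw ⊢
    have hf := flip_emod (w := W (z 0) (z 1)) hp
    have := ih (p := flip (W (z 0) (z 1)) p) (z := fun t => z (t + 1)) (fun t => hz _)
      (flip_lt hp) (by omega)
    exact ((iter_min_le (fun x => W (z 0) x + dist W m K l (flip (W (z 0) x) p) x (z (l + 1))) K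
      m).2 (z 1) (hz 1)).trans (by simpa using this)

/-- The first `l` arcs of a walk `z` from `u`, with remaining parities `q`, that follow a closed
walk of smallest weight with `n` arcs. -/
structure Trace (W : ℕ → ℕ → ℤ) (m : ℕ) (K : ℤ) (n p u : ℕ) (z q : ℕ → ℕ) (l : ℕ) : Prop where
  start : z 0 = u
  par : q 0 = p
  lt : ∀ t ≤ l, z t < m
  par_lt : ∀ t ≤ l, q t < 2
  par_emod : ∀ t ≤ l, ((q t : ℤ) + wt W z t - p) % 2 = 0
  add_dist : ∀ t ≤ l, wt W z t + dist W m K (n - t) (q t) (z t) u = dist W m K n p u u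

theorem neg_le_wt {W : ℕ → ℕ → ℤ} {N : ℤ} {z : ℕ → ℕ} {m l : ℕ} (hz : ∀ t ≤ l, z t < m)
    (hW : ∀ x < m, ∀ y < m, -N ≤ W x y) : -(l * N) ≤ wt W z l := by
  have := Finset.card_nsmul_le_sum (Finset.range l) (fun t => W (z t) (z (t + 1))) (-N)
    fun t ht => by
      have := Finset.mem_range.1 ht
      exact hW _ (hz _ (by omega)) _ (hz _ (by omega))
  simpa [wt] using this

/-- A minimum in the recursion is attained by some successor unless it equals the default `K`. The
arcs already taken weigh at least `-l * N`, so the remaining distance is at most the total plus `l *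
N`, which is below `K`. -/
theorem Trace.exists_next {W : ℕ → ℕ → ℤ} {m : ℕ} {K N : ℤ} {n p u l : ℕ} {z q : ℕ → ℕ}
    (h : Trace W m K n p u z q l) (hl : l < n) (hW : ∀ x < m, ∀ y < m, -N ≤ W x y)
    (hK : dist W m K n p u u + l * N < K) :
    ∃ y < m, W (z l) y + dist W m K (n - l - 1) (flip (W (z l) y) (q l)) y u =
      dist W m K (n - l) (q l) (z l) u := by
  have h1 := h.add_dist l le_rfl
  have h2 := neg_le_wt h.lt hW
  obtain ⟨r, hr⟩ : ∃ r, n - l = r + 1 := ⟨n - l - 1, by omega⟩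
  rw [hr] at h1 ⊢
  exact iter_min_eq (fun y => W (z l) y + dist W m K r (flip (W (z l) y) (q l)) y u) K m
    (lt_of_le_of_lt (by change dist W m K (r + 1) (q l) (z l) u ≤ _; linarith) hK)

theorem Trace.next {W : ℕ → ℕ → ℤ} {m : ℕ} {K : ℤ} {n p u l : ℕ} {z q : ℕ → ℕ}
    (h : Trace W m K n p u z q l) (hz : z (l + 1) < m)
    (hd : W (z l) (z (l + 1)) + dist W m K (n - l - 1) (flip (W (z l) (z (l + 1))) (q l))
      (z (l + 1)) u = dist W m K (n - l) (q l) (z l) u)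
    (hq : q (l + 1) = flip (W (z l) (z (l + 1))) (q l)) :
    Trace W m K n p u z q (l + 1) := by
  have hql := h.par_lt l le_rfl
  refine ⟨h.start, h.par, fun t ht => ?_, fun t ht => ?_, fun t ht => ?_, fun t ht => ?_⟩
  all_goals
    rcases Nat.le_succ_iff.1 ht with ht | rfl
    · first
      | exact h.lt t ht
      | exact h.par_lt t ht
      | exact h.par_emod t ht
      | exact h.add_dist t ht
  · exact hz
  · rw [hq]; exact flip_lt hql
  · have := h.par_emod l le_rfl
    have := flip_emod (w := W (z l) (z (l + 1))) hql
    rw [hq, wt_succ]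
    omega
  · rw [← h.add_dist l le_rfl, ← hd, hq, wt_succ, show n - (l + 1) = n - l - 1 by omega, add_assoc]

theorem Trace.congr {W : ℕ → ℕ → ℤ} {m : ℕ} {K : ℤ} {n p u l : ℕ} {z q z' q' : ℕ → ℕ}
    (h : Trace W m K n p u z q l) (hz : ∀ t ≤ l, z' t = z t) (hq : ∀ t ≤ l, q' t = q t) :
    Trace W m K n p u z' q' l := by
  have hw : ∀ t ≤ l, wt W z' t = wt W z t := fun t ht =>
    wt_congr fun i hi => by rw [hz i (by omega), hz (i + 1) (by omega)]
  refine ⟨by rw [hz 0 (by omega), h.start], by rw [hq 0 (by omega), h.par], ?_, ?_, ?_, ?_⟩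
  · intro t ht; rw [hz t ht]; exact h.lt t ht
  · intro t ht; rw [hq t ht]; exact h.par_lt t ht
  · intro t ht; rw [hq t ht, hw t ht]; exact h.par_emod t ht
  · intro t ht; rw [hq t ht, hw t ht, hz t ht]; exact h.add_dist t ht

/-- A complete trace is a closed walk. -/
theorem Trace.closed {W : ℕ → ℕ → ℤ} {m : ℕ} {K N : ℤ} {n p u : ℕ} {z q : ℕ → ℕ}
    (h : Trace W m K n p u z q n) (hW : ∀ x < m, ∀ y < m, -N ≤ W x y)
    (hK : dist W m K n p u u + n * N < K) :
    z n = z 0 ∧ wt W z n = dist W m K n p u u ∧ (wt W z n - p) % 2 = 0 := by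
  have h1 := h.add_dist n le_rfl
  have h2 := neg_le_wt h.lt hW
  have h3 := h.par_emod n le_rfl
  rw [Nat.sub_self, dist] at h1
  -- At the end the remaining distance has length 0: it is 0 exactly when the walk has returned to
  -- `u` with remaining parity 0. Otherwise it is `K`, which `hK` rules out.
  split_ifs at h1 with h0
  · rw [h0.1] at h3
    exact ⟨by rw [h0.2, h.start], by omega, by omega⟩
  · linarith

/-! ### What a statement leaves unchanged -/

/-- The statement may change variable `r`. -/
def Stm.setsVar : Stm → ℕ → Bool
  | .skip, _ => false
  | .set i _, r => r == i
  | .st _ _ _, _ => false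
  | .seq S S', r => S.setsVar r || S'.setsVar r
  | .ite _ S S', r => S.setsVar r || S'.setsVar r
  | .rep i _ S, r => r == i || S.setsVar r

/-- The statement may change the array `x`. -/
def Stm.setsArr : Stm → ℕ → Bool
  | .skip, _ => false
  | .set _ _, _ => false
  | .st y _ _, x => x == y
  | .seq S S', x => S.setsArr x || S'.setsArr x
  | .ite _ S S', x => S.setsArr x || S'.setsArr x
  | .rep _ _ S, x => S.setsArr x

theorem iter_induct {α : Type*} {f : ℕ → α → α} {x : α} {N : ℕ} (I : ℕ → α → Prop) (h0 : I 0 x)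
    (hI : ∀ j < N, ∀ y, I j y → I (j + 1) (f j y)) : I N (iter f x N) := by
  induction N with
  | zero => exact h0
  | succ N ih => exact hI N (by omega) _ (ih fun j hj => hI j (by omega))

/-- Since `Stm.setsVar` is a computable Boolean test, the frame conditions for concrete statements
can be proved by `rfl`. -/
theorem Stm.eval_reg (B : ℕ) (S : Stm) {r : ℕ} (h : S.setsVar r = false) (s : Memory) :
    (S.eval B s).reg r = s.reg r := by
  induction S generalizing s with
  | skip => rfl
  | set i t =>
    simp [Stm.setsVar] at h
    simp [Stm.eval, Memory.set, h]
  | st x a t => rfl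
  | seq S S' ih ih' =>
    simp [Stm.setsVar] at h
    simp [Stm.eval, ih h.1, ih' h.2]
  | ite c S S' ih ih' =>
    simp [Stm.setsVar] at h
    simp only [Stm.eval]
    split_ifs
    · exact ih h.1 s
    · exact ih' h.2 s
  | rep i n S ih =>
    simp [Stm.setsVar] at h
    simp only [Stm.eval]
    refine iter_induct (fun _ (s' : Memory) => s'.reg r = s.reg r) rfl fun j _ s' hs' => ?_
    rw [ih h.2, ← hs']
    simp [Memory.set, h.1]

theorem Stm.eval_arr (B : ℕ) (S : Stm) {x : ℕ} (h : S.setsArr x = false) (s : Memory) :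
    (S.eval B s).arr x = s.arr x := by
  induction S generalizing s with
  | skip => rfl
  | set i t => rfl
  | st y a t =>
    simp [Stm.setsArr] at h
    simp [Stm.eval, h]
  | seq S S' ih ih' =>
    simp [Stm.setsArr] at h
    simp [Stm.eval, ih h.1, ih' h.2]
  | ite c S S' ih ih' =>
    simp [Stm.setsArr] at h
    simp only [Stm.eval]
    split_ifs
    · exact ih h.1 s
    · exact ih' h.2 s
  | rep i n S ih =>
    simp [Stm.setsArr] at h
    simp only [Stm.eval]
    refine iter_induct (fun _ (s' : Memory) => s'.arr x = s.arr x) rfl fun j _ s' hs' => ?_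
    rw [ih h, ← hs']
    rfl

@[simp] theorem Memory.set_reg (s : Memory) (i : ℕ) (z : ℤ) (r : ℕ) :
    (s.set i z).reg r = if r = i then z else s.reg r := by
  simp [Memory.set, Function.update_apply]

@[simp] theorem Memory.set_arr (s : Memory) (i : ℕ) (z : ℤ) : (s.set i z).arr = s.arr := rfl

/-- Induction over the rounds of a loop. -/
theorem Stm.eval_rep {B i N : ℕ} {n : Tm} {S : Stm} {s : Memory} (I : ℕ → Memory → Prop)
    (hN : n.eval B s.arr s.reg = N) (hNB : N ≤ B) (h0 : I 0 s)
    (hI : ∀ j < N, ∀ s', I j s' → (∀ r, r ≠ i → S.setsVar r = false → s'.reg r = s.reg r) →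
      (∀ x, S.setsArr x = false → s'.arr x = s.arr x) → I (j + 1) (S.eval B (s'.set i j))) :
    I N ((Stm.rep i n S).eval B s) := by
  have hcap : cap B (n.eval B s.arr s.reg) = N := by simp [cap, hN, hNB]
  simp only [Stm.eval, hcap]
  refine (iter_induct (fun j s' => I j s' ∧
    (∀ r, r ≠ i → S.setsVar r = false → s'.reg r = s.reg r) ∧
    (∀ x, S.setsArr x = false → s'.arr x = s.arr x)) ⟨h0, fun _ _ _ => rfl, fun _ _ => rfl⟩ ?_).1
  rintro j hj s' ⟨h1, h2, h3⟩
  refine ⟨hI j hj s' h1 h2 h3, fun r hr h => ?_, fun x h => ?_⟩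
  · rw [Stm.eval_reg B S h, ← h2 r hr h]; simp [hr]
  · rw [Stm.eval_arr B S h, ← h3 x h]; simp

/-! ### Terms of the algorithm

Variables: 0 holds `n`, 1 holds `k`, 2 holds the bound `B`, 3 holds the threshold `θ`, 4, 5, 6 hold
the length, the start and the parity of the cycle found, 7 and 8 are used by the main program.
Arrays: 0 and 1 hold the input, 2 holds the matching, 3 the distances, 4 the vertices of
the cycle, 5 the parities along the cycle, and 6 the new matching. -/

/-- The number of vertices and the two input arrays. -/
structure Inst where
  n : ℕ
  a : ℤ → ℤ
  r : ℤ → ℤ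

/-- The cost of a rung. -/
def Inst.N (I : Inst) : ℕ := I.n + I.n + 2

/-- The cost of a pair that is not an edge. -/
def Inst.K (I : Inst) : ℕ := I.N * I.N

/-- The costs of the prism over the input graph: two copies of the graph, one with vertices
`v < n` and the other with vertices `n + v`, and the rungs `(v, n + v)`. Red edges count in the
first copy only. -/
def Inst.cost (I : Inst) (u v : ℕ) : ℤ :=
  if u < I.n then
    if v < I.n then
      if 0 < I.a (u * I.n + v) then (if 0 < I.r (u * I.n + v) then 1 else 0) else I.K
    else if v = u + I.n then I.N else I.K
  else
    if v < I.n then if u = v + I.n then I.N else I.K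
    else if 0 < I.a ((u - I.n : ℤ) * I.n + (v - I.n : ℤ)) then 0 else I.K

/-- The arc weights of the exchange digraph. -/
def Inst.weight (I : Inst) (μ : ℕ → ℕ) (u v : ℕ) : ℤ := I.cost u (μ v) - I.cost v (μ v)

theorem Inst.even_N (I : Inst) : (I.N : ℤ) % 2 = 0 := by unfold Inst.N; omega

theorem Inst.even_K (I : Inst) : (I.K : ℤ) % 2 = 0 := by
  unfold Inst.K; push_cast; rw [Int.mul_emod, I.even_N]; rfl

/-- The costs are 0, 1, `N` and `K`, and the last two are even. So the parity of a cost, and hence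
of an arc weight, is decided by comparison with 1, without any division. -/
theorem Inst.cost_odd (I : Inst) (u v : ℕ) : I.cost u v % 2 = 1 ↔ I.cost u v = 1 := by
  have h1 := I.even_N
  have h2 := I.even_K
  unfold Inst.cost
  split_ifs <;> omega

/-- The variables and arrays hold the instance and the matching `μ`. -/
structure Env (I : Inst) (B : ℕ) (μ : ℕ → ℕ) (A : ℕ → ℤ → ℤ) (v : ℕ → ℤ) : Prop where
  le : I.n + I.n + 2 ≤ B
  var : v 0 = I.n
  a : A 0 = I.a
  r : A 1 = I.r
  arr_μ : ∀ x < I.n + I.n, A 2 (x : ℕ) = μ x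
  μ_lt : ∀ x < I.n + I.n, μ x < I.n + I.n

theorem cap_natCast {B i : ℕ} (h : i ≤ B) : cap B (i : ℤ) = i := by simp [cap, h]

namespace Tm

def n : Tm := .var 0
def m : Tm := .add n n
def N : Tm := .add m (.lit 2)
def K : Tm := .mul N N

/-- if `a = b` then `x` else `y` -/
def ifEq (a b x y : Tm) : Tm := .ite (.sub a b) y (.ite (.sub b a) y x)

def cost (a b : Tm) : Tm :=
  .ite (.sub n a)
    (.ite (.sub n b)
      (.ite (.ld 0 (.add (.mul a n) b)) (.ite (.ld 1 (.add (.mul a n) b)) (.lit 1) (.lit 0)) K)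
      (.ifEq b (.add a n) N K))
    (.ite (.sub n b) (.ifEq a (.add b n) N K)
      (.ite (.ld 0 (.add (.mul (.sub a n) n) (.sub b n))) (.lit 0) K))

def weight (a b : Tm) : Tm := .sub (cost a (.ld 2 b)) (cost b (.ld 2 b))

/-- The parity flips exactly when one, but not both, of the two costs in the arc weight is 1. -/
def flip (a b p : Tm) : Tm :=
  .ifEq (cost a (.ld 2 b)) (.lit 1) (.ifEq (cost b (.ld 2 b)) (.lit 1) p (.sub (.lit 1) p))
    (.ifEq (cost b (.ld 2 b)) (.lit 1) (.sub (.lit 1) p) p)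

/-- A mixed-radix address. The left factor of `mul` is capped by `B`, so the small number `m` has to
stand on the left. -/
def code (l p x y : Tm) : Tm := .add (.mul m (.add (.mul m (.add (.add l l) p)) x)) y

def min (a b : Tm) : Tm := .ite (.sub a b) b a

/-- the first `i < n` for which `c` is positive, or -1 -/
def first (i a : ℕ) (n c : Tm) : Tm :=
  .fold i a n (.lit (-1)) (.ite (.add (.var a) (.lit 1)) (.var a) (.ite c (.var i) (.lit (-1))))

variable {I : Inst} {B : ℕ} {μ : ℕ → ℕ} {A : ℕ → ℤ → ℤ} {v : ℕ → ℤ}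

theorem eval_ifEq {a b x y : Tm} : (ifEq a b x y).eval B A v =
    if a.eval B A v = b.eval B A v then x.eval B A v else y.eval B A v := by
  simp only [ifEq, Tm.eval]
  split_ifs <;> first | rfl | omega

theorem eval_min {a b : Tm} : (min a b).eval B A v = Min.min (a.eval B A v) (b.eval B A v) := by
  simp only [min, Tm.eval]
  rcases lt_or_ge (b.eval B A v) (a.eval B A v) with h | h
  · rw [min_eq_right h.le]
    exact if_pos (sub_pos.2 h)
  · rw [min_eq_left h]
    exact if_neg (sub_nonpos.2 h).not_gt

theorem eval_m (hE : Env I B μ A v) : m.eval B A v = (I.n + I.n : ℕ) := by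
  simp [m, n, Tm.eval, hE.var]

theorem eval_K (hE : Env I B μ A v) : K.eval B A v = I.K := by
  have h : N.eval B A v = I.N := by simp [N, Tm.eval, eval_m hE, Inst.N]
  simp only [K, Tm.eval, h, Inst.K]
  rw [cap_natCast (show I.N ≤ B from hE.le)]
  push_cast; rfl

/-- The bound on `i` keeps the first factor of the address `i * n + j`, or its shift by `n`, below
the cap of the multiplication. -/
theorem eval_cost (hE : Env I B μ A v) {a b : Tm} {i j : ℕ} (ha : a.eval B A v = i)
    (hb : b.eval B A v = j) (hi : i < I.n + I.n) :
    (cost a b).eval B A v = I.cost i j := by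
  have h : N.eval B A v = I.N := by simp [N, Tm.eval, eval_m hE, Inst.N]
  have hle := hE.le
  have hn : n.eval B A v = I.n := hE.var
  simp only [cost, Tm.eval, eval_ifEq, eval_K hE, ha, hb, h, hn, hE.a, hE.r, Inst.cost, sub_pos,
    Nat.cast_lt]
  rw [cap_natCast (by omega : i ≤ B)]
  by_cases hin : i < I.n
  · simp only [hin, if_true]
    by_cases hjn : j < I.n
    · simp only [hjn, if_true]
    · simp only [hjn, if_false]
      norm_cast
  · have : cap B ((i : ℤ) - I.n) = i - I.n := by
      rw [← Nat.cast_sub (by omega), cap_natCast (by omega)]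
    rw [this, Nat.cast_sub (by omega)]
    simp only [hin, if_false]
    norm_cast

theorem eval_weight (hE : Env I B μ A v) {a b : Tm} {i j : ℕ} (ha : a.eval B A v = i)
    (hb : b.eval B A v = j) (hi : i < I.n + I.n) (hj : j < I.n + I.n) :
    (weight a b).eval B A v = I.weight μ i j := by
  have h : (ld 2 b).eval B A v = μ j := by simp only [Tm.eval, hb, hE.arr_μ j hj]
  simp only [weight, Tm.eval, eval_cost hE ha h hi, eval_cost hE hb h hj, Inst.weight]

theorem eval_flip (hE : Env I B μ A v) {a b p : Tm} {i j q : ℕ} (ha : a.eval B A v = i)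
    (hb : b.eval B A v = j) (hp : p.eval B A v = q) (hq : q < 2) (hi : i < I.n + I.n)
    (hj : j < I.n + I.n) :
    (flip a b p).eval B A v = BCPM.flip (I.weight μ i j) q := by
  have h : (ld 2 b).eval B A v = μ j := by simp only [Tm.eval, hb, hE.arr_μ j hj]
  have h1 := I.cost_odd i (μ j)
  have h2 := I.cost_odd j (μ j)
  have h3 : ((1 - q : ℕ) : ℤ) = 1 - q := by omega
  have h4 : I.weight μ i j = I.cost i (μ j) - I.cost j (μ j) := rfl
  simp only [flip, eval_ifEq, eval_cost hE ha h hi, eval_cost hE hb h hj, Tm.eval, hp]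
  by_cases hw : I.weight μ i j % 2 = 1
  · rw [BCPM.flip, if_pos hw, h3]
    split_ifs <;> first | rfl | omega
  · rw [BCPM.flip, if_neg hw]
    split_ifs <;> first | rfl | omega

/-- The address of a distance. -/
def codeNat (m l p x y : ℕ) : ℕ := m * (m * (l + l + p) + x) + y

/-- The last two digits are read off in base `m`; what remains is `2 * l + p` with `p < 2`. Distinct
distances therefore never share a cell. -/
theorem codeNat_inj {m l p x y l' p' x' y' : ℕ} (hp : p < 2) (hx : x < m) (hy : y < m)
    (hp' : p' < 2) (hx' : x' < m) (hy' : y' < m)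
    (h : codeNat m l p x y = codeNat m l' p' x' y') : l = l' ∧ p = p' ∧ x = x' ∧ y = y' := by
  have key : ∀ {a b c d : ℕ}, b < m → d < m → m * a + b = m * c + d → a = c ∧ b = d := by
    intro a b c d hb hd h
    have h1 : b = d := by
      have := congrArg (· % m) h
      simpa [Nat.mul_add_mod, Nat.mod_eq_of_lt hb, Nat.mod_eq_of_lt hd] using this
    subst h1
    exact ⟨Nat.eq_of_mul_eq_mul_left (by omega : 0 < m) (by omega), rfl⟩
  obtain ⟨h1, h2⟩ := key hy hy' h
  obtain ⟨h3, h4⟩ := key hx hx' h1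
  omega

theorem eval_code (hE : Env I B μ A v) {l p x y : Tm} {l' p' x' y' : ℕ}
    (hl : l.eval B A v = l') (hp : p.eval B A v = p') (hx : x.eval B A v = x')
    (hy : y.eval B A v = y') :
    (code l p x y).eval B A v = codeNat (I.n + I.n) l' p' x' y' := by
  have := hE.le
  simp only [code, Tm.eval, eval_m hE, hl, hp, hx, hy, codeNat]
  rw [cap_natCast (by omega)]
  push_cast; rfl

theorem eval_fold {i a N : ℕ} {n init body : Tm} (hN : n.eval B A v = N) (hNB : N ≤ B) :
    (fold i a n init body).eval B A v =
      iter (fun j r => body.eval B A (Function.update (Function.update v i (j : ℤ)) a r))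
        (init.eval B A v) N := by
  simp only [Tm.eval, hN, cap_natCast hNB]

theorem iter_congr {α : Type*} {f g : ℕ → α → α} {x : α} {N : ℕ}
    (h : ∀ j < N, ∀ r, f j r = g j r) : iter f x N = iter g x N := by
  induction N with
  | zero => rfl
  | succ N ih =>
    simp only [iter]
    rw [ih fun j hj => h j (by omega), h N (by omega)]

theorem eval_first {i a N : ℕ} {n c : Tm} (hN : n.eval B A v = N) (hNB : N ≤ B) (P : ℕ → Prop)
    (hia : i ≠ a)
    (hc : ∀ j < N, ∀ r, 0 < c.eval B A (Function.update (Function.update v i (j : ℤ)) a r) ↔ P j) :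
    ((first i a n c).eval B A v = -1 ∧ ∀ j < N, ¬ P j) ∨
      ∃ j < N, (first i a n c).eval B A v = j ∧ P j ∧ ∀ j' < j, ¬ P j' := by
  rw [first, eval_fold hN hNB]
  refine iter_induct (N := N) (fun j (r : ℤ) => (r = -1 ∧ ∀ j' < j, ¬ P j') ∨
    ∃ j' < j, r = j' ∧ P j' ∧ ∀ i < j', ¬ P i) ?_ ?_
  · left; simp [Tm.eval]
  · intro j hj r hr
    simp only [Tm.eval, hc j hj r, Function.update_self]
    rw [Function.update_of_ne hia, Function.update_self]
    rcases hr with ⟨rfl, hr⟩ | ⟨j', hj', rfl, hP, hr⟩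
    · by_cases hP : P j
      · right
        exact ⟨j, by omega, by rw [if_neg (by omega), if_pos ((hc j hj _).2 hP)], hP, hr⟩
      · left
        refine ⟨by rw [if_neg (by omega), if_neg fun h => hP ((hc j hj _).1 h)], fun j' hj' => ?_⟩
        rcases Nat.lt_succ_iff_lt_or_eq.1 hj' with h | rfl
        · exact hr j' h
        · exact hP
    · right
      refine ⟨j', by omega, ?_, hP, hr⟩
      rw [if_pos (by omega)]

end Tm

theorem Env.update {I : Inst} {B : ℕ} {μ : ℕ → ℕ} {A : ℕ → ℤ → ℤ} {v : ℕ → ℤ}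
    (hE : Env I B μ A v) {i : ℕ} (hi : 0 ≠ i) (z : ℤ) : Env I B μ A (Function.update v i z) :=
  { hE with var := by rw [Function.update_of_ne hi]; exact hE.var }

/-- The memory holds the instance and the matching `μ`. -/
def Holds (I : Inst) (B : ℕ) (μ : ℕ → ℕ) (s : Memory) : Prop := Env I B μ s.arr s.reg

theorem Holds.congr {I : Inst} {B : ℕ} {μ : ℕ → ℕ} {s s' : Memory} (h : Holds I B μ s)
    (hr : s'.reg 0 = s.reg 0) (h0 : s'.arr 0 = s.arr 0) (h1 : s'.arr 1 = s.arr 1)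
    (h2 : s'.arr 2 = s.arr 2) : Holds I B μ s' :=
  ⟨h.le, hr.trans h.var, h0.trans h.a, h1.trans h.r, by rw [h2]; exact h.arr_μ, h.μ_lt⟩

/-! ### Computing the distances -/

namespace Tm

/-- The distance, computed from shorter distances. -/
def distStep (l p x y : ℕ) : Tm :=
  .ite (.var l)
    (.fold 14 15 m K (.min (.var 15) (.add (.weight (.var x) (.var 14))
      (.ld 3 (.code (.sub (.var l) (.lit 1)) (.flip (.var x) (.var 14) (.var p)) (.var 14)
        (.var y))))))
    (.ite (.var p) K (.ifEq (.var x) (.var y) (.lit 0) K))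

end Tm

/-- Fill the array of distances. -/
def Stm.fill : Stm :=
  .rep 10 (.add .m (.lit 1)) (.rep 11 (.lit 2) (.rep 12 .m (.rep 13 .m
    (.st 3 (.code (.var 10) (.var 11) (.var 12) (.var 13)) (.distStep 10 11 12 13)))))

/-- The lexicographic order. -/
def Before (l p x y l' p' x' y' : ℕ) : Prop :=
  l < l' ∨ l = l' ∧ (p < p' ∨ p = p' ∧ (x < x' ∨ x = x' ∧ y < y'))

/-- All distances before a given one are known. -/
def Known (I : Inst) (μ : ℕ → ℕ) (l p x y : ℕ) (s : Memory) : Prop :=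
  ∀ l' p' x' y', p' < 2 → x' < I.n + I.n → y' < I.n + I.n → Before l' p' x' y' l p x y →
    s.arr 3 (Tm.codeNat (I.n + I.n) l' p' x' y') = dist (I.weight μ) (I.n + I.n) I.K l' p' x' y'

theorem eval_distStep {I : Inst} {B : ℕ} {μ : ℕ → ℕ} {s : Memory} (hE : Holds I B μ s)
    {l p x y : ℕ} (hp : p < 2) (hx : x < I.n + I.n) (hy : y < I.n + I.n)
    (hK : Known I μ l p x y s) (h10 : s.reg 10 = l) (h11 : s.reg 11 = p) (h12 : s.reg 12 = x)
    (h13 : s.reg 13 = y) : (Tm.distStep 10 11 12 13).eval B s.arr s.reg =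
      dist (I.weight μ) (I.n + I.n) I.K l p x y := by
  have hle := hE.le
  simp only [Tm.distStep, Tm.eval.eq_7]
  rcases l with _ | l
  · simp only [Tm.eval.eq_2, h10, Nat.cast_zero, lt_irrefl, if_false, dist, Tm.eval_ifEq, h11,
      Tm.eval_K hE, h12, h13, Tm.eval.eq_1, Nat.cast_inj]
    split_ifs <;> first | rfl | omega
  · rw [if_pos (by simp only [Tm.eval, h10]; omega), Tm.eval_fold (Tm.eval_m hE) (by omega),
      Tm.eval_K hE, dist]
    refine Tm.iter_congr fun z hz r => ?_
    have hE' : Env I B μ s.arr (Function.update (Function.update s.reg 14 (z : ℤ)) 15 r) :=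
      (hE.update (by decide) _).update (by decide) _
    have e12 : (Tm.var 12).eval B s.arr (Function.update (Function.update s.reg 14 (z : ℤ)) 15 r)
      = x := by simp [Tm.eval, h12]
    have e13 : (Tm.var 13).eval B s.arr (Function.update (Function.update s.reg 14 (z : ℤ)) 15 r)
      = y := by simp [Tm.eval, h13]
    have e11 : (Tm.var 11).eval B s.arr (Function.update (Function.update s.reg 14 (z : ℤ)) 15 r)
      = p := by simp [Tm.eval, h11]
    have e14 : (Tm.var 14).eval B s.arr (Function.update (Function.update s.reg 14 (z : ℤ)) 15 r)
      = z := by simp [Tm.eval]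
    have e10 : (Tm.sub (Tm.var 10) (Tm.lit 1)).eval B s.arr
      (Function.update (Function.update s.reg 14 (z : ℤ)) 15 r) = l := by simp [Tm.eval, h10]
    rw [Tm.eval_min]
    simp only [Tm.eval.eq_3, Tm.eval.eq_6]
    rw [Tm.eval_weight hE' e12 e14 hx hz,
      Tm.eval_code hE' e10 (Tm.eval_flip hE' e12 e14 e11 hp hx hz) e14 e13,
      -- Only distances with one arc less are read, and all of these come earlier in the
      -- lexicographic order.
      hK _ _ _ _ (flip_lt hp) hz hy (Or.inl (by omega))]
    simp [Tm.eval]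

/-- The four nested loops visit the cells in lexicographic order, and finishing an inner loop is the
same as standing at the beginning of the next outer round. Injectivity of the addresses protects
what has been written. -/
theorem Stm.known_fill {I : Inst} {B : ℕ} {μ : ℕ → ℕ} {s : Memory} (hE : Holds I B μ s) :
    Known I μ (I.n + I.n + 1) 0 0 0 (Stm.fill.eval B s) := by
  have hle := hE.le
  have em : ∀ {s' : Memory}, s'.reg 0 = s.reg 0 →
      Tm.m.eval B s'.arr s'.reg = (I.n + I.n : ℕ) := by
    intro s' h
    have := hE.var
    simp [Tm.m, Tm.n, Tm.eval, h, this]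
  have mono : ∀ {l p x y l₁ p₁ x₁ y₁ : ℕ} {s' s'' : Memory}, Known I μ l p x y s' →
      s''.arr = s'.arr → (∀ l' p' x' y', p' < 2 → x' < I.n + I.n → y' < I.n + I.n →
        Before l' p' x' y' l₁ p₁ x₁ y₁ → Before l' p' x' y' l p x y) →
      Known I μ l₁ p₁ x₁ y₁ s'' := by
    intro l p x y l₁ p₁ x₁ y₁ s' s'' h ha hb l' p' x' y' hp' hx' hy' hB
    rw [ha]
    exact h l' p' x' y' hp' hx' hy' (hb _ _ _ _ hp' hx' hy' hB)
  refine Stm.eval_rep (B := B) (fun l s' => Known I μ l 0 0 0 s') (N := I.n + I.n + 1) ?_ (by omega) ?_ ?_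
  · simp [Tm.eval, em]
  · intro l' p' x' y' _ _ _ h; unfold Before at h; omega
  intro l hl s₁ h₁ hr₁ ha₁
  refine mono (Stm.eval_rep (B := B) (s := s₁.set 10 l) (fun p s' => Known I μ l p 0 0 s') (N := 2) rfl (by omega)
    (mono h₁ rfl (fun _ _ _ _ _ _ _ h => h)) ?_) rfl ?_
  rotate_left
  · intros; unfold Before at *; omega
  intro p hp s₂ h₂ hr₂ ha₂
  refine mono (Stm.eval_rep (B := B) (s := s₂.set 11 p) (fun x s' => Known I μ l p x 0 s') (N := I.n + I.n) (em ?_) (by omega)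
    (mono h₂ rfl (fun _ _ _ _ _ _ _ h => h)) ?_) rfl ?_
  rotate_left 2
  · intros; unfold Before at *; omega
  · simp [hr₂ 0 (by decide) rfl, hr₁ 0 (by decide) rfl]
  intro x hx s₃ h₃ hr₃ ha₃
  refine mono (Stm.eval_rep (B := B) (s := s₃.set 12 x) (fun y s' => Known I μ l p x y s') (N := I.n + I.n) (em ?_) (by omega)
    (mono h₃ rfl (fun _ _ _ _ _ _ _ h => h)) ?_) rfl ?_
  rotate_left 2
  · intros; unfold Before at *; omega
  · simp [hr₃ 0 (by decide) rfl, hr₂ 0 (by decide) rfl, hr₁ 0 (by decide) rfl]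
  intro y hy s₄ h₄ hr₄ ha₄
  have hE₄ : Holds I B μ (s₄.set 13 y) := hE.congr
    (by simp [hr₄ 0 (by decide) rfl, hr₃ 0 (by decide) rfl, hr₂ 0 (by decide) rfl,
      hr₁ 0 (by decide) rfl])
    (by simp [ha₄ 0 rfl, ha₃ 0 rfl, ha₂ 0 rfl, ha₁ 0 rfl])
    (by simp [ha₄ 1 rfl, ha₃ 1 rfl, ha₂ 1 rfl, ha₁ 1 rfl])
    (by simp [ha₄ 2 rfl, ha₃ 2 rfl, ha₂ 2 rfl, ha₁ 2 rfl])
  have e10 : (s₄.set 13 y).reg 10 = l := by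
    simp [hr₄ 10 (by decide) rfl, hr₃ 10 (by decide) rfl, hr₂ 10 (by decide) rfl]
  have e11 : (s₄.set 13 y).reg 11 = p := by
    simp [hr₄ 11 (by decide) rfl, hr₃ 11 (by decide) rfl]
  have e12 : (s₄.set 13 y).reg 12 = x := by
    simp [hr₄ 12 (by decide) rfl]
  have e13 : (s₄.set 13 y).reg 13 = y := by simp
  intro l' p' x' y' hp' hx' hy' hB
  simp only [Stm.eval, eval_distStep hE₄ hp hx hy h₄ e10 e11 e12 e13,
    Tm.eval_code hE₄ (l := .var 10) (p := .var 11) (x := .var 12) (y := .var 13) e10 e11 e12 e13,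
    Function.update_self]
  by_cases he : Tm.codeNat (I.n + I.n) l' p' x' y' = Tm.codeNat (I.n + I.n) l p x y
  · obtain ⟨rfl, rfl, rfl, rfl⟩ := Tm.codeNat_inj hp' hx' hy' hp hx hy he
    simp
  · rw [Function.update_of_ne (by exact_mod_cast he)]
    refine h₄ l' p' x' y' hp' hx' hy' ?_
    by_contra hB'
    apply he
    unfold Before at hB hB'
    congr 1 <;> omega

/-! ### One improvement step -/

/-- The weighted graph `H` is the prism described by the instance `I`. -/
structure Inst.Represents (I : Inst) (H : CostGraph (Fin (I.n + I.n))) : Prop where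
  c : ∀ u v, H.c u v = I.cost u v
  K : H.K = I.K
  N : H.N = I.N

/-- A map on `Fin m` as a map on natural numbers. -/
def ext {m : ℕ} (μ : Fin m → Fin m) (x : ℕ) : ℕ := if h : x < m then μ ⟨x, h⟩ else 0

@[simp] theorem ext_val {m : ℕ} (μ : Fin m → Fin m) (x : Fin m) : ext μ x = μ x := by
  simp [ext]

/-- There is a light closed walk with `l` arcs from `u`. -/
def Good (I : Inst) (μ : ℕ → ℕ) (θ : ℤ) (l u : ℕ) : Prop :=
  dist (I.weight μ) (I.n + I.n) I.K l 0 u u < 0 ∨ dist (I.weight μ) (I.n + I.n) I.K l 1 u u ≤ θ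

section
variable {I : Inst} {H : CostGraph (Fin (I.n + I.n))} {μ : Fin (I.n + I.n) → Fin (I.n + I.n)}

theorem Inst.Represents.weight (hI : I.Represents H) (u v : Fin (I.n + I.n)) :
    I.weight (ext μ) u v = H.weight μ u v := by
  simp [Inst.weight, CostGraph.weight, hI.c]

theorem Inst.Represents.neg_le (hI : I.Represents H) (hM : H.Matching μ) :
    ∀ x < I.n + I.n, ∀ y < I.n + I.n, -(I.N : ℤ) ≤ I.weight (ext μ) x y := by
  intro x hx y hy
  rw [hI.weight ⟨x, hx⟩ ⟨y, hy⟩, ← hI.N]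
  exact CostGraph.neg_le_weight hM _ _

/-- The table never overestimates a walk of the right parity. This is what turns the failure of the
search into the absence of acceptable closed walks. -/
theorem Inst.Represents.good_of_walk (hI : I.Represents H) {θ : ℤ} {l : ℕ}
    (h : HasWalk (H.weight μ) θ l) : ∃ u < I.n + I.n, Good I (ext μ) θ l u := by
  obtain ⟨z, hz, hA⟩ := h
  have hw : wt (I.weight (ext μ)) (fun t => (z t : ℕ)) l = wt (H.weight μ) z l :=
    wt_congr fun t _ => hI.weight _ _
  refine ⟨z 0, (z 0).2, ?_⟩
  have hd : ∀ p : ℕ, p < 2 → (wt (H.weight μ) z l - p) % 2 = 0 →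
      dist (I.weight (ext μ)) (I.n + I.n) I.K l p (z 0) (z 0) ≤ wt (H.weight μ) z l := by
    intro p hp he
    have := dist_le (W := I.weight (ext μ)) (K := I.K) (z := fun t => (z t : ℕ)) (l := l)
      (fun t => (z t).2) hp (by rw [hw]; exact he)
    rwa [hw, hz] at this
  rcases hA with ⟨h1, h2⟩ | ⟨h1, h2⟩
  · exact Or.inl ((hd 0 (by omega) (by simpa using h1)).trans_lt h2)
  · exact Or.inr ((hd 1 (by omega) (by push_cast; omega)).trans h2)

/-- K = N² = 2nN + 2N exceeds the loss lN of a walk with at most 2n arcs by more than n. This is the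
margin needed for thresholds up to n. -/
theorem Inst.K_bound (I : Inst) {l : ℕ} (hl : l ≤ I.n + I.n) : (I.n : ℤ) + l * I.N < I.K := by
  have h : l * I.N ≤ (I.n + I.n) * I.N := Nat.mul_le_mul_right _ hl
  have h2 : I.K = (I.n + I.n) * I.N + 2 * I.N := by unfold Inst.K Inst.N; ring
  have h3 : I.n < 2 * I.N := by unfold Inst.N; omega
  have : I.n + l * I.N < I.K := by omega
  exact_mod_cast this

/-- A complete trace of minimal length gives a better matching. -/
theorem Inst.Represents.exch_of_trace (hI : I.Represents H) (hM : H.Matching μ) {θ : ℤ}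
    (hθ : -1 ≤ θ) (hθn : θ ≤ I.n) {l p u : ℕ} (hl : l ≤ I.n + I.n)
    (hp : p = 0 ∧ dist (I.weight (ext μ)) (I.n + I.n) I.K l 0 u u < 0 ∨
      p = 1 ∧ dist (I.weight (ext μ)) (I.n + I.n) I.K l 1 u u ≤ θ)
    (hmin : ∀ l' < l, ∀ u' < I.n + I.n, ¬ Good I (ext μ) θ l' u') {z q : ℕ → ℕ}
    (hT : Trace (I.weight (ext μ)) (I.n + I.n) I.K l p u z q l) (zF : ℕ → Fin (I.n + I.n))
    (hzF : ∀ t ≤ l, (zF t : ℕ) = z t) :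
    H.Matching (CostGraph.exch μ zF l) ∧
      Acc θ (H.cost (CostGraph.exch μ zF l) - H.cost μ) := by
  have hd : dist (I.weight (ext μ)) (I.n + I.n) I.K l p u u ≤ I.n := by
    rcases hp with ⟨rfl, h⟩ | ⟨rfl, h⟩ <;> omega
  have hKb := I.K_bound hl
  obtain ⟨hz, hw, hpar⟩ := hT.closed (N := I.N) (hI.neg_le hM) (by linarith)
  have hwF : wt (H.weight μ) zF l = wt (I.weight (ext μ)) z l :=
    wt_congr fun t ht => by rw [← hI.weight, hzF t ht.le, hzF (t + 1) ht]
  have hA : Acc θ (wt (H.weight μ) zF l) := by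
    rw [hwF]
    rw [← hw] at hd
    rcases hp with ⟨rfl, h⟩ | ⟨rfl, h⟩
    · left; push_cast at hpar; omega
    · right; push_cast at hpar; omega
  have hzF0 : zF l = zF 0 := Fin.ext (by rw [hzF l le_rfl, hzF 0 (by omega), hz])
  -- A shorter acceptable closed walk would show up in the table as a smaller good length.
  have hinj := injOn_of_shortest hθ hzF0 hA fun n' hn' hW => by
    obtain ⟨u', hu', hG⟩ := hI.good_of_walk hW
    exact hmin n' hn' u' hu' hG
  have hlt := hM.lt_of_wt (z := zF) (n := l) (by rw [hwF, hw, hI.N, hI.K]; linarith)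
  obtain ⟨h1, h2⟩ := hM.exch hzF0 hinj hlt
  refine ⟨h1, ?_⟩
  rw [h2, add_sub_cancel_left]
  exact hA

end

/-! ### The improvement step as a program, and its correctness. -/

namespace Tm

def dist (l p x y : Tm) : Tm := .ld 3 (.code l p x y)

/-- positive if there is a light closed walk with `l` arcs from `u` -/
def good (l u : Tm) : Tm :=
  .ite (.sub (.lit 0) (.dist l (.lit 0) u u)) (.lit 1)
    (.ite (.sub (.add (.var 3) (.lit 1)) (.dist l (.lit 1) u u)) (.lit 1) (.lit 0))

/-- positive if the vertex in variable 11 continues the cycle -/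
def isNext : Tm :=
  .ifEq
    (.add (.weight (.ld 4 (.var 10)) (.var 11))
      (.dist (.sub (.sub (.var 4) (.var 10)) (.lit 1))
        (.flip (.ld 4 (.var 10)) (.var 11) (.ld 5 (.var 10))) (.var 11) (.var 5)))
    (.dist (.sub (.var 4) (.var 10)) (.ld 5 (.var 10)) (.ld 4 (.var 10)) (.var 5))
    (.lit 1) (.lit 0)

def exchange : Tm :=
  .fold 11 12 (.var 4) (.ld 2 (.var 10))
    (.ifEq (.var 10) (.ld 4 (.var 11)) (.ld 2 (.ld 4 (.add (.var 11) (.lit 1))))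
      (.ifEq (.var 10) (.ld 2 (.ld 4 (.add (.var 11) (.lit 1)))) (.ld 4 (.var 11)) (.var 12)))

end Tm

namespace Stm

/-- The walk is recovered greedily from the table: the next vertex is one at which the recursion
attains its minimum. Array 5 records the parity still owed. -/
def trace : Stm :=
  .rep 10 (.var 4) (.seq (.st 4 (.add (.var 10) (.lit 1)) (.first 11 12 .m .isNext))
    (.st 5 (.add (.var 10) (.lit 1))
      (.flip (.ld 4 (.var 10)) (.ld 4 (.add (.var 10) (.lit 1))) (.ld 5 (.var 10)))))

/-- Lengths up to the number 2n of vertices of the prism suffice, because an orbit of a permutation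
is no longer than that. The shortest length is taken so that the walk is a cycle. -/
def find : Stm :=
  .set 4 (.first 10 11 (.add .m (.lit 1))
    (.add (.first 12 13 .m (.good (.var 10) (.var 12))) (.lit 1)))

/-- Parity 0 is used when it gives a negative weight; otherwise, since the length and the start are
good, parity 1 works. -/
def start : Stm :=
  .seq (.set 5 (.first 12 13 .m (.good (.var 4) (.var 12))))
    (.seq (.set 6 (.ite (.sub (.lit 0) (.dist (.var 4) (.lit 0) (.var 5) (.var 5))) (.lit 0) (.lit 1)))
      (.seq (.st 4 (.lit 0) (.var 5)) (.st 5 (.lit 0) (.var 6))))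

/-- The new matching goes to array 6 first, because every new partner is computed from the old
matching in array 2. -/
def update : Stm :=
  .seq (.rep 10 .m (.st 6 (.var 10) .exchange)) (.rep 10 .m (.st 2 (.var 10) (.ld 6 (.var 10))))

/-- Find a shortest closed walk of acceptable weight and exchange along it. -/
def improve : Stm :=
  .seq .fill (.seq .find
    (.ite (.add (.var 4) (.lit 1)) (.seq .start (.seq .trace .update)) .skip))

end Stm

/-- The distances are in array 3. -/
def Dists (I : Inst) (μ : ℕ → ℕ) (A : ℕ → ℤ → ℤ) : Prop :=
  ∀ l ≤ I.n + I.n, ∀ p < 2, ∀ x < I.n + I.n, ∀ y < I.n + I.n,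
    A 3 (Tm.codeNat (I.n + I.n) l p x y) = dist (I.weight μ) (I.n + I.n) I.K l p x y

section
variable {I : Inst} {B : ℕ} {μ : ℕ → ℕ} {A : ℕ → ℤ → ℤ} {v : ℕ → ℤ}

theorem Tm.eval_dist (hE : Env I B μ A v) (hD : Dists I μ A) {l p x y : Tm} {l' p' x' y' : ℕ}
    (hl : l.eval B A v = l') (hp : p.eval B A v = p') (hx : x.eval B A v = x')
    (hy : y.eval B A v = y') (hl' : l' ≤ I.n + I.n) (hp' : p' < 2) (hx' : x' < I.n + I.n)
    (hy' : y' < I.n + I.n) :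
    (Tm.dist l p x y).eval B A v = BCPM.dist (I.weight μ) (I.n + I.n) I.K l' p' x' y' := by
  rw [Tm.dist, Tm.eval.eq_6, Tm.eval_code hE hl hp hx hy, hD l' hl' p' hp' x' hx' y' hy']

theorem Tm.eval_good (hE : Env I B μ A v) (hD : Dists I μ A) {l u : Tm} {l' u' : ℕ}
    (hl : l.eval B A v = l') (hu : u.eval B A v = u') (hl' : l' ≤ I.n + I.n)
    (hu' : u' < I.n + I.n) :
    0 < (Tm.good l u).eval B A v ↔ Good I μ (v 3) l' u' := by
  have h0 := Tm.eval_dist hE hD hl (p := .lit 0) (p' := 0) rfl hu hu hl' (by omega) hu' hu'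
  have h1 := Tm.eval_dist hE hD hl (p := .lit 1) (p' := 1) rfl hu hu hl' (by omega) hu' hu'
  simp only [Tm.good, Tm.eval, h0, h1, Good]
  split_ifs <;> constructor <;> intros <;> omega

theorem eval_find {s : Memory} (hE : Holds I B μ s) (hD : Dists I μ s.arr) :
    ((Stm.find.eval B s).reg 4 = -1 ∧ ∀ l ≤ I.n + I.n, ∀ u < I.n + I.n, ¬ Good I μ (s.reg 3) l u) ∨
      ∃ l ≤ I.n + I.n, (Stm.find.eval B s).reg 4 = l ∧ (∃ u < I.n + I.n, Good I μ (s.reg 3) l u) ∧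
        ∀ l' < l, ∀ u < I.n + I.n, ¬ Good I μ (s.reg 3) l' u := by
  have hle := hE.le
  have key := Tm.eval_first (B := B) (A := s.arr) (v := s.reg) (i := 10) (a := 11)
    (N := I.n + I.n + 1) (n := .add .m (.lit 1))
    (c := .add (.first 12 13 .m (.good (.var 10) (.var 12))) (.lit 1))
    (by simp only [Tm.eval.eq_3, Tm.eval_m hE, Tm.eval.eq_1]; push_cast; rfl) (by omega)
    (fun l => ∃ u < I.n + I.n, Good I μ (s.reg 3) l u) (by decide) ?_
  · simp only [Stm.find, Stm.eval, Memory.set_reg, if_true]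
    rcases key with ⟨h1, h2⟩ | ⟨l, hl, h1, h2, h3⟩
    · refine Or.inl ⟨h1, fun l hl u hu hG => h2 l (by omega) ⟨u, hu, hG⟩⟩
    · exact Or.inr ⟨l, by omega, h1, h2, fun l' hl' u hu hG => h3 l' hl' ⟨u, hu, hG⟩⟩
  · intro l hl r
    have hE' : Env I B μ s.arr (Function.update (Function.update s.reg 10 (l : ℤ)) 11 r) :=
      (Env.update hE (by decide) _).update (by decide) _
    have key := Tm.eval_first (i := 12) (a := 13) (c := .good (.var 10) (.var 12))
      (Tm.eval_m hE') (by omega) (fun u => Good I μ (s.reg 3) l u) (by decide) (fun u hu r' => by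
        rw [Tm.eval_good (u' := u) (l' := l) ((hE'.update (by decide) _).update (by decide) _) hD
          (by simp [Tm.eval]) (by simp [Tm.eval]) (by omega) hu]
        simp)
    simp only [Tm.eval.eq_3, Tm.eval.eq_1]
    rcases key with ⟨h1, h2⟩ | ⟨u, hu, h1, h2, h3⟩
    · rw [h1]
      constructor
      · intro h; omega
      · rintro ⟨u, hu, hG⟩; exact absurd hG (h2 u hu)
    · rw [h1]
      exact ⟨fun _ => ⟨u, hu, h2⟩, fun _ => by omega⟩

theorem eval_start {s : Memory} (hE : Holds I B μ s) (hD : Dists I μ s.arr) {l : ℕ}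
    (hl : l ≤ I.n + I.n) (h4 : s.reg 4 = l) (hG : ∃ u < I.n + I.n, Good I μ (s.reg 3) l u) :
    ∃ u p : ℕ, u < I.n + I.n ∧
      (p = 0 ∧ dist (I.weight μ) (I.n + I.n) I.K l 0 u u < 0 ∨
        p = 1 ∧ dist (I.weight μ) (I.n + I.n) I.K l 1 u u ≤ s.reg 3) ∧
      (Stm.start.eval B s).reg 5 = u ∧ (Stm.start.eval B s).arr 4 0 = u ∧
      (Stm.start.eval B s).arr 5 0 = p := by
  have hle := hE.le
  have key := Tm.eval_first (i := 12) (a := 13) (c := .good (.var 4) (.var 12))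
    (Tm.eval_m hE) (by omega) (fun u => Good I μ (s.reg 3) l u) (by decide) (fun u hu r' => by
      rw [Tm.eval_good (u' := u) (l' := l) ((Env.update hE (by decide) _).update (by decide) _) hD
        (by simp [Tm.eval, h4]) (by simp [Tm.eval]) (by omega) hu]
      simp)
  rcases key with ⟨-, h2⟩ | ⟨u, hu, h1, h2, -⟩
  · obtain ⟨u, hu, hG⟩ := hG
    exact absurd hG (h2 u hu)
  set s₁ := s.set 5 u with hs₁
  have e₁ : Stm.eval B (.set 5 (.first 12 13 .m (.good (.var 4) (.var 12)))) s = s₁ := by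
    simp only [Stm.eval, h1, hs₁]
  have hE₁ : Holds I B μ s₁ := hE.congr (by simp [hs₁]) rfl rfl rfl
  have e₂ := Tm.eval_dist hE₁ hD (l := .var 4) (p := .lit 0) (x := .var 5) (y := .var 5) (l' := l)
    (p' := 0) (x' := u) (y' := u) (by simp [Tm.eval, hs₁, h4]) rfl (by simp [Tm.eval, hs₁])
    (by simp [Tm.eval, hs₁]) hl (by omega) hu hu
  have e₃ : (Tm.ite (.sub (.lit 0) (.dist (.var 4) (.lit 0) (.var 5) (.var 5))) (.lit 0)
      (.lit 1)).eval B s₁.arr s₁.reg =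
      if dist (I.weight μ) (I.n + I.n) I.K l 0 u u < 0 then 0 else 1 := by
    simp only [Tm.eval, e₂, sub_pos]
  refine ⟨u, if dist (I.weight μ) (I.n + I.n) I.K l 0 u u < 0 then 0 else 1, hu, ?_, ?_, ?_, ?_⟩
  · split_ifs with h
    · exact Or.inl ⟨rfl, h⟩
    · exact Or.inr ⟨rfl, h2.resolve_left h⟩
  · simp only [Stm.start, Stm.eval.eq_4, e₁]
    simp [Stm.eval, hs₁]
  · simp only [Stm.start, Stm.eval.eq_4, e₁]
    simp [Stm.eval, hs₁, Tm.eval]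
  · simp only [Stm.start, Stm.eval.eq_4, e₁]
    rw [Stm.eval.eq_2, e₃]
    simp [Stm.eval, Tm.eval]


/-- The loop keeps a `Trace` as its invariant, and `Trace.exists_next` ensures that the search for
the next vertex never fails. -/
theorem eval_trace {s : Memory} (hE : Holds I B μ s) (hD : Dists I μ s.arr) {l u p : ℕ} {N : ℤ}
    (hl : l ≤ I.n + I.n) (hu : u < I.n + I.n) (hp : p < 2) (h4 : s.reg 4 = l) (h5 : s.reg 5 = u)
    (ha4 : s.arr 4 0 = u) (ha5 : s.arr 5 0 = p) (hN : 0 ≤ N)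
    (hW : ∀ x < I.n + I.n, ∀ y < I.n + I.n, -N ≤ I.weight μ x y)
    (hK : dist (I.weight μ) (I.n + I.n) I.K l p u u + l * N < I.K) :
    ∃ z q, Trace (I.weight μ) (I.n + I.n) I.K l p u z q l ∧
      ∀ t ≤ l, (Stm.trace.eval B s).arr 4 (t : ℕ) = z t := by
  have hle := hE.le
  suffices H : ∃ z q, Trace (I.weight μ) (I.n + I.n) I.K l p u z q l ∧ ∀ t ≤ l,
      (Stm.trace.eval B s).arr 4 (t : ℕ) = z t ∧ (Stm.trace.eval B s).arr 5 (t : ℕ) = q t by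
    obtain ⟨z, q, hT, h⟩ := H
    exact ⟨z, q, hT, fun t ht => (h t ht).1⟩
  refine Stm.eval_rep (B := B) (s := s) (fun j s' => ∃ z q,
    Trace (I.weight μ) (I.n + I.n) I.K l p u z q j ∧
    ∀ t ≤ j, s'.arr 4 (t : ℕ) = z t ∧ s'.arr 5 (t : ℕ) = q t) (N := l) h4 (by omega) ?_ ?_
  · refine ⟨fun _ => u, fun _ => p, ⟨rfl, rfl, fun _ _ => hu, fun _ _ => hp, ?_, ?_⟩, ?_⟩
    · intro t ht; obtain rfl : t = 0 := by omega
      simp [wt]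
    · intro t ht; obtain rfl : t = 0 := by omega
      simp [wt]
    · intro t ht; obtain rfl : t = 0 := by omega
      exact ⟨ha4, ha5⟩
  rintro j hj s' ⟨z, q, hT, hzq⟩ hr ha
  obtain ⟨hz, hq⟩ := hzq j le_rfl
  set s₁ := s'.set 10 j with hs₁
  have hE₁ : Holds I B μ s₁ := hE.congr (by simp [hs₁, hr 0 (by decide) rfl])
    (by simp [hs₁, ha 0 rfl]) (by simp [hs₁, ha 1 rfl]) (by simp [hs₁, ha 2 rfl])
  have hD₁ : Dists I μ s₁.arr := by
    intro l hl p hp x hx y hy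
    rw [show s₁.arr 3 = s.arr 3 by simp [hs₁, ha 3 rfl]]
    exact hD l hl p hp x hx y hy
  have r4 : s₁.reg 4 = l := by simp [hs₁, hr 4 (by decide) rfl, h4]
  have r5 : s₁.reg 5 = u := by simp [hs₁, hr 5 (by decide) rfl, h5]
  have r10 : s₁.reg 10 = j := by simp [hs₁]
  have hzj := hT.lt j le_rfl
  have hqj := hT.par_lt j le_rfl
  have key := Tm.eval_first (i := 11) (a := 12) (c := .isNext) (Tm.eval_m hE₁) (by omega)
    (fun y => I.weight μ (z j) y + dist (I.weight μ) (I.n + I.n) I.K (l - j - 1)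
      (flip (I.weight μ (z j) y) (q j)) y u = dist (I.weight μ) (I.n + I.n) I.K (l - j) (q j) (z j) u)
    (by decide) (fun y hy r => by
      have hE₂ := (Env.update hE₁ (i := 11) (by decide) y).update (i := 12) (by decide) r
      have f4 : (Tm.ld 4 (.var 10)).eval B s₁.arr
        (Function.update (Function.update s₁.reg 11 (y : ℤ)) 12 r) = z j := by
        simp [Tm.eval, hs₁, hz]
      have f5 : (Tm.ld 5 (.var 10)).eval B s₁.arr
        (Function.update (Function.update s₁.reg 11 (y : ℤ)) 12 r) = q j := by
        simp [Tm.eval, hs₁, hq]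
      have f11 : (Tm.var 11).eval B s₁.arr
        (Function.update (Function.update s₁.reg 11 (y : ℤ)) 12 r) = y := by simp [Tm.eval]
      have g5 : (Tm.var 5).eval B s₁.arr
        (Function.update (Function.update s₁.reg 11 (y : ℤ)) 12 r) = u := by simp [Tm.eval, r5]
      have g4 : (Tm.sub (.var 4) (.var 10)).eval B s₁.arr
        (Function.update (Function.update s₁.reg 11 (y : ℤ)) 12 r) = (l - j : ℕ) := by
        simp [Tm.eval, r4, r10]; omega
      have g4' : (Tm.sub (.sub (.var 4) (.var 10)) (.lit 1)).eval B s₁.arr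
        (Function.update (Function.update s₁.reg 11 (y : ℤ)) 12 r) = (l - j - 1 : ℕ) := by
        rw [Tm.eval, g4]; simp [Tm.eval]; omega
      rw [Tm.isNext, Tm.eval_ifEq, Tm.eval.eq_3, Tm.eval_weight hE₂ f4 f11 hzj hy,
        Tm.eval_dist hE₂ hD₁ g4' (Tm.eval_flip hE₂ f4 f11 f5 hqj hzj hy) f11 g5 (by omega)
          (flip_lt hqj) hy hu,
        Tm.eval_dist hE₂ hD₁ g4 f5 f4 g5 (by omega) hqj hzj hu]
      simp only [Tm.eval]
      split_ifs with h <;> simp [h])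
  obtain ⟨y₀, hy₀, hP₀⟩ := hT.exists_next hj hW (by
    have : (j : ℤ) * N ≤ l * N := mul_le_mul_of_nonneg_right (by omega) hN
    linarith)
  rcases key with ⟨-, h2⟩ | ⟨y, hy, h1, hP, -⟩
  · exact absurd hP₀ (h2 y₀ hy₀)
  set s₂ : Memory := ⟨s₁.reg, Function.update s₁.arr 4 (Function.update (s₁.arr 4) ((j + 1 : ℕ) : ℤ) y)⟩
    with hs₂
  have e₁ : Stm.eval B (.st 4 (.add (.var 10) (.lit 1)) (.first 11 12 .m .isNext)) s₁ = s₂ := by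
    simp only [Stm.eval, h1, hs₂, Tm.eval, r10]
    push_cast; rfl
  have hE₂ : Holds I B μ s₂ := hE₁.congr rfl (by simp [hs₂]) (by simp [hs₂]) (by simp [hs₂])
  have hjj : (j : ℤ) ≠ j + 1 := by omega
  have e₂ : (Tm.flip (.ld 4 (.var 10)) (.ld 4 (.add (.var 10) (.lit 1))) (.ld 5 (.var 10))).eval B
      s₂.arr s₂.reg = flip (I.weight μ (z j) y) (q j) := by
    refine Tm.eval_flip hE₂ ?_ ?_ ?_ hqj hzj hy
    · simp [Tm.eval, hs₂, hjj, hs₁, hz]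
    · simp [Tm.eval, hs₂, r10]
    · simp [Tm.eval, hs₂, hs₁, hq]
  refine ⟨Function.update z (j + 1) y, Function.update q (j + 1) (flip (I.weight μ (z j) y) (q j)),
    (hT.congr ?_ ?_).next ?_ ?_ ?_, ?_⟩
  · intro t ht; rw [Function.update_of_ne (by omega)]
  · intro t ht; rw [Function.update_of_ne (by omega)]
  · simpa using hy
  · simpa using hP
  · simp
  · intro t ht
    rw [Stm.eval.eq_4, e₁, Stm.eval, e₂]
    rcases Nat.le_succ_iff.1 ht with h | rfl
    · have h' : (t : ℤ) ≠ j + 1 := by omega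
      have h'' : t ≠ j + 1 := by omega
      simp [hs₂, h', h'', Tm.eval, hzq t h, hs₁]
    · simp [hs₂, Tm.eval, r10]

end

section
variable {I : Inst} {B : ℕ} {H : CostGraph (Fin (I.n + I.n))}
  {μ : Fin (I.n + I.n) → Fin (I.n + I.n)}

theorem eval_update {s : Memory} (hE : Holds I B (ext μ) s) {l : ℕ} (hl : l ≤ I.n + I.n)
    (h4 : s.reg 4 = l) (z : ℕ → Fin (I.n + I.n)) (hz : ∀ t ≤ l, s.arr 4 (t : ℕ) = z t) :
    Holds I B (ext (CostGraph.exch μ z l)) (Stm.update.eval B s) := by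
  obtain ⟨ex, hex⟩ : ∃ ex, ex = CostGraph.exch μ z l := ⟨_, rfl⟩
  rw [← hex]
  have hle := hE.le
  have hm : ∀ {s' : Memory}, s'.reg 0 = s.reg 0 →
      Tm.m.eval B s'.arr s'.reg = (I.n + I.n : ℕ) := by
    intro s' h
    have := hE.var
    simp [Tm.m, Tm.n, Tm.eval, h, this]
  set s₁ := (Stm.rep 10 .m (.st 6 (.var 10) .exchange)).eval B s with hs₁
  have h₁ : ∀ x : Fin (I.n + I.n), s₁.arr 6 ((x : ℕ) : ℤ) = (ex x : ℕ) := by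
    suffices h : ∀ x : Fin (I.n + I.n), (x : ℕ) < I.n + I.n →
        s₁.arr 6 ((x : ℕ) : ℤ) = (ex x : ℕ) from fun x => h x x.2
    refine Stm.eval_rep (B := B) (s := s) (fun j s' => ∀ x : Fin (I.n + I.n), (x : ℕ) < j →
      s'.arr 6 ((x : ℕ) : ℤ) = (ex x : ℕ)) (N := I.n + I.n) (hm rfl) (by omega)
      (by simp) ?_
    intro j hj s' hs' hr ha x hx
    have ev : Tm.exchange.eval B (s'.set 10 j).arr (s'.set 10 j).reg =
        (ex ⟨j, hj⟩ : ℕ) := by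
      rw [Tm.exchange, Tm.eval_fold (N := l) (by simp [Tm.eval, hr 4 (by decide) rfl, h4]) (by omega),
        hex, CostGraph.exch]
      have h2 : ∀ x : Fin (I.n + I.n), s.arr 2 ((x : ℕ) : ℤ) = (μ x : ℕ) := fun x => by
        rw [hE.arr_μ x x.2, ext_val]
      have e4 : s'.arr 4 = s.arr 4 := ha 4 rfl
      have e2 : s'.arr 2 = s.arr 2 := ha 2 rfl
      -- The integer computation mirrors `CostGraph.exch` arc by arc. The induction runs over
      -- prefixes, since the stored cycle is known only up to index `l`.
      have gen : ∀ l' ≤ l, iter (fun t r => Tm.eval B (s'.set 10 j).arr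
          (.ifEq (.var 10) (.ld 4 (.var 11)) (.ld 2 (.ld 4 (.add (.var 11) (.lit 1))))
            (.ifEq (.var 10) (.ld 2 (.ld 4 (.add (.var 11) (.lit 1)))) (.ld 4 (.var 11)) (.var 12)))
          (Function.update (Function.update (s'.set 10 j).reg 11 (t : ℤ)) 12 r))
          ((Tm.ld 2 (.var 10)).eval B (s'.set 10 j).arr (s'.set 10 j).reg) l' =
          ((iter (fun t r => if (⟨j, hj⟩ : Fin (I.n + I.n)) = z t then μ (z (t + 1)) else
            if (⟨j, hj⟩ : Fin (I.n + I.n)) = μ (z (t + 1)) then z t else r) (μ ⟨j, hj⟩) l' :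
            Fin (I.n + I.n)) : ℕ) := by
        intro l' hl'
        induction l' with
        | zero => simpa [iter, Tm.eval, e2] using h2 ⟨j, hj⟩
        | succ t ih =>
          have z1 := hz t (by omega)
          have z2 := hz (t + 1) (by omega)
          push_cast at z2
          rw [iter, ih (by omega), iter]
          simp only [Tm.eval_ifEq, Tm.eval]
          simp [e4, e2, z1, z2, h2, Fin.ext_iff]
          split_ifs <;> rfl
      exact gen l le_rfl
    simp only [Stm.eval, ev]
    by_cases hxj : (x : ℕ) = j
    · obtain rfl : x = ⟨j, hj⟩ := Fin.ext hxj
      simp [Tm.eval]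
    · have hxj' : ((x : ℕ) : ℤ) ≠ j := by exact_mod_cast hxj
      simp [Tm.eval, hxj', hs' x (by omega)]
  have hr₁ : s₁.reg 0 = s.reg 0 := Stm.eval_reg B _ rfl s
  have ha₁ : ∀ x, x ≠ 6 → s₁.arr x = s.arr x := fun x hx =>
    Stm.eval_arr B _ (by simpa [Stm.setsArr] using hx) s
  have h₂ : ∀ x : Fin (I.n + I.n), (x : ℕ) < I.n + I.n →
      ((Stm.rep 10 .m (.st 2 (.var 10) (.ld 6 (.var 10)))).eval B s₁).arr 2 ((x : ℕ) : ℤ) =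
        (ex x : ℕ) := by
    refine Stm.eval_rep (B := B) (s := s₁) (fun j s' => ∀ x : Fin (I.n + I.n), (x : ℕ) < j →
      s'.arr 2 ((x : ℕ) : ℤ) = (ex x : ℕ)) (N := I.n + I.n) (hm hr₁) (by omega)
      (by simp) ?_
    intro j hj s' hs' hr ha x hx
    have e6 : s'.arr 6 = s₁.arr 6 := ha 6 rfl
    by_cases hxj : (x : ℕ) = j
    · obtain rfl : x = ⟨j, hj⟩ := Fin.ext hxj
      simpa [Tm.eval, Stm.eval, e6] using h₁ ⟨j, hj⟩
    · have hxj' : ((x : ℕ) : ℤ) ≠ j := by exact_mod_cast hxj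
      simp [Tm.eval, Stm.eval, hxj', hs' x (by omega)]
  have e : Stm.update.eval B s = (Stm.rep 10 .m (.st 2 (.var 10) (.ld 6 (.var 10)))).eval B s₁ := rfl
  rw [e]
  refine ⟨hle, ?_, ?_, ?_, ?_, ?_⟩
  · rw [Stm.eval_reg B _ rfl, hr₁]; exact hE.var
  · rw [Stm.eval_arr B _ rfl, ha₁ 0 (by decide)]; exact hE.a
  · rw [Stm.eval_arr B _ rfl, ha₁ 1 (by decide)]; exact hE.r
  · intro x hx
    rw [h₂ ⟨x, hx⟩ hx, ext, dif_pos hx]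
  · intro x hx
    rw [ext, dif_pos hx]; exact Fin.is_lt _

/-- If no length is good, no acceptable closed walk exists, hence no matching of acceptable relative
cost. Otherwise the shortest good length yields a traced closed walk that is a cycle, and the
exchange along it has acceptable weight. -/
theorem eval_improve (hI : I.Represents H) (hM : H.Matching μ) {s : Memory}
    (hE : Holds I B (ext μ) s) (hθ : -1 ≤ s.reg 3) (hθn : s.reg 3 ≤ I.n) :
    ∃ μ', H.Matching μ' ∧ Holds I B (ext μ') (Stm.improve.eval B s) ∧
      (Acc (s.reg 3) (H.cost μ' - H.cost μ) ∨
        μ' = μ ∧ ∀ μ'', H.Matching μ'' → ¬ Acc (s.reg 3) (H.cost μ'' - H.cost μ)) := by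
  set s₁ := Stm.fill.eval B s with hs₁
  have hE₁ : Holds I B (ext μ) s₁ := hE.congr (Stm.eval_reg B _ rfl s) (Stm.eval_arr B _ rfl s)
    (Stm.eval_arr B _ rfl s) (Stm.eval_arr B _ rfl s)
  have hD₁ : Dists I (ext μ) s₁.arr := fun l hl p hp x hx y hy =>
    Stm.known_fill hE l p x y hp hx hy (Or.inl (by omega))
  have r3 : s₁.reg 3 = s.reg 3 := Stm.eval_reg B _ rfl s
  set s₂ := Stm.find.eval B s₁ with hs₂
  have hE₂ : Holds I B (ext μ) s₂ := hE₁.congr (Stm.eval_reg B _ rfl s₁) (Stm.eval_arr B _ rfl s₁)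
    (Stm.eval_arr B _ rfl s₁) (Stm.eval_arr B _ rfl s₁)
  have hD₂ : Dists I (ext μ) s₂.arr := hD₁
  have r3' : s₂.reg 3 = s.reg 3 := (Stm.eval_reg B _ rfl s₁).trans r3
  have e : Stm.improve.eval B s = if 0 < s₂.reg 4 + 1 then
    Stm.update.eval B (Stm.trace.eval B (Stm.start.eval B s₂)) else s₂ := rfl
  rw [e]
  rcases eval_find hE₁ hD₁ with ⟨h4, hG⟩ | ⟨l, hl, h4, hG, hmin⟩
  · refine ⟨μ, hM, ?_, Or.inr ⟨rfl, fun μ'' hM'' hA => ?_⟩⟩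
    · rw [if_neg (by rw [h4]; omega)]; exact hE₂
    · obtain ⟨l, hl, hW⟩ := hM.exists_walk hM'' hθ hA
      obtain ⟨u, hu, hG'⟩ := hI.good_of_walk hW
      rw [Fintype.card_fin] at hl
      exact hG l hl u hu (by rw [r3]; exact hG')
  · rw [if_pos (by rw [h4]; omega)]
    rw [r3] at hmin
    rw [r3, ← r3'] at hG
    obtain ⟨u, p, hu, hp, h5, ha4, ha5⟩ := eval_start hE₂ hD₂ hl h4 hG
    rw [r3'] at hp
    set s₃ := Stm.start.eval B s₂ with hs₃
    have hE₃ : Holds I B (ext μ) s₃ := hE₂.congr (Stm.eval_reg B _ rfl s₂)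
      (Stm.eval_arr B _ rfl s₂) (Stm.eval_arr B _ rfl s₂) (Stm.eval_arr B _ rfl s₂)
    have hD₃ : Dists I (ext μ) s₃.arr := by
      intro l hl p hp x hx y hy
      rw [show s₃.arr 3 = s₂.arr 3 from Stm.eval_arr B _ rfl s₂]
      exact hD₂ l hl p hp x hx y hy
    have r4 : s₃.reg 4 = l := (Stm.eval_reg B _ rfl s₂).trans h4
    have hd : dist (I.weight (ext μ)) (I.n + I.n) I.K l p u u ≤ I.n := by
      rcases hp with ⟨rfl, h⟩ | ⟨rfl, h⟩ <;> omega
    have hKb := I.K_bound hl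
    obtain ⟨z, q, hT, hz⟩ := eval_trace hE₃ hD₃ hl hu (by omega) r4 h5 ha4 ha5
      (Int.natCast_nonneg I.N) (hI.neg_le hM) (by linarith)
    -- The trace controls `z` only up to `l`; freezing the index there gives a total map into `Fin`.
    set zF : ℕ → Fin (I.n + I.n) := fun t => ⟨z (min t l), hT.lt _ (by omega)⟩ with hzF
    have hzF' : ∀ t ≤ l, (zF t : ℕ) = z t := fun t ht => by simp [hzF, ht]
    obtain ⟨hM', hA⟩ := hI.exch_of_trace hM hθ hθn hl hp hmin hT zF hzF'
    refine ⟨_, hM', ?_, Or.inl hA⟩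
    set s₄ := Stm.trace.eval B s₃ with hs₄
    have hE₄ : Holds I B (ext μ) s₄ := hE₃.congr (Stm.eval_reg B _ rfl s₃)
      (Stm.eval_arr B _ rfl s₃) (Stm.eval_arr B _ rfl s₃) (Stm.eval_arr B _ rfl s₃)
    exact eval_update hE₄ hl ((Stm.eval_reg B _ rfl s₃).trans r4) zF
      fun t ht => by rw [hz t ht, hzF' t ht]

end
/-! ### The algorithm -/

namespace Tm

/-- the cost of the matching -/
def total : Tm :=
  .fold 10 11 m (.lit 0)
    (.add (.var 11) (.ite (.sub (.ld 2 (.var 10)) (.var 10)) (.cost (.var 10) (.ld 2 (.var 10)))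
      (.lit 0)))

/-- the parity of variable 7 -/
def parity : Tm :=
  .fold 10 11 (.var 2) (.var 7)
    (.ite (.add (.sub (.var 11)
        (.fold 12 13 (.sub (.var 2) (.var 10)) (.lit 1) (.add (.var 13) (.var 13)))) (.lit 1))
      (.sub (.var 11)
        (.fold 12 13 (.sub (.var 2) (.var 10)) (.lit 1) (.add (.var 13) (.var 13))))
      (.var 11))

/-- 1 if the matching is a solution, 0 otherwise -/
def verdict : Tm :=
  .ite (.add (.var 7) (.lit 1))
    (.ite (.var 8) (.lit 0)
      (.ite (.add (.first 10 11 n (.add (.sub (.ld 2 (.var 10)) n) (.lit 1))) (.lit 1))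
        (.lit 0) (.lit 1)))
    (.lit 0)

end Tm

namespace Stm

def rungs : Stm :=
  .rep 10 .n (.seq (.st 2 (.var 10) (.add (.var 10) .n)) (.st 2 (.add (.var 10) .n) (.var 10)))

/-- With θ = -1 acceptable means negative. Two nested loops are needed because one loop is capped at
B rounds, while up to nN improvements may occur. -/
def minimize : Stm :=
  .seq (.set 3 (.lit (-1))) (.rep 16 (.var 2) (.rep 17 (.var 2) .improve))

def measure : Stm := .seq (.set 7 (.sub (.var 1) .total)) (.set 8 .parity)

/-- A single odd improvement repairs the parity. The threshold is also limited to n so that the walk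
stays light compared with K and no rung enters. -/
def correct : Stm :=
  .ite (.var 7) (.ite (.var 8) (.seq (.set 3 (.min (.var 7) .n)) .improve) .skip) .skip

def main : Stm :=
  .seq .rungs (.seq .minimize (.seq .measure (.seq .correct (.seq .measure (.set 0 .verdict)))))

end Stm

theorem iter_add (f : ℕ → ℤ) (N : ℕ) :
    iter (fun j r => r + f j) 0 N = ∑ j ∈ Finset.range N, f j := by
  induction N with
  | zero => rfl
  | succ N ih => rw [iter, ih, Finset.sum_range_succ]

/-- Without division, the remainder modulo 2 is obtained by subtracting each of 2^B, …, 4, 2 once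
where it fits. The powers come from repeated doubling. -/
theorem Tm.eval_parity {B : ℕ} {A : ℕ → ℤ → ℤ} {v : ℕ → ℤ} (h2 : v 2 = B) (h7 : 0 ≤ v 7)
    (h7' : v 7 < 2 ^ B) : Tm.parity.eval B A v = v 7 % 2 := by
  have hp : ∀ j < B, ∀ r, (Tm.fold 12 13 (.sub (.var 2) (.var 10)) (.lit 1)
      (.add (.var 13) (.var 13))).eval B A (Function.update (Function.update v 10 (j : ℤ)) 11 r) =
      2 ^ (B - j) := by
    intro j hj r
    rw [Tm.eval_fold (N := B - j) (by simp [Tm.eval, h2]; omega) (by omega)]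
    refine iter_induct (fun i (r : ℤ) => r = 2 ^ i) (by simp [Tm.eval]) ?_
    intro i _ r hr
    simp [Tm.eval, hr, pow_succ]; ring
  rw [Tm.parity, Tm.eval_fold (N := B) (by simp [Tm.eval, h2]) le_rfl]
  have key := iter_induct (N := B) (f := fun j r => Tm.eval B A
    (.ite (.add (.sub (.var 11)
        (.fold 12 13 (.sub (.var 2) (.var 10)) (.lit 1) (.add (.var 13) (.var 13)))) (.lit 1))
      (.sub (.var 11)
        (.fold 12 13 (.sub (.var 2) (.var 10)) (.lit 1) (.add (.var 13) (.var 13))))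
      (.var 11)) (Function.update (Function.update v 10 (j : ℤ)) 11 r))
    (x := (Tm.var 7).eval B A v)
    -- Before round `j` the remainder is below twice the power about to be tried, so one subtraction
    -- suffices. At the end it is below 2.
    (fun j r => 0 ≤ r ∧ r < 2 ^ (B - j + 1) ∧ r % 2 = v 7 % 2) ?_ ?_
  · obtain ⟨h, h', h''⟩ := key
    rw [← h'']
    simp only [Nat.sub_self, zero_add, pow_one] at h'
    omega
  · refine ⟨h7, ?_, rfl⟩
    rw [Nat.sub_zero, pow_succ]
    change v 7 < _
    linarith
  · rintro j hj r ⟨h, h', h''⟩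
    obtain ⟨i, hi⟩ : ∃ i, B - j = i + 1 := ⟨B - j - 1, by omega⟩
    have hi' : B - (j + 1) + 1 = i + 1 := by omega
    rw [hi] at h'
    rw [hi']
    have e : (2 : ℤ) ^ (i + 1 + 1) = 2 * 2 ^ (i + 1) := by ring
    have e2 : (2 : ℤ) ^ (i + 1) = 2 * 2 ^ i := by ring
    have r11 : (Tm.var 11).eval B A (Function.update (Function.update v 10 (j : ℤ)) 11 r) = r := by
      simp [Tm.eval]
    rw [Tm.eval.eq_7, Tm.eval.eq_3, Tm.eval.eq_4, hp j hj, Tm.eval.eq_1, r11, hi]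
    split_ifs <;> omega

section
variable {I : Inst} {B : ℕ} {H : CostGraph (Fin (I.n + I.n))}
  {μ : Fin (I.n + I.n) → Fin (I.n + I.n)}

/-- The machine has no colouring, so each matching edge is counted at its smaller end. Any choice of
one end per edge gives the same sum, by symmetry of the costs. -/
theorem eval_total (hI : I.Represents H) (hM : H.Matching μ) {s : Memory}
    (hE : Holds I B (ext μ) s) : Tm.total.eval B s.arr s.reg = H.cost μ := by
  have hle := hE.le
  rw [Tm.total, Tm.eval_fold (Tm.eval_m hE) (by omega)]
  have h := iter_add (fun x => if x < ext μ x then I.cost x (ext μ x) else 0) (I.n + I.n)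
  rw [Finset.sum_range, ← hM.sum_eq_cost (fun v => v < μ v)] at *
  · rw [Finset.sum_filter]
    simp only [ext_val, ← hI.c, Fin.val_fin_lt] at h
    rw [← h]
    refine Tm.iter_congr fun x hx r => ?_
    have hE' : Env I B (ext μ) s.arr (Function.update (Function.update s.reg 10 (x : ℤ)) 11 r) :=
      (Env.update hE (by decide) _).update (by decide) _
    have e10 : (Tm.var 10).eval B s.arr (Function.update (Function.update s.reg 10 (x : ℤ)) 11 r)
      = x := by simp [Tm.eval]
    have e2 : (Tm.ld 2 (.var 10)).eval B s.arr
      (Function.update (Function.update s.reg 10 (x : ℤ)) 11 r) = ext μ x := by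
      rw [Tm.eval, e10, hE.arr_μ x hx]
    rw [Tm.eval.eq_3, Tm.eval.eq_7, Tm.eval.eq_4, Tm.eval_cost hE' e10 e2 hx, e10, e2]
    simp only [sub_pos, Nat.cast_lt]
    simp [Tm.eval]
  · intro v
    have := hM.col_ne v
    have hne : μ v ≠ v := fun h => by rw [h] at this; simp at this
    rw [hM.invol, not_lt]
    exact ⟨fun h => h.le, fun h => lt_of_le_of_ne h hne⟩

/-! ### Rungs and their cost. -/

/-- The matching consists of edges of the two copies of the graph. -/
def Rungless (I : Inst) (μ : Fin (I.n + I.n) → Fin (I.n + I.n)) : Prop :=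
  ∀ v : Fin (I.n + I.n), (v : ℕ) < I.n → (μ v : ℕ) < I.n

theorem Rungless.iff (hR : Rungless I μ) (hM : H.Matching μ) (v : Fin (I.n + I.n)) :
    (μ v : ℕ) < I.n ↔ (v : ℕ) < I.n :=
  ⟨fun h => by simpa [hM.invol] using hR _ h, hR v⟩

theorem Inst.N_lt_K (I : Inst) : I.N < I.K := by
  unfold Inst.K Inst.N
  nlinarith

/-- Every vertex sees an edge of cost at most 1, and the sum over all 2n vertices is twice the cost.
-/
theorem cost_le_of_rungless (hI : I.Represents H) (hM : H.Matching μ) (hR : Rungless I μ) :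
    H.cost μ ≤ I.n := by
  have h1 := hM.two_mul_cost
  have h2 : ∑ v, H.c v (μ v) ≤ ∑ _v : Fin (I.n + I.n), (1 : ℤ) := by
    refine Finset.sum_le_sum fun v _ => ?_
    have h3 := hM.lt v
    rw [hI.c, hI.K] at h3
    rw [hI.c]
    have h4 := hR.iff hM v
    unfold Inst.cost at h3 ⊢
    split_ifs at h3 ⊢ <;> omega
  simp at h2
  omega

/-- A rung contributes N at both of its ends to the sum over all vertices, which is twice the cost.
-/
theorem rungless_of_cost_lt (hI : I.Represents H) (hM : H.Matching μ) (h : H.cost μ < I.N) :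
    Rungless I μ := by
  intro v hv
  by_contra hμ
  have h1 := hM.lt v
  have h2 : H.c v (μ v) = I.N := by
    rw [hI.c, hI.K] at h1
    rw [hI.c]
    unfold Inst.cost at h1 ⊢
    simp only [hv, hμ, if_true, if_false] at h1 ⊢
    split_ifs at h1 ⊢
    · rfl
    · omega
  have h3 : ∑ w ∈ {v, μ v}, H.c w (μ w) ≤ ∑ w, H.c w (μ w) :=
    Finset.sum_le_sum_of_subset_of_nonneg (Finset.subset_univ _) fun _ _ _ => H.nonneg _ _
  have hne : v ≠ μ v := fun h => hμ (by rw [← h]; exact hv)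
  rw [Finset.sum_pair hne, hM.invol, H.symm (μ v), ← hM.two_mul_cost] at h3
  omega

/-- The matching that consists of the rungs. -/
def rungMap (n : ℕ) (v : Fin (n + n)) : Fin (n + n) :=
  if h : (v : ℕ) < n then ⟨v + n, by omega⟩ else ⟨v - n, by omega⟩

theorem matching_rungMap (hI : I.Represents H) :
    H.Matching (rungMap I.n) ∧ H.cost (rungMap I.n) = I.n * I.N := by
  have hc : ∀ v, H.c v (rungMap I.n v) = I.N := by
    intro v
    rw [hI.c, rungMap]
    split_ifs with h
    · simp [Inst.cost, h]
    · have h1 : (v : ℕ) - I.n < I.n := by omega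
      have h2 : (v : ℕ) = v - I.n + I.n := by omega
      simp only [Inst.cost, h, h1, if_true, if_false]
      rw [if_pos h2]
  have hM : H.Matching (rungMap I.n) := by
    refine ⟨fun v => ?_, fun v => ?_⟩
    · unfold rungMap
      apply Fin.ext
      by_cases h : (v : ℕ) < I.n
      · simp [h]
      · have h1 : (v : ℕ) - I.n < I.n := by omega
        simp [h, h1]; omega
    · rw [hc, hI.K]
      exact_mod_cast I.N_lt_K
  refine ⟨hM, ?_⟩
  have h := hM.two_mul_cost
  simp only [hc, Finset.sum_const, Finset.card_univ, Fintype.card_fin, nsmul_eq_mul] at h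
  push_cast at h
  linarith

/-! ### Correctness of the phases of the algorithm. -/

theorem holds_rungs {s : Memory} (hle : I.n + I.n + 2 ≤ B) (h0 : s.reg 0 = I.n) (ha : s.arr 0 = I.a)
    (hr : s.arr 1 = I.r) : Holds I B (ext (rungMap I.n)) (Stm.rungs.eval B s) := by
  refine ⟨hle, (Stm.eval_reg B _ rfl s).trans h0, (Stm.eval_arr B _ rfl s).trans ha,
    (Stm.eval_arr B _ rfl s).trans hr, ?_, ?_⟩
  · have key : ∀ x < I.n, (Stm.rungs.eval B s).arr 2 (x : ℕ) = x + I.n ∧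
        (Stm.rungs.eval B s).arr 2 (x + I.n) = x := by
      refine Stm.eval_rep (B := B) (s := s) (fun j s' => ∀ x < j,
        s'.arr 2 (x : ℕ) = x + I.n ∧ s'.arr 2 (x + I.n) = x) (N := I.n) (by simp [Tm.n, Tm.eval, h0])
        (by omega) (by simp) ?_
      intro j hj s' hs' hr' ha' x hx
      have r0 : s'.reg 0 = I.n := (hr' 0 (by decide) rfl).trans h0
      have n1 : (x : ℤ) ≠ j + I.n := by omega
      have n2 : (x + I.n : ℤ) ≠ j := by omega
      have n3 : (j : ℤ) ≠ j + I.n := by omega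
      rcases Nat.lt_succ_iff_lt_or_eq.1 hx with h | rfl
      · have n4 : (x : ℤ) ≠ j := by omega
        simp [Stm.eval, Tm.eval, Tm.n, r0, n1, n2, n4, hs' x h]
      · simp [Stm.eval, Tm.eval, Tm.n, r0, n1]
    intro x hx
    simp only [ext, hx, dif_pos, rungMap]
    by_cases h : x < I.n
    · simp [h, (key x h).1]
    · obtain ⟨y, rfl⟩ := Nat.exists_eq_add_of_le (not_lt.1 h)
      have := (key y (by omega)).2
      rw [add_comm] at this
      simp [this]
  · intro x hx
    simp only [ext, hx, dif_pos]
    exact Fin.is_lt _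

theorem eval_minimize (hI : I.Represents H) {s : Memory} (h2 : s.reg 2 = B)
    (hE : Holds I B (ext (rungMap I.n)) s) :
    ∃ μ, H.Matching μ ∧ Holds I B (ext μ) (Stm.minimize.eval B s) ∧
      ∀ μ', H.Matching μ' → H.cost μ ≤ H.cost μ' := by
  obtain ⟨hM₀, hc₀⟩ := matching_rungMap hI
  set s₁ := s.set 3 (-1) with hs₁
  have hE₁ : Holds I B (ext (rungMap I.n)) s₁ := hE.congr (by simp [hs₁]) rfl rfl rfl
  -- The potential argument: after `j` rounds the matching is either optimal or at least `j` cheaper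
  -- than the rungs, which cost nN.
  let P : ℕ → Memory → Prop := fun j s' => s'.reg 3 = -1 ∧ ∃ μ, H.Matching μ ∧ Holds I B (ext μ) s' ∧
    ((∀ μ', H.Matching μ' → H.cost μ ≤ H.cost μ') ∨ H.cost μ + j ≤ I.n * I.N)
  have hP : ∀ j s', P j s' → ∀ s'' : Memory, s''.reg 0 = s'.reg 0 → s''.reg 3 = s'.reg 3 →
      s''.arr = s'.arr → P j s'' := by
    rintro j s' ⟨h3, μ, hM, hE, hc⟩ s'' hr0 hr3 ha
    exact ⟨hr3.trans h3, μ, hM, hE.congr hr0 (by rw [ha]) (by rw [ha]) (by rw [ha]), hc⟩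
  have main : P (B * B) ((Stm.rep 16 (.var 2) (.rep 17 (.var 2) .improve)).eval B s₁) := by
    refine Stm.eval_rep (B := B) (s := s₁) (fun i s' => P (i * B) s') (N := B)
      (by simp [Tm.eval, hs₁, h2]) le_rfl ⟨by simp [hs₁], _, hM₀, hE₁, Or.inr (by simp [hc₀])⟩ ?_
    intro i hi s' hs' hr ha
    have := Stm.eval_rep (B := B) (s := s'.set 16 i) (i := 17) (n := .var 2) (S := .improve)
      (fun j s' => P (i * B + j) s') (N := B)
      (by simp [Tm.eval, hr 2 (by decide) rfl, hs₁, h2]) le_rfl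
      (hP _ _ hs' _ (by simp) (by simp) rfl) ?_
    · rwa [add_mul, one_mul]
    intro j hj s'' hs'' hr' ha'
    obtain ⟨h3, μ, hM, hE, hc⟩ := hP _ _ hs'' (s''.set 17 j) (by simp) (by simp) rfl
    obtain ⟨μ', hM', hE', hc'⟩ := eval_improve hI hM hE (by rw [h3]) (by rw [h3]; omega)
    refine ⟨(Stm.eval_reg B _ rfl _).trans h3, μ', hM', hE', ?_⟩
    rw [h3] at hc'
    rcases hc' with hA | ⟨rfl, hopt⟩
    · rcases hc with hopt | hc
      · have := hopt μ' hM'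
        unfold Acc at hA
        omega
      · right
        unfold Acc at hA
        push_cast at hc ⊢
        omega
    · left
      intro μ'' hM''
      have := hopt μ'' hM''
      unfold Acc at this
      omega
  -- The second alternative is impossible after B² rounds: costs are nonnegative, and nN < N² ≤ B².
  obtain ⟨-, μ, hM, hE', hc⟩ := main
  refine ⟨μ, hM, hE', hc.resolve_right fun h => ?_⟩
  have h1 := H.cost_nonneg μ
  have h2 : I.n * I.N < B * B := by
    have : I.N ≤ B := hE.le
    have h3 : I.n < I.N := by unfold Inst.N; omega
    calc I.n * I.N < I.N * I.N := Nat.mul_lt_mul_of_pos_right h3 (by omega)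
      _ ≤ B * B := Nat.mul_le_mul this this
  zify at h2
  push_cast at h
  linarith

theorem eval_measure (hI : I.Represents H) (hM : H.Matching μ) {s : Memory} {k : ℤ}
    (hE : Holds I B (ext μ) s) (h1 : s.reg 1 = k) (h2 : s.reg 2 = B) (hk : k < 2 ^ B) :
    Holds I B (ext μ) (Stm.measure.eval B s) ∧ (Stm.measure.eval B s).reg 7 = k - H.cost μ ∧
      (0 ≤ k - H.cost μ → (Stm.measure.eval B s).reg 8 = (k - H.cost μ) % 2) := by
  have hc := H.cost_nonneg μ
  have e : Stm.eval B (.set 7 (.sub (.var 1) .total)) s = s.set 7 (k - H.cost μ) := by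
    rw [Stm.eval, Tm.eval, eval_total hI hM hE, ← h1]; rfl
  refine ⟨hE.congr (Stm.eval_reg B _ rfl s) (Stm.eval_arr B _ rfl s) (Stm.eval_arr B _ rfl s)
    (Stm.eval_arr B _ rfl s), ?_, fun h0 => ?_⟩
  · rw [Stm.measure, Stm.eval, e]; simp [Stm.eval]
  · rw [Stm.measure, Stm.eval, e, Stm.eval, Tm.eval_parity (by simp [h2]) (by simpa using h0)
      (by simp; linarith)]
    simp

/-- The matching solves the instance. -/
def Solves (I : Inst) (H : CostGraph (Fin (I.n + I.n))) (k : ℤ)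
    (μ : Fin (I.n + I.n) → Fin (I.n + I.n)) : Prop :=
  Rungless I μ ∧ H.cost μ ≤ k ∧ (k - H.cost μ) % 2 = 0

/-- If a solution exists and the slack is odd, the solution differs from the optimum by an odd cost,
at most the slack and at most n, so the improvement succeeds. In the other case a solution can exist
only if the slack is nonnegative and even, and then the optimum itself is a solution. -/
theorem eval_correct (hI : I.Represents H) (hM : H.Matching μ) {s : Memory} {k : ℤ}
    (hE : Holds I B (ext μ) s) (hopt : ∀ μ', H.Matching μ' → H.cost μ ≤ H.cost μ')
    (h7 : s.reg 7 = k - H.cost μ) (h8 : 0 ≤ k - H.cost μ → s.reg 8 = (k - H.cost μ) % 2) :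
    ∃ μ', H.Matching μ' ∧ Holds I B (ext μ') (Stm.correct.eval B s) ∧
      ((∃ μ'', H.Matching μ'' ∧ Solves I H k μ'') → Solves I H k μ') := by
  have e : Stm.correct.eval B s = if 0 < s.reg 7 then if 0 < s.reg 8 then
    Stm.improve.eval B (s.set 3 ((Tm.min (.var 7) .n).eval B s.arr s.reg)) else s else s := rfl
  have hmin : (Tm.min (.var 7) .n).eval B s.arr s.reg = min (k - H.cost μ) I.n := by
    rw [Tm.eval_min, ← h7, ← hE.var]; rfl
  rw [hmin] at e
  -- A solution is rungless and costs at most n, so the optimum costs at most n < N and is rungless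
  -- too.
  have rungless : ∀ μ'', H.Matching μ'' → Solves I H k μ'' → Rungless I μ ∧ H.cost μ ≤ I.n := by
    intro μ'' hM'' ⟨hR, _, _⟩
    have h1 := hopt μ'' hM''
    have h2 := cost_le_of_rungless hI hM'' hR
    have h3 : (I.N : ℤ) = I.n + I.n + 2 := by unfold Inst.N; push_cast; rfl
    exact ⟨rungless_of_cost_lt hI hM (by omega), by omega⟩
  by_cases hodd : 0 < k - H.cost μ ∧ (k - H.cost μ) % 2 = 1
  · have h8' := h8 hodd.1.le
    rw [e, if_pos (by rw [h7]; exact hodd.1), if_pos (by rw [h8', hodd.2]; norm_num)]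
    set s₁ := s.set 3 (min (k - H.cost μ) I.n) with hs₁
    have r3 : s₁.reg 3 = min (k - H.cost μ) I.n := by simp [hs₁]
    have hE₁ : Holds I B (ext μ) s₁ := hE.congr (by simp [hs₁]) rfl rfl rfl
    obtain ⟨μ', hM', hE', hc⟩ := eval_improve hI hM hE₁ (by rw [r3]; omega) (by rw [r3]; omega)
    refine ⟨μ', hM', hE', ?_⟩
    rintro ⟨μ'', hM'', hS⟩
    obtain ⟨hR, hn⟩ := rungless μ'' hM'' hS
    obtain ⟨hR'', hk'', hp''⟩ := hS
    have hn'' := cost_le_of_rungless hI hM'' hR''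
    have h0 := H.cost_nonneg μ
    have hA : Acc (s₁.reg 3) (H.cost μ' - H.cost μ) := by
      refine hc.resolve_right fun h => h.2 μ'' hM'' ?_
      rw [r3]
      unfold Acc
      omega
    -- Minimality excludes the even negative case, so the change is odd and at most θ. The new cost
    -- is at most n + n < N, so still no rung occurs.
    have h1 := hopt μ' hM'
    rw [r3] at hA
    unfold Acc at hA
    have h3 : (I.N : ℤ) = I.n + I.n + 2 := by unfold Inst.N; push_cast; rfl
    exact ⟨rungless_of_cost_lt hI hM' (by omega), by omega, by omega⟩
  · have e' : Stm.correct.eval B s = s := by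
      rw [e]
      split_ifs with h9 h10
      · rw [h7] at h9
        rw [h8 h9.le] at h10
        omega
      · rfl
      · rfl
    rw [e']
    refine ⟨μ, hM, hE, ?_⟩
    rintro ⟨μ'', hM'', hS⟩
    obtain ⟨hR, hn⟩ := rungless μ'' hM'' hS
    have := hopt μ'' hM''
    obtain ⟨hR'', hk'', hp''⟩ := hS
    exact ⟨hR, by omega, by omega⟩

/-- The parity in register 8 is meaningful only for nonnegative slack, so the sign is tested first.
To detect rungs it suffices to look at the partners of the first copy. -/
theorem eval_verdict {s : Memory} {k : ℤ} (hE : Holds I B (ext μ) s)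
    (h7 : s.reg 7 = k - H.cost μ) (h8 : 0 ≤ k - H.cost μ → s.reg 8 = (k - H.cost μ) % 2) :
    Tm.verdict.eval B s.arr s.reg = 1 ∧ Solves I H k μ ∨
      Tm.verdict.eval B s.arr s.reg = 0 ∧ ¬ Solves I H k μ := by
  have hle := hE.le
  have key := Tm.eval_first (B := B) (A := s.arr) (v := s.reg) (i := 10) (a := 11) (N := I.n)
    (n := .n) (c := .add (.sub (.ld 2 (.var 10)) .n) (.lit 1)) hE.var (by omega)
    (fun x => I.n ≤ ext μ x) (by decide) (fun x hx r => by
      have := hE.var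
      have h2 := hE.arr_μ x (by omega)
      simp [Tm.eval, Tm.n, this, h2])
  have hR : Rungless I μ ↔ ∀ x < I.n, ¬ I.n ≤ ext μ x := by
    constructor
    · intro h x hx
      have h1 := h ⟨x, by omega⟩ hx
      rw [← ext_val] at h1
      exact not_le.2 h1
    · intro h v hv
      have := h v hv
      rw [ext_val] at this
      omega
  have e : Tm.verdict.eval B s.arr s.reg = if 0 < s.reg 7 + 1 then if 0 < s.reg 8 then 0 else
    if 0 < (Tm.first 10 11 .n (.add (.sub (.ld 2 (.var 10)) .n) (.lit 1))).eval B s.arr s.reg + 1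
    then 0 else 1 else 0 := rfl
  rw [e, h7]
  by_cases h0 : 0 ≤ k - H.cost μ
  · rw [if_pos (by omega), h8 h0]
    by_cases hp : (k - H.cost μ) % 2 = 0
    · rw [if_neg (by omega)]
      rcases key with ⟨h, h'⟩ | ⟨x, hx, h, h', -⟩
      · rw [h]
        exact Or.inl ⟨rfl, hR.2 h', by omega, hp⟩
      · rw [h, if_pos (by omega)]
        exact Or.inr ⟨rfl, fun hS => hR.1 hS.1 x hx h'⟩
    · rw [if_pos (by omega)]
      exact Or.inr ⟨rfl, fun hS => hp hS.2.2⟩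
  · rw [if_neg (by omega)]
    exact Or.inr ⟨rfl, fun hS => h0 (by have := hS.2.1; omega)⟩

theorem eval_main (hI : I.Represents H) {s : Memory} {k : ℤ} (hle : I.n + I.n + 2 ≤ B)
    (h0 : s.reg 0 = I.n) (h1 : s.reg 1 = k) (h2 : s.reg 2 = B) (ha : s.arr 0 = I.a)
    (hr : s.arr 1 = I.r) (hk : k < 2 ^ B) :
    ((Stm.main.eval B s).reg 0 = 1 ∧ ∃ μ, H.Matching μ ∧ Solves I H k μ ∧
        ∀ x < I.n + I.n, (Stm.main.eval B s).arr 2 (x : ℕ) = ext μ x) ∨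
      ((Stm.main.eval B s).reg 0 = 0 ∧ ∀ μ, H.Matching μ → ¬ Solves I H k μ) := by
  set s₁ := Stm.rungs.eval B s with hs₁
  have hE₁ : Holds I B (ext (rungMap I.n)) s₁ := holds_rungs hle h0 ha hr
  have r1₁ : s₁.reg 1 = k := (Stm.eval_reg B _ rfl s).trans h1
  have r2₁ : s₁.reg 2 = B := (Stm.eval_reg B _ rfl s).trans h2
  set s₂ := Stm.minimize.eval B s₁ with hs₂
  obtain ⟨μ, hM, hE₂, hopt⟩ := eval_minimize hI r2₁ hE₁
  have r1₂ : s₂.reg 1 = k := (Stm.eval_reg B _ rfl s₁).trans r1₁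
  have r2₂ : s₂.reg 2 = B := (Stm.eval_reg B _ rfl s₁).trans r2₁
  set s₃ := Stm.measure.eval B s₂ with hs₃
  obtain ⟨hE₃, r7₃, r8₃⟩ := eval_measure hI hM hE₂ r1₂ r2₂ hk
  have r1₃ : s₃.reg 1 = k := (Stm.eval_reg B _ rfl s₂).trans r1₂
  have r2₃ : s₃.reg 2 = B := (Stm.eval_reg B _ rfl s₂).trans r2₂
  set s₄ := Stm.correct.eval B s₃ with hs₄
  obtain ⟨μ', hM', hE₄, hS⟩ := eval_correct hI hM hE₃ hopt r7₃ r8₃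
  have r1₄ : s₄.reg 1 = k := (Stm.eval_reg B _ rfl s₃).trans r1₃
  have r2₄ : s₄.reg 2 = B := (Stm.eval_reg B _ rfl s₃).trans r2₃
  set s₅ := Stm.measure.eval B s₄ with hs₅
  obtain ⟨hE₅, r7₅, r8₅⟩ := eval_measure hI hM' hE₄ r1₄ r2₄ hk
  have e : Stm.main.eval B s = s₅.set 0 (Tm.verdict.eval B s₅.arr s₅.reg) := rfl
  rw [e]
  rcases eval_verdict hE₅ r7₅ r8₅ with ⟨h, h'⟩ | ⟨h, h'⟩
  · exact Or.inl ⟨by rw [Memory.set_reg, if_pos rfl]; exact h, μ', hM', h', hE₅.arr_μ⟩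
  · exact Or.inr ⟨by rw [Memory.set_reg, if_pos rfl]; exact h, fun μ'' hM'' hS'' => h' (hS ⟨μ'', hM'', hS''⟩)⟩

end
/-! ### The bound for the loops -/

/-- Compute a bound for the number of rounds of the loops, and set the constants. -/
def prelude : Program :=
  .seq (.instr (.add 2 1 5)) <| .seq (.instr (.const 3 1)) <| .seq (.instr (.add 1 0 0)) <|
  .seq (.instr (.add 1 1 3)) <| .seq (.instr (.add 1 1 3)) <| .seq (.instr (.const 7 1)) <|
  .seq (.instr (.sub 9 2 7)) <| .seq (.instr (.add 9 9 3)) <|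
  .seq (.loop 9 (.seq (.instr (.add 7 7 7)) (.seq (.instr (.add 1 1 3))
    (.seq (.instr (.sub 9 2 7)) (.instr (.add 9 9 3)))))) (.instr (.add 4 1 5))

/-- Register 7 runs through the powers of two while register 1 counts the doublings; register 9 is
positive exactly while 2^j ≤ k. The parameter `d` only bounds the remaining rounds, and the loop may
stop earlier. -/
theorem ends_doubling {s₀ : Memory} {n : ℕ} {k : ℤ} (d : ℕ) : ∀ (j : ℕ) (s : Memory),
    s.reg 0 = n → s.reg 2 = k → s.reg 3 = 1 → s.reg 5 = 0 → s.reg 7 = 2 ^ j →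
    s.reg 9 = k - 2 ^ j + 1 → s.reg 1 = (n + n + 2 + j : ℕ) → s.arr = s₀.arr → k < 2 ^ (j + d) →
    Ends (.loop 9 (.seq (.instr (.add 7 7 7)) (.seq (.instr (.add 1 1 3))
      (.seq (.instr (.sub 9 2 7)) (.instr (.add 9 9 3)))))) s (5 * d + 1) fun s' =>
      ∃ i ≤ j + d, s'.reg 0 = n ∧ s'.reg 2 = k ∧ s'.reg 3 = 1 ∧ s'.reg 5 = 0 ∧
        s'.reg 1 = (n + n + 2 + i : ℕ) ∧ s'.arr = s₀.arr ∧ k < 2 ^ i := by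
  induction d with
  | zero =>
    intro j s h0 h2 h3 h5 h7 h9 h1 ha hk
    rw [add_zero] at hk
    exact ⟨1, by omega, s, .loop_nonpos (by omega), j, by omega, h0, h2, h3, h5, h1, ha, hk⟩
  | succ d ih =>
    intro j s h0 h2 h3 h5 h7 h9 h1 ha hk
    by_cases hp : 0 < s.reg 9
    · have hb : Ends (.seq (.instr (.add 7 7 7)) (.seq (.instr (.add 1 1 3))
          (.seq (.instr (.sub 9 2 7)) (.instr (.add 9 9 3))))) s (1 + (1 + (1 + 1))) fun s' =>
          s'.reg 0 = n ∧ s'.reg 2 = k ∧ s'.reg 3 = 1 ∧ s'.reg 5 = 0 ∧ s'.reg 7 = 2 ^ (j + 1) ∧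
          s'.reg 9 = k - 2 ^ (j + 1) + 1 ∧ s'.reg 1 = (n + n + 2 + (j + 1) : ℕ) ∧
          s'.arr = s₀.arr := by
        refine .seq (.instr (.seq (.instr (.seq (.instr (.instr ?_))))))
        simp [h0, h2, h3, h5, h7, h1, ha, pow_succ]
        constructor <;> ring
      obtain ⟨t, ht, s₁, hr, g0, g2, g3, g5, g7, g9, g1, ga⟩ := hb
      obtain ⟨t', ht', s₂, hr', i, hi, h⟩ := ih (j + 1) s₁ g0 g2 g3 g5 g7 g9 g1 ga
        (by rwa [show j + 1 + d = j + (d + 1) by ring])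
      exact ⟨t + t' + 1, by omega, s₂, .loop_pos hp hr hr', i, by omega, h⟩
    · exact ⟨1, by omega, s, .loop_nonpos (by omega), j, by omega, h0, h2, h3, h5, h1, ha, by omega⟩

/-- Converts the input into the layout of compiled code: k moves from register 1 to register 2,
where variable 1 lives, and register 1 receives the bound B. B has to exceed the round numbers of
all loops and satisfy k < 2^B for the parity computation. -/
theorem ends_prelude {s : Memory} {n : ℕ} {k : ℤ} (h0 : s.reg 0 = n) (h1 : s.reg 1 = k)
    (h5 : s.reg 5 = 0) : Ends prelude s (5 * Nat.size k.natAbs + 10) fun s' =>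
      ∃ B, n + n + 2 ≤ B ∧ B ≤ n + n + 2 + Nat.size k.natAbs ∧ Ready B s' ∧ s'.view.reg 0 = n ∧
        s'.view.reg 1 = k ∧ s'.view.reg 2 = B ∧ s'.view.arr = s.arr ∧ k < 2 ^ B := by
  have hk : k < 2 ^ (0 + Nat.size k.natAbs) := by
    rw [zero_add]
    have : (k.natAbs : ℤ) < 2 ^ Nat.size k.natAbs := by exact_mod_cast Nat.lt_size_self k.natAbs
    omega
  refine Ends.mono (T := 1 + (1 + (1 + (1 + (1 + (1 + (1 + (1 + (5 * Nat.size k.natAbs + 1 + 1)))))))))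
    ?_ (by omega) fun _ h => h
  refine .seq (.instr (.seq (.instr (.seq (.instr (.seq (.instr (.seq (.instr (.seq (.instr
    (.seq (.instr (.seq (.instr (.seq ?_))))))))))))))))
  refine (ends_doubling (s₀ := s) (n := n) (k := k) _ 0 _ ?_ ?_ ?_ ?_ ?_ ?_ ?_ ?_ hk).mono le_rfl ?_
  · simp [h0]
  · simp [h1, h5]
  · simp
  · simp [h5]
  · simp
  · simp [h1, h5]
  · simp [h0]; ring
  · simp
  · rintro s' ⟨i, hi, g0, g2, g3, g5, g1, ga, gk⟩
    refine .instr ⟨n + n + 2 + i, by omega, by omega, ⟨?_, ?_, ?_⟩, ?_, ?_, ?_, ?_, ?_⟩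
    · simp [g1]
    · simp [g3]
    · simp [g5]
    · simp [Memory.view, g0]
    · simp [Memory.view, g2]
    · simp [Memory.view, g1, g5]
    · simp [Memory.view, ga]
    · exact gk.trans_le (pow_le_pow_right₀ (by norm_num) (by omega))

/-! ### The prism over a graph -/

section
variable {n : ℕ} {G : SimpleGraph (Fin n)} {red : Set (Sym2 (Fin n))}

/-- The instance in the initial memory. -/
noncomputable def inst (G : SimpleGraph (Fin n)) (red : Set (Sym2 (Fin n))) : Inst :=
  ⟨n, (inputMemory G red 0).arr 0, (inputMemory G red 0).arr 1⟩

theorem address_inj {i j u v : Fin n} (h : (u : ℤ) * n + v = (i : ℤ) * n + j) : u = i ∧ v = j := by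
  have h' : (u : ℕ) * n + v = i * n + j := by exact_mod_cast h
  have h1 : (v : ℕ) = j := by
    have := congrArg (· % n) h'
    simpa [Nat.mul_add_mod', Nat.mod_eq_of_lt v.2, Nat.mod_eq_of_lt j.2] using this
  refine ⟨Fin.ext (Nat.eq_of_mul_eq_mul_right (by have := u.2; omega : 0 < n) (by omega)), Fin.ext h1⟩

theorem inst_a_pos (u v : Fin n) :
    0 < (inst G red).a ((u : ℕ) * n + (v : ℕ)) ↔ G.Adj u v := by
  have : (∃ i j : Fin n, ((u : ℕ) : ℤ) * n + (v : ℕ) = (i : ℤ) * n + j ∧ G.Adj i j) ↔ G.Adj u v := by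
    constructor
    · rintro ⟨i, j, h, hG⟩
      obtain ⟨rfl, rfl⟩ := address_inj h
      exact hG
    · exact fun h => ⟨u, v, rfl, h⟩
  rw [← this]
  simp only [inst, inputMemory, if_true]
  split_ifs with h
  · exact iff_of_true zero_lt_one h
  · exact iff_of_false (lt_irrefl _) h

theorem inst_r_pos (u v : Fin n) :
    0 < (inst G red).r ((u : ℕ) * n + (v : ℕ)) ↔ s(u, v) ∈ red := by
  have : (∃ i j : Fin n, ((u : ℕ) : ℤ) * n + (v : ℕ) = (i : ℤ) * n + j ∧ s(i, j) ∈ red) ↔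
      s(u, v) ∈ red := by
    constructor
    · rintro ⟨i, j, h, hG⟩
      obtain ⟨rfl, rfl⟩ := address_inj h
      exact hG
    · exact fun h => ⟨u, v, rfl, h⟩
  rw [← this]
  simp only [inst, inputMemory, if_true, one_ne_zero, if_false]
  split_ifs with h
  · exact iff_of_true zero_lt_one h
  · exact iff_of_false (lt_irrefl _) h

open Classical in
theorem inst_cost_left (u v : Fin n) : (inst G red).cost u v =
    if G.Adj u v then (if s(u, v) ∈ red then 1 else 0) else ((inst G red).K : ℤ) := by
  have hn : (inst G red).n = n := rfl
  simp only [Inst.cost, hn, u.2, v.2, if_true, inst_a_pos, inst_r_pos]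

theorem inst_cost_rung (u v : Fin n) : (inst G red).cost u (n + v : ℕ) =
    if u = v then ((inst G red).N : ℤ) else (inst G red).K := by
  have hn : (inst G red).n = n := rfl
  have h : (n + v = u + n) ↔ u = v := by rw [Fin.ext_iff]; omega
  simp only [Inst.cost, hn, u.2, if_true, if_neg (show ¬ n + (v : ℕ) < n by omega), h]

theorem inst_cost_rung' (u v : Fin n) : (inst G red).cost (n + u : ℕ) v =
    if u = v then ((inst G red).N : ℤ) else (inst G red).K := by
  have hn : (inst G red).n = n := rfl
  have h : (n + u = v + n) ↔ u = v := by rw [Fin.ext_iff]; omega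
  simp only [Inst.cost, hn, v.2, if_true, if_neg (show ¬ n + (u : ℕ) < n by omega), h]

open Classical in
theorem inst_cost_right (u v : Fin n) : (inst G red).cost (n + u : ℕ) (n + v : ℕ) =
    if G.Adj u v then 0 else ((inst G red).K : ℤ) := by
  have hn : (inst G red).n = n := rfl
  have e : ∀ w : Fin n, ((n + w : ℕ) : ℤ) - n = (w : ℕ) := fun w => by omega
  simp only [Inst.cost, hn, if_neg (show ¬ n + (v : ℕ) < n by omega),
    if_neg (show ¬ n + (u : ℕ) < n by omega), e, inst_a_pos]

/-- The prism over `G` as a weighted bipartite graph. -/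
noncomputable def prism (G : SimpleGraph (Fin n)) (red : Set (Sym2 (Fin n))) (C : G.Coloring Bool) :
    CostGraph (Fin (n + n)) where
  c u v := (inst G red).cost u v
  K := (inst G red).K
  N := (inst G red).N
  -- The colours are swapped in the second copy so that the rungs, too, join different colours.
  col := Fin.addCases (fun i => C i) fun i => !C i
  symm u v := by
    classical
    refine Fin.addCases (fun i => ?_) (fun i => ?_) u <;>
      refine Fin.addCases (fun j => ?_) (fun j => ?_) v
    · change (inst G red).cost i j = (inst G red).cost j i
      rw [inst_cost_left, inst_cost_left, Sym2.eq_swap]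
      exact if_congr (G.adj_comm i j) rfl rfl
    · change (inst G red).cost i (n + j : ℕ) = (inst G red).cost (n + j : ℕ) i
      rw [inst_cost_rung, inst_cost_rung']
      exact if_congr eq_comm rfl rfl
    · change (inst G red).cost (n + i : ℕ) j = (inst G red).cost j (n + i : ℕ)
      rw [inst_cost_rung, inst_cost_rung']
      exact if_congr eq_comm rfl rfl
    · change (inst G red).cost (n + i : ℕ) (n + j : ℕ) = (inst G red).cost (n + j : ℕ) (n + i : ℕ)
      rw [inst_cost_right, inst_cost_right]
      exact if_congr (G.adj_comm i j) rfl rfl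
  nonneg u v := by
    unfold Inst.cost
    split_ifs <;> positivity
  le u v h := by
    have hN : (1 : ℤ) ≤ (inst G red).N := by unfold Inst.N; push_cast; omega
    unfold Inst.cost at h ⊢
    split_ifs at h ⊢ <;> omega
  col_ne u v := by
    refine Fin.addCases (fun i => ?_) (fun i => ?_) u <;>
      refine Fin.addCases (fun j => ?_) (fun j => ?_) v
    · rw [Fin.addCases_left, Fin.addCases_left]
      intro h
      change (inst G red).cost i j < _ at h
      rw [inst_cost_left] at h
      split_ifs at h with hG
      · exact C.valid hG
      · exact C.valid hG
      · exact absurd h (lt_irrefl _)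
    · rw [Fin.addCases_left, Fin.addCases_right]
      intro h
      change (inst G red).cost i (n + j : ℕ) < _ at h
      rw [inst_cost_rung] at h
      split_ifs at h with hG
      · simp [hG]
      · exact absurd h (lt_irrefl _)
    · rw [Fin.addCases_left, Fin.addCases_right]
      intro h
      change (inst G red).cost (n + i : ℕ) j < _ at h
      rw [inst_cost_rung'] at h
      split_ifs at h with hG
      · simp [hG]
      · exact absurd h (lt_irrefl _)
    · rw [Fin.addCases_right, Fin.addCases_right]
      intro h
      change (inst G red).cost (n + i : ℕ) (n + j : ℕ) < _ at h
      rw [inst_cost_right] at h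
      split_ifs at h with hG
      · simpa using C.valid hG
      · exact absurd h (lt_irrefl _)

theorem represents_prism (C : G.Coloring Bool) : (inst G red).Represents (prism G red C) :=
  ⟨fun _ _ => rfl, rfl, rfl⟩

/-- A matching of the prism without rungs contains `M` in the first copy of the graph. -/
theorem redCount_eq_cost {C : G.Coloring Bool} {μ : Fin (n + n) → Fin (n + n)}
    (hM : (prism G red C).Matching μ) (hR : Rungless (inst G red) μ) {M : G.Subgraph}
    (hA : ∀ u v : Fin n, M.Adj u v ↔ (μ (Fin.castAdd n u) : ℕ) = v) :
    (redCount red M : ℤ) = (prism G red C).cost μ := by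
  classical
  have hcol := hM.col_ne
  -- Counting each matching edge at its smaller end, instead of at its coloured end, fits the count
  -- of unordered red edges.
  rw [← hM.sum_eq_cost (fun v => v < μ v)]
  swap
  · intro v
    have hne : μ v ≠ v := fun h => by have := hcol v; rw [h] at this; simp at this
    rw [hM.invol, not_lt]
    exact ⟨fun h => h.le, fun h => lt_of_le_of_ne h hne⟩
  have hf : ∀ u : Fin n, (μ (Fin.castAdd n u) : ℕ) < n := fun u => hR (Fin.castAdd n u) u.2
  let f : Fin n → Fin n := fun u => ⟨μ (Fin.castAdd n u), hf u⟩
  have hfμ : ∀ u, μ (Fin.castAdd n u) = Fin.castAdd n (f u) := fun u => rfl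
  have hff : ∀ u, f (f u) = u := by
    intro u
    apply Fin.castAdd_injective n n
    rw [← hfμ, ← hfμ, hM.invol]
  have hAf : ∀ u v, M.Adj u v ↔ f u = v := fun u v => by rw [hA, Fin.ext_iff]
  have hsum : ∑ v with v < μ v, (prism G red C).c v (μ v) =
      ∑ u : Fin n, if u < f u ∧ s(u, f u) ∈ red then 1 else 0 := by
    rw [Finset.sum_filter, Fin.sum_univ_add]
    -- A rungless matching pairs the second copy within itself, and edges there are free.
    have h2 : ∀ u : Fin n, (if Fin.natAdd n u < μ (Fin.natAdd n u) then
        (prism G red C).c (Fin.natAdd n u) (μ (Fin.natAdd n u)) else 0) = 0 := by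
      intro u
      have h3 := hM.lt (Fin.natAdd n u)
      have h4 : ¬ (μ (Fin.natAdd n u) : ℕ) < n := fun h => by
        have := hR _ h
        rw [hM.invol] at this
        simp [inst] at this
      obtain ⟨w, hw⟩ : ∃ w : Fin n, μ (Fin.natAdd n u) = Fin.natAdd n w :=
        ⟨⟨μ (Fin.natAdd n u) - n, by omega⟩, Fin.ext <| by
          change (μ (Fin.natAdd n u) : ℕ) = n + (μ (Fin.natAdd n u) - n)
          omega⟩
      rw [hw] at h3 ⊢
      have e : (prism G red C).c (Fin.natAdd n u) (Fin.natAdd n w) =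
        (inst G red).cost (n + u : ℕ) (n + w : ℕ) := rfl
      rw [e, inst_cost_right] at h3 ⊢
      split_ifs at h3 ⊢
      · rfl
      · exact absurd h3 (lt_irrefl _)
      · rfl
      · rfl
    rw [Finset.sum_congr rfl fun u _ => h2 u, Finset.sum_const_zero, add_zero]
    refine Finset.sum_congr rfl fun u _ => ?_
    have e : (prism G red C).c (Fin.castAdd n u) (Fin.castAdd n (f u)) =
      (inst G red).cost u (f u) := rfl
    rw [hfμ, e, inst_cost_left, if_pos (M.adj_sub ((hAf u _).2 rfl))]
    simp only [Fin.lt_def, Fin.val_castAdd, ite_and]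
  rw [hsum, Finset.sum_boole, redCount]
  norm_cast
  have himg : M.edgeSet ∩ red =
      (fun u => s(u, f u)) '' (Finset.univ.filter fun u => u < f u ∧ s(u, f u) ∈ red : Finset _) := by
    ext e
    induction e using Sym2.ind with
    | _ a b =>
    simp only [Set.mem_inter_iff, SimpleGraph.Subgraph.mem_edgeSet, Set.mem_image,
      Finset.coe_filter, Finset.mem_univ, true_and, Set.mem_ofPred_eq, hAf]
    constructor
    · rintro ⟨rfl, hr⟩
      have hne : a ≠ f a := (M.adj_sub ((hAf a _).2 rfl)).ne
      rcases lt_or_gt_of_ne hne with h | h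
      · exact ⟨a, ⟨h, hr⟩, rfl⟩
      · exact ⟨f a, ⟨by rwa [hff], by rwa [hff, Sym2.eq_swap]⟩, by rw [hff, Sym2.eq_swap]⟩
    · rintro ⟨u, ⟨hu, hr⟩, he⟩
      rw [← he]
      refine ⟨?_, hr⟩
      rcases Sym2.eq_iff.1 he with ⟨rfl, rfl⟩ | ⟨rfl, rfl⟩
      · rfl
      · exact hff u
  rw [himg, Set.InjOn.ncard_image, Set.ncard_coe_finset]
  intro u hu w hw he
  simp only [Finset.coe_filter, Finset.mem_univ, true_and, Set.mem_ofPred_eq] at hu hw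
  rcases Sym2.eq_iff.1 he with ⟨h, -⟩ | ⟨h1, h2⟩
  · exact h
  · have h3 := hu.1
    have h4 := hw.1
    rw [h2, h1] at h3
    exact absurd h3 h4.asymm

/-- The restriction of a rungless matching to the first copy is a perfect matching of `G`, and its
red count is the whole cost. -/
theorem isSolution_of_solves {C : G.Coloring Bool} {k : ℤ} {μ : Fin (n + n) → Fin (n + n)}
    (hM : (prism G red C).Matching μ) (hS : Solves (inst G red) (prism G red C) k μ) :
    ∃ M : G.Subgraph, IsSolution red k M ∧
      ∀ u v : Fin n, M.Adj u v ↔ (μ (Fin.castAdd n u) : ℕ) = v := by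
  classical
  obtain ⟨hR, hk, hp⟩ := hS
  replace hp : (k - (prism G red C).cost μ) % 2 = 0 := hp
  have hf : ∀ u : Fin n, (μ (Fin.castAdd n u) : ℕ) < n := fun u => hR (Fin.castAdd n u) u.2
  let M : G.Subgraph :=
    { verts := Set.univ
      Adj := fun u v => (μ (Fin.castAdd n u) : ℕ) = v
      adj_sub := by
        intro u v h
        have h1 := hM.lt (Fin.castAdd n u)
        have h2 : μ (Fin.castAdd n u) = Fin.castAdd n v := Fin.ext h
        have e : (prism G red C).c (Fin.castAdd n u) (Fin.castAdd n v) =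
          (inst G red).cost u v := rfl
        rw [h2, e, inst_cost_left] at h1
        by_contra hG
        rw [if_neg hG] at h1
        exact absurd h1 (lt_irrefl _)
      edge_vert := fun _ => Set.mem_univ _
      symm := ⟨fun u v h => by
        have h2 : μ (Fin.castAdd n u) = Fin.castAdd n v := Fin.ext h
        rw [← h2, hM.invol]
        rfl⟩ }
  have hA : ∀ u v : Fin n, M.Adj u v ↔ (μ (Fin.castAdd n u) : ℕ) = v := fun _ _ => Iff.rfl
  have hc := redCount_eq_cost hM hR hA
  refine ⟨M, ⟨⟨fun u _ => ⟨⟨_, hf u⟩, rfl, fun v hv => Fin.ext ?_⟩, fun u => Set.mem_univ u⟩, ?_, ?_⟩, hA⟩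
  · exact ((hA u v).1 hv).symm
  · rw [hc]; exact hk
  · rw [hc]
    exact (Int.emod_eq_emod_iff_emod_sub_eq_zero.2 hp).symm

/-- The solution is copied into both halves of the prism. The second half only serves to make the
matching perfect and costs nothing. -/
theorem solves_of_isSolution (C : G.Coloring Bool) {k : ℤ} {M : G.Subgraph}
    (hS : IsSolution red k M) :
    ∃ μ, (prism G red C).Matching μ ∧ Solves (inst G red) (prism G red C) k μ := by
  classical
  obtain ⟨⟨hm, hs⟩, hk, hp⟩ := hS
  choose f hf hf' using fun u => hm (hs u)
  have hAf : ∀ u v, M.Adj u v ↔ f u = v := fun u v => ⟨fun h => (hf' u v h).symm, fun h => h ▸ hf u⟩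
  have hff : ∀ u, f (f u) = u := fun u => (hAf _ _).1 (hf u).symm
  let μ : Fin (n + n) → Fin (n + n) :=
    Fin.addCases (fun i => Fin.castAdd n (f i)) fun i => Fin.natAdd n (f i)
  have hμl : ∀ i, μ (Fin.castAdd n i) = Fin.castAdd n (f i) := fun i => Fin.addCases_left i
  have hμr : ∀ i, μ (Fin.natAdd n i) = Fin.natAdd n (f i) := fun i => Fin.addCases_right i
  have hK : (1 : ℤ) < (inst G red).K := by
    have h1 := (inst G red).N_lt_K
    have h2 : 2 ≤ (inst G red).N := by unfold Inst.N; omega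
    omega
  have hM : (prism G red C).Matching μ := by
    refine ⟨fun v => ?_, fun v => ?_⟩
    · refine Fin.addCases (fun i => ?_) (fun i => ?_) v
      · rw [hμl, hμl, hff]
      · rw [hμr, hμr, hff]
    · refine Fin.addCases (fun i => ?_) (fun i => ?_) v
      · have e : (prism G red C).c (Fin.castAdd n i) (Fin.castAdd n (f i)) =
          (inst G red).cost i (f i) := rfl
        rw [hμl, e, inst_cost_left, if_pos (M.adj_sub (hf i))]
        change _ < ((inst G red).K : ℤ)
        split_ifs <;> omega
      · have e : (prism G red C).c (Fin.natAdd n i) (Fin.natAdd n (f i)) =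
          (inst G red).cost (n + i : ℕ) (n + f i : ℕ) := rfl
        rw [hμr, e, inst_cost_right, if_pos (M.adj_sub (hf i))]
        change _ < ((inst G red).K : ℤ)
        omega
  have hR : Rungless (inst G red) μ := by
    intro v hv
    change ((μ (Fin.castAdd n ⟨v, hv⟩) : Fin (n + n)) : ℕ) < n
    rw [hμl]
    exact (f _).2
  have hc := redCount_eq_cost hM hR (M := M) fun u v => by rw [hAf, hμl, Fin.ext_iff]; rfl
  rw [hc] at hk hp
  refine ⟨μ, hM, hR, hk, ?_⟩
  exact Int.emod_eq_emod_iff_emod_sub_eq_zero.1 (Eq.symm hp)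

end

/-! ### Assembling the algorithm and its time bound. -/

theorem eval_mono (p : Polynomial ℕ) {a b : ℕ} (h : a ≤ b) : p.eval a ≤ p.eval b := by
  rw [Polynomial.eval_eq_sum_range, Polynomial.eval_eq_sum_range]
  exact Finset.sum_le_sum fun i _ => Nat.mul_le_mul_left _ (Nat.pow_le_pow_left h i)

/-- The algorithm. -/
def algorithm : Program := .seq prelude (Stm.main.compile 3)

open Polynomial in
/-- A bound for its running time. -/
noncomputable def algorithmTime : ℕ[X] := 5 * X + 10 + Stm.main.time.comp (2 * X + 2)

theorem ends_algorithm {n : ℕ} (G : SimpleGraph (Fin n)) (red : Set (Sym2 (Fin n))) (k : ℤ)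
    (hG : G.IsBipartite) : Ends algorithm (inputMemory G red k)
      (algorithmTime.eval (inputSize n k)) (IsCorrectOutput G red k) := by
  obtain ⟨C⟩ : Nonempty (G.Coloring Bool) := by
    obtain ⟨C⟩ := hG
    exact ⟨SimpleGraph.Coloring.mk (fun v => decide (C v = 0)) fun {u v} h => by
      have := C.valid h
      simp only [ne_eq, decide_eq_decide]
      omega⟩
  have h := ends_prelude (s := inputMemory G red k) (n := n) (k := k) (by simp [inputMemory])
    (by simp [inputMemory]) (by simp [inputMemory])
  have e : algorithmTime.eval (inputSize n k) =
      5 * inputSize n k + 10 + Stm.main.time.eval (2 * inputSize n k + 2) := by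
    simp [algorithmTime]
  rw [e]
  refine .seq (h.mono (by unfold inputSize; omega) ?_)
  rintro s ⟨B, hB, hB', hs, h0, h1, h2, ha, hk⟩
  -- The stack starts at level 3 because registers 1, 3 and 5 hold constants. The bound B is at most
  -- 2n + 2 plus the binary length of k, hence at most twice the input size plus 2.
  refine (Stm.ends_compile B .main 3 s le_rfl hs).mono (eval_mono _ (by unfold inputSize; omega)) ?_
  intro s' hs'
  have main := eval_main (represents_prism (red := red) C) (s := s.view) hB h0 h1 h2
    (by rw [ha]; rfl) (by rw [ha]; rfl) hk
  rw [← hs'.view] at main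
  rcases main with ⟨h0', μ, hM, hS, hμ⟩ | ⟨h0', hμ⟩
  · obtain ⟨M, hM', hA⟩ := isSolution_of_solves (n := n) hM hS
    refine Or.inl ⟨h0', M, hM', fun u v => ?_⟩
    have h3 : s'.arr 2 ((u : ℕ) : ℤ) = ext μ u := hμ u (Nat.lt_add_right n u.2)
    have h4 : ext μ (u : ℕ) = μ (Fin.castAdd n u) := ext_val μ (Fin.castAdd n u)
    rw [hA, h3, h4]
    norm_cast
  · refine Or.inr ⟨h0', ?_⟩
    rintro ⟨M, hM⟩
    obtain ⟨μ, hM', hS⟩ := solves_of_isSolution C hM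
    exact hμ μ hM' hS

end BCPM

theorem mainTheorem5 :
    ∃ (P : BCPM.Program) (p : Polynomial ℕ),
      ∀ (n : ℕ) (G : SimpleGraph (Fin n)) (red : Set (Sym2 (Fin n))) (k : ℤ),
        G.IsBipartite → red ⊆ G.edgeSet →
          ∃ (t : ℕ) (s : BCPM.Memory),
            BCPM.Run P (BCPM.inputMemory G red k) t s ∧
            t ≤ p.eval (BCPM.inputSize n k) ∧
            BCPM.IsCorrectOutput G red k s := by
  refine ⟨BCPM.algorithm, BCPM.algorithmTime, fun n G red k hG _ => ?_⟩
  obtain ⟨t, ht, s, hr, hs⟩ := BCPM.ends_algorithm G red k hG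
  exact ⟨t, s, hr, ht, hs⟩
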